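/- **Setting.** Let $q>1$ be a fixed integer, $\beta\in\mathbb R^q$ fixed, and $p=p_n>n$ for all large $n$. For every sample size $n$ we have, on a probability space that may depend on $n$, random $Z\in\mathbb R^{n\times p}$, $N,H\in\mathbb R^{n\times q}$, $\mu,\epsilon\in\mathbb R^n$, and $$X=N+H,\qquad Y=X\beta+\mu+\epsilon .$$ (The dependence on $n$ is suppressed; $Z,N,\mu$ may in particular be deterministic.) Write $A_j$ for the $j$-th column of a matrix $A$, and $\|\cdot\|$ for the Euclidean norm. For $u\in\mathbb N$ let $\mathcal M_u=\{m\subseteq\{1,\dots,p\}:|m|=u\}$; for $m\in\mathcal M_u$ let $Z_m$ be the submatrix of $Z$ with the columns in $m$, and let $P_m^\perp$ be the orthogonal projection onto the orthogonal complement of the column space of $Z_m$. A sequence of random vectors $v=v_n\in\mathbb R^n$ is *weakly sparse relative to $Z$ with sparsity $s=s_n$ at rate $\sqrt n$* if there are deterministic $m_n\in\mathcal M_{s_n}$ with $\|P_{m_n}^\perp v_n\|^2=o_{\mathbb P}(\sqrt n)$ (for deterministic sequences: $o(\sqrt n)$). A real random variable $\xi$ is *sub-Gaussian with parameter $K$*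 if $\mathbb E e^{\lambda\xi}\le e^{K^2\lambda^2/2}$ for all $\lambda\in\mathbb R$ (in particular $\mathbb E\xi=0$). **Estimator.** Given $v\in\mathbb R^n$, $u\in\mathbb N$ and $\alpha>0$, put $$w_m=\frac{\exp(-\|P_m^\perp v\|^2/\alpha)}{\sum_{k\in\mathcal M_u}\exp(-\|P_k^\perp v\|^2/\alpha)},\qquad \hat\theta(v;u,\alpha)=\sum_{m\in\mathcal M_u}w_m\,\hat\theta_m(v)\in\mathbb R^p,$$ where $\hat\theta_m(v)=(Z_m^{\mathsf T}Z_m)^{-}Z_m^{\mathsf T}v$ (generalized inverse), extended by $0$ outside $m$. Let $\hat\theta_{EW}=\hat\theta(Y;u_\theta,\alpha_Y)$, let $\hat\Delta_{EW}\in\mathbb R^{p\times q}$ have columns $\hat\theta(X_j;u_{\delta,j},\alpha_{X,j})$, $1\le j\le q$, and $$\hat\beta_{EW}=\big((X-Z\hat\Delta_{EW})^{\mathsf T}(X-Z\hat\Delta_{EW})\big)^{-1}(X-Z\hat\Delta_{EW})^{\mathsf T}(Y-Z\hat\theta_{EW}).$$ **Assumptions.** (B1) $\|\mu\|^2=O_{\mathbb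 P}(n)$ and $\|N_j\|^2=O_{\mathbb P}(n)$ for $1\le j\le q$. (B2) For each $n$, the $n$ rows of $H$ and the $n$ entries of $\epsilon$ are mutually independent, and $(H,\epsilon)$ is independent of $(Z,\mu,N)$. For each $j$ the entries $H_{1j},\dots,H_{nj}$ are identically distributed and sub-Gaussian with parameter $K_{\eta,j}$; the entries of $\epsilon$ are identically distributed and sub-Gaussian with parameter $K_\epsilon$. Every row of $H$ has covariance matrix $\Sigma_H$, which is invertible, and every entry of $\epsilon$ has variance $\sigma_\epsilon^2$. Here $K_{\eta,j},K_\epsilon,\Sigma_H,\sigma_\epsilon^2$ do not depend on $n$. (B3) $\mu$, $N_j$ ($1\le j\le q$) and $N\beta+\mu$ are weakly sparse relative to $Z$ at rate $\sqrt n$ with sparsities $s_\gamma$, $s_{\delta,j}$ and $s_\theta$ respectively. For all large $n$, $u_\gamma\ge s_\gamma$, $u_{\delta,j}\ge s_{\delta,j}$ ($1\le j\le q$) and $u_\theta\ge s_\theta$; moreover $\max\big(u_\gamma,\max_j u_{\delta,j},u_\theta\big)=o(\sqrt n/\log p)$. The constants $\alpha_Y$, $\alpha_{X,j}$ do not depend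 on $n$ and satisfy $\alpha_Y>4K_\epsilon^2$ and $\alpha_{X,j}>4K_{\eta,j}^2$. **Theorem.** Under (B1)–(B3), $$\sqrt n\,(\hat\beta_{EW}-\beta)\ \xrightarrow{d}\ \mathcal N_q\big(0,\ \sigma_\epsilon^2\,\Sigma_H^{-1}\big)\qquad(n\to\infty).$$ -/

import Mathlib

open MeasureTheory ProbabilityTheory Filter Asymptotics Matrix
open scoped Topology NNReal

namespace ExpWeights

noncomputable section

/-- The collection `𝓜_u` of all models (subsets of the `p` columns) of size `u`. -/
def models (p u : ℕ) : Finset (Finset (Fin p)) :=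
  (Finset.univ : Finset (Fin p)).powersetCard u

/-- The column space of `Z_m`, the submatrix of `Z` with the columns indexed by `m`. -/
def colSpace {n p : ℕ} (Z : Matrix (Fin n) (Fin p) ℝ) (m : Finset (Fin p)) :
    Submodule ℝ (EuclideanSpace ℝ (Fin n)) :=
  Submodule.span ℝ ((fun j => WithLp.toLp 2 (Z.col j)) '' (m : Set (Fin p)))

/-- `‖P_m^⊥ v‖²` (Euclidean norm), where `P_m^⊥` is the orthogonal projection onto the
orthogonal complement of the column space of `Z_m`. -/
def rss {n p : ℕ} (Z : Matrix (Fin n) (Fin p) ℝ) (m : Finset (Fin p)) (v : Fin n → ℝ) : ℝ :=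
  ‖(colSpace Z m)ᗮ.starProjection (WithLp.toLp 2 v)‖ ^ 2

/-- The generalized (Moore-Penrose) inverse of a real symmetric matrix: all nonzero eigenvalues
are inverted, and the eigenvalue zero is kept. -/
def ginv {k : Type*} [Fintype k] [DecidableEq k] (A : Matrix k k ℝ) : Matrix k k ℝ :=
  cfc (fun x : ℝ => x⁻¹) A

theorem mul_ginv_mul {k : Type*} [Fintype k] [DecidableEq k] {A : Matrix k k ℝ}
    (hA : A.IsHermitian) : A * ginv A * A = A := by
  have hA' : IsSelfAdjoint A := hA
  have hc : ∀ f : ℝ → ℝ, ContinuousOn f (spectrum ℝ A) := fun f =>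
    (Matrix.finite_real_spectrum (A := A)).continuousOn f
  have h1 : cfc (fun x : ℝ => x) A = A := cfc_id' ℝ A
  calc A * ginv A * A
      = cfc (fun x : ℝ => x) A * cfc (fun x : ℝ => x⁻¹) A * cfc (fun x : ℝ => x) A := by
        rw [h1, ginv]
    _ = cfc (fun x : ℝ => x * x⁻¹ * x) A := by
        rw [← cfc_mul _ _ A (hc _) (hc _), ← cfc_mul _ _ A (hc _) (hc _)]
    _ = cfc (fun x : ℝ => x) A := by
        congr 1
        funext x
        exact mul_inv_mul_cancel x
    _ = A := h1

/-- The least-squares coefficient vector `(Z_mᵀ Z_m)⁻ Z_mᵀ v` of the regression of `v` on the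
columns of `Z` in `m`, extended by zero to a vector in `ℝ^p` supported on `m`. -/
def lsCoef {n p : ℕ} (Z : Matrix (Fin n) (Fin p) ℝ) (m : Finset (Fin p)) (v : Fin n → ℝ) :
    Fin p → ℝ :=
  let Zm : Matrix (Fin n) m ℝ := Z.submatrix id Subtype.val
  fun j => if h : j ∈ m then (ginv (Zmᵀ * Zm) *ᵥ (Zmᵀ *ᵥ v)) ⟨j, h⟩ else 0

/-- The exponential weight `w_m` of the model `m` among all models of size `u`, for the response
`v` and the temperature `α`. -/
def weight {n p : ℕ} (Z : Matrix (Fin n) (Fin p) ℝ) (u : ℕ) (α : ℝ) (v : Fin n → ℝ)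
    (m : Finset (Fin p)) : ℝ :=
  Real.exp (-(1 / α) * rss Z m v) / ∑ k ∈ models p u, Real.exp (-(1 / α) * rss Z k v)

/-- The exponential-weights coefficient vector `∑_{m ∈ 𝓜_u} w_m * (least squares on m)`. -/
def ewCoef {n p : ℕ} (Z : Matrix (Fin n) (Fin p) ℝ) (u : ℕ) (α : ℝ) (v : Fin n → ℝ) :
    Fin p → ℝ :=
  ∑ m ∈ models p u, weight Z u α v m • lsCoef Z m v

/-- The `p × q` matrix whose `j`-th column is the exponential-weights coefficient vector for the
regression of the `j`-th column of `X` on `Z`. -/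
def ewDelta {n p q : ℕ} (Z : Matrix (Fin n) (Fin p) ℝ) (uδ : Fin q → ℕ) (αX : Fin q → ℝ)
    (X : Matrix (Fin n) (Fin q) ℝ) : Matrix (Fin p) (Fin q) ℝ :=
  Matrix.of fun i j => ewCoef Z (uδ j) (αX j) (X.col j) i

/-- The exponential-weights estimator of `β`: least squares of the residuals `Y - Z θ̂` on the
residuals `X - Z Δ̂`. -/
def betaEW {n p q : ℕ} (Z : Matrix (Fin n) (Fin p) ℝ) (uδ : Fin q → ℕ) (αX : Fin q → ℝ)
    (uθ : ℕ) (αY : ℝ) (X : Matrix (Fin n) (Fin q) ℝ) (Y : Fin n → ℝ) : Fin q → ℝ :=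
  let R : Matrix (Fin n) (Fin q) ℝ := X - Z * ewDelta Z uδ αX X
  (Rᵀ * R)⁻¹ *ᵥ (Rᵀ *ᵥ (Y - Z *ᵥ ewCoef Z uθ αY Y))

variable {Ω : ℕ → Type*} [∀ n, MeasurableSpace (Ω n)]

/-- `V_n = O_P(a_n)`. -/
def IsBigOInProb (P : ∀ n, Measure (Ω n)) (V : ∀ n, Ω n → ℝ) (a : ℕ → ℝ) : Prop :=
  ∀ r : ℝ, 0 < r → ∃ C : ℝ, ∀ᶠ n in atTop, P n {ω | C * a n < |V n ω|} ≤ ENNReal.ofReal r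

/-- `V_n = o_P(a_n)`. -/
def IsLittleOInProb (P : ∀ n, Measure (Ω n)) (V : ∀ n, Ω n → ℝ) (a : ℕ → ℝ) : Prop :=
  ∀ r : ℝ, 0 < r → Tendsto (fun n => P n {ω | r * a n < |V n ω|}) atTop (𝓝 0)

/-- Weak sparsity (in probability) of the sequence of vectors `v` relative to `Z`, with sparsity
`s` at rate `k`: there are models `m_n` of size `s_n` with `‖P_{m_n}^⊥ v_n‖² = o_P(k_n)`. When `v`
and `Z` are not random, this says `‖P_{m_n}^⊥ v_n‖² = o(k_n)`. -/
def WeaklySparse (P : ∀ n, Measure (Ω n)) {p : ℕ → ℕ}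
    (Z : ∀ n, Ω n → Fin n → Fin (p n) → ℝ) (v : ∀ n, Ω n → Fin n → ℝ)
    (s : ℕ → ℕ) (k : ℕ → ℝ) : Prop :=
  ∃ m : ∀ n, Finset (Fin (p n)), (∀ n, m n ∈ models (p n) (s n)) ∧
    IsLittleOInProb P (fun n ω => rss (Matrix.of (Z n ω)) (m n) (v n ω)) k

end

end ExpWeights

/-! Write `e j` for the error of the exponential-weights fit of `N_j` from `X_j = N_j + H_j`, and
`e₀` for the error of the fit of `Nβ + μ` from `Y = (Nβ + μ) + (Hβ + ε)`. Then `X - ZΔ̂ = H + e =: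
R` and `Y - Zθ̂ = Rβ + r` with `r = ε + e₀ - ∑ β_k e_k`, so `β̂ - β = (RᵀR)⁻¹ Rᵀr` whenever `RᵀR` is
invertible (`betaEW_sub_eq`). It remains to show that `RᵀR / n → Σ_H` and `Rᵀr / √n = Hᵀε / √n +
o_P(1)`, and to apply a central limit theorem to `Hᵀε / √n`.

Both claims follow once the squared norms of the errors and their inner products with the columns of
`H`, and those of `e` with `ε`, are `o_P(√n)`. Cauchy-Schwarz between noise and error is too weak
for the score, and the weights depend on the same noise. The remedy is a bound uniform over models.
Let `T` dominate `‖P_V h‖²` for all `V = span(Z_m, f)`, `|m| = u`, and all noise vectors `h`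
involved. The Gibbs variational bound `sum_gibbs_weight_mul_le` compares the weighted residual sum
of squares with that of any one model, at the price `α log |𝓜_u|`. Since `P_m^⊥ f` lies in `V`,
cross terms between noise and bias are absorbed into `T` and a fraction of the squared bias. This
gives a deterministic oracle inequality (`fitError_bounds`): every quantity above is at most `3
‖P_{m₀}^⊥ f‖² + 12 T + 2 α u log p`. The first term is `o_P(√n)` by weak sparsity, the last by the
growth condition on `u`.

For `T`, a sub-Gaussian vector projected on a fixed space of dimension at most `d` has tail `K^d
e^{-lt}` (`exists_tail_constants`). Independence of noise and design allows the random spaces to be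
frozen, and a union bound over at most `p^u` models gives `T = o_P(√n)` (`isLittleOInProb_supProj`).

The limit law comes from characteristic functions: a triangular-array central limit theorem for
fixed linear combinations of the score, a Slutsky step, and Lévy continuity. -/

namespace ExpWeights

/-! ### Least-squares fits as orthogonal projections -/

section LeastSquares

variable {n p : ℕ}

/-- With `G = AᵀA`, the matrix `D = (G G⁻ - 1)Aᵀ` satisfies `D A = 0` by `G G⁻ G = G`, hence `D Dᵀ =
0` and `D = 0`. No rank condition on the columns is involved. -/
theorem gram_mul_ginv_mul_transpose {k : Type*} [Fintype k] [DecidableEq k]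
    (A : Matrix (Fin n) k ℝ) : (Aᵀ * A) * ginv (Aᵀ * A) * Aᵀ = Aᵀ := by
  have hH : (Aᵀ * A).IsHermitian := by
    simpa [Matrix.conjTranspose_eq_transpose_of_trivial] using
      Matrix.isHermitian_conjTranspose_mul_self A
  have h := mul_ginv_mul hH
  set G := Aᵀ * A with hG
  have h0 : (G * ginv G * Aᵀ - Aᵀ) * (G * ginv G * Aᵀ - Aᵀ)ᵀ = 0 := by
    have e1 : G * ginv G * Aᵀ - Aᵀ = (G * ginv G - 1) * Aᵀ := by
      rw [Matrix.sub_mul, Matrix.one_mul]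
    have e2 : (G * ginv G - 1) * Aᵀ * A = 0 := by
      rw [Matrix.mul_assoc, ← hG, Matrix.sub_mul, Matrix.one_mul, h, sub_self]
    rw [e1, Matrix.transpose_mul, Matrix.transpose_transpose, ← Matrix.mul_assoc, e2,
      Matrix.zero_mul]
  have h1 := (Matrix.self_mul_conjTranspose_eq_zero (A := G * ginv G * Aᵀ - Aᵀ)).1
    (by simpa only [Matrix.conjTranspose_eq_transpose_of_trivial] using h0)
  exact sub_eq_zero.1 h1

/-- The normal equations make the residual orthogonal to every column in `m`. From here on the
generalized inverse matters only through this projection. -/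
theorem mulVec_lsCoef (Z : Matrix (Fin n) (Fin p) ℝ) (m : Finset (Fin p)) (v : Fin n → ℝ) :
    WithLp.toLp 2 (Z *ᵥ lsCoef Z m v) = (colSpace Z m).starProjection (WithLp.toLp 2 v) := by
  set A : Matrix (Fin n) m ℝ := Z.submatrix id Subtype.val with hA
  set c : m → ℝ := ginv (Aᵀ * A) *ᵥ (Aᵀ *ᵥ v) with hc
  have h1 : Z *ᵥ lsCoef Z m v = A *ᵥ c := by
    funext i
    simp only [Matrix.mulVec, dotProduct]
    rw [← Finset.sum_subset (Finset.subset_univ m)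
      (fun j _ hj => by simp [lsCoef, hj]), ← Finset.sum_coe_sort m]
    refine Finset.sum_congr rfl fun j _ => ?_
    simp only [lsCoef, j.2, dite_true, hA, Matrix.submatrix_apply, id]
    rfl
  have h2 : Aᵀ *ᵥ (v - A *ᵥ c) = 0 := by
    rw [Matrix.mulVec_sub, hc, Matrix.mulVec_mulVec, Matrix.mulVec_mulVec, Matrix.mulVec_mulVec,
      gram_mul_ginv_mul_transpose, sub_self]
  rw [h1]
  symm
  refine Submodule.eq_starProjection_of_mem_of_inner_eq_zero ?_ ?_
  · have : WithLp.toLp 2 (A *ᵥ c) = ∑ j : m, c j • WithLp.toLp 2 (Z.col j) := by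
      ext i
      simp [Matrix.mulVec, dotProduct, hA, mul_comm, Matrix.col]
    rw [this]
    exact Submodule.sum_mem _ fun j _ => Submodule.smul_mem _ _
      (Submodule.subset_span ⟨j, j.2, rfl⟩)
  · intro w hw
    induction hw using Submodule.span_induction with
    | mem x hx =>
      obtain ⟨j, hj, rfl⟩ := hx
      have := congrFun h2 ⟨j, hj⟩
      simp only [Matrix.mulVec, dotProduct, Matrix.transpose_apply, hA, Matrix.submatrix_apply,
        id, Pi.zero_apply, Pi.sub_apply] at this
      simpa [PiLp.inner_apply, Matrix.col, Matrix.mulVec, dotProduct, hA] using this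
    | zero => simp
    | add x y _ _ hx hy => rw [inner_add_right, hx, hy, add_zero]
    | smul a x _ hx => rw [inner_smul_right, hx, mul_zero]

theorem mulVec_ewCoef (Z : Matrix (Fin n) (Fin p) ℝ) (u : ℕ) (α : ℝ) (v : Fin n → ℝ) :
    WithLp.toLp 2 (Z *ᵥ ewCoef Z u α v) =
      ∑ m ∈ models p u, weight Z u α v m • (colSpace Z m).starProjection (WithLp.toLp 2 v) := by
  simp only [ewCoef, ← mulVec_lsCoef, Matrix.mulVec_sum, Matrix.mulVec_smul, WithLp.toLp_sum,
    WithLp.toLp_smul]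

theorem colSpace_mono (Z : Matrix (Fin n) (Fin p) ℝ) {m m' : Finset (Fin p)} (h : m ⊆ m') :
    colSpace Z m ≤ colSpace Z m' :=
  Submodule.span_mono (Set.image_mono (by exact_mod_cast h))

theorem norm_orthogonal_starProjection_le_of_le {E : Type*} [NormedAddCommGroup E]
    [InnerProductSpace ℝ E] {U V : Submodule ℝ E} [U.HasOrthogonalProjection]
    [V.HasOrthogonalProjection] (h : U ≤ V) (x : E) :
    ‖Vᗮ.starProjection x‖ ≤ ‖Uᗮ.starProjection x‖ := by
  have h1 := Submodule.starProjection_comp_starProjection_of_le (Submodule.orthogonal_le h)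
  rw [← h1]
  exact Submodule.norm_starProjection_apply_le _ _

theorem norm_starProjection_le_of_le {E : Type*} [NormedAddCommGroup E]
    [InnerProductSpace ℝ E] {U V : Submodule ℝ E} [U.HasOrthogonalProjection]
    [V.HasOrthogonalProjection] (h : U ≤ V) (x : E) :
    ‖U.starProjection x‖ ≤ ‖V.starProjection x‖ := by
  rw [← Submodule.starProjection_comp_starProjection_of_le h]
  exact Submodule.norm_starProjection_apply_le _ _

theorem rss_mono (Z : Matrix (Fin n) (Fin p) ℝ) {m m' : Finset (Fin p)} (h : m ⊆ m')
    (v : Fin n → ℝ) : rss Z m' v ≤ rss Z m v := by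
  unfold rss
  gcongr
  exact norm_orthogonal_starProjection_le_of_le (colSpace_mono Z h) _

theorem card_models_le (p u : ℕ) : (models p u).card ≤ p ^ u := by
  rw [models, Finset.card_powersetCard, Finset.card_univ, Fintype.card_fin]
  exact Nat.choose_le_pow p u

end LeastSquares

/-! ### Variational bound for exponential weights -/

section Gibbs

/-- The Gibbs variational bound for exponential weights. -/
theorem sum_gibbs_weight_mul_le {ι : Type*} {M : Finset ι} (r : ι → ℝ) {α : ℝ} (hα : 0 < α)
    {m₀ : ι} (hm₀ : m₀ ∈ M) :
    ∑ m ∈ M, (Real.exp (-(1 / α) * r m) / ∑ k ∈ M, Real.exp (-(1 / α) * r k)) * r m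
      ≤ r m₀ + α * Real.log M.card := by
  set S := ∑ k ∈ M, Real.exp (-(1 / α) * r k) with hS
  have hSpos : 0 < S := Finset.sum_pos (fun _ _ => Real.exp_pos _) ⟨m₀, hm₀⟩
  set w : ι → ℝ := fun m => Real.exp (-(1 / α) * r m) / S with hw
  have hwpos : ∀ m, 0 < w m := fun m => div_pos (Real.exp_pos _) hSpos
  have hwsum : ∑ m ∈ M, w m = 1 := by
    simp only [hw]
    rw [← Finset.sum_div, ← hS, div_self hSpos.ne']
  have hcard : (0 : ℝ) < M.card := by exact_mod_cast Finset.card_pos.2 ⟨m₀, hm₀⟩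
  have hr : ∀ m, r m = -α * (Real.log (w m) + Real.log S) := by
    intro m
    simp only [hw]
    rw [Real.log_div (Real.exp_pos _).ne' hSpos.ne', Real.log_exp, sub_add_cancel, ← mul_assoc,
      neg_mul_neg,
      mul_one_div_cancel hα.ne', one_mul]
  have hent : ∑ m ∈ M, w m * (-Real.log (w m)) ≤ Real.log M.card := by
    have h1 : ∀ m ∈ M, w m * (-Real.log (w m)) ≤ w m * Real.log M.card + (1 / M.card - w m) := by
      intro m _
      -- Entropy is at most `log |M|`: this is `log x ≤ x - 1` at `x = 1 / (|M| w_m)`, multiplied by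
      -- `w_m`; the correction `1/|M| - w_m` sums to zero.
      have h2 := Real.log_le_sub_one_of_pos (x := 1 / (M.card * w m))
        (one_div_pos.2 (mul_pos hcard (hwpos m)))
      rw [Real.log_div one_ne_zero (mul_pos hcard (hwpos m)).ne', Real.log_one,
        Real.log_mul hcard.ne' (hwpos m).ne'] at h2
      have h3 := mul_le_mul_of_nonneg_left h2 (hwpos m).le
      have h4 : w m * (1 / (M.card * w m) - 1) = 1 / M.card - w m := by
        rw [mul_sub, mul_one, mul_one_div, div_mul_cancel_right₀ (hwpos m).ne', one_div]
      rw [h4] at h3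
      linarith
    refine (Finset.sum_le_sum h1).trans ?_
    rw [Finset.sum_add_distrib, ← Finset.sum_mul, hwsum, Finset.sum_sub_distrib, hwsum]
    simp [hcard.ne']
  -- The normalizing sum dominates its single term at `m₀`.
  have hlogS : -Real.log S ≤ r m₀ / α := by
    have h1 : Real.exp (-(1 / α) * r m₀) ≤ S :=
      Finset.single_le_sum (f := fun k => Real.exp (-(1 / α) * r k))
        (fun _ _ => (Real.exp_pos _).le) hm₀
    have h2 := Real.log_le_log (Real.exp_pos _) h1
    rw [Real.log_exp] at h2
    have : -(1 / α) * r m₀ = -(r m₀ / α) := by ring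
    linarith
  have hfin : ∑ m ∈ M, w m * r m = α * (∑ m ∈ M, w m * (-Real.log (w m))) + α * (-Real.log S) := by
    have : ∀ m ∈ M, w m * r m = α * (w m * (-Real.log (w m))) + α * (-Real.log S) * w m := by
      intro m _
      rw [hr m]
      ring
    rw [Finset.sum_congr rfl this, Finset.sum_add_distrib, ← Finset.mul_sum, ← Finset.mul_sum,
      hwsum, mul_one]
  change ∑ m ∈ M, w m * r m ≤ _
  rw [hfin]
  have h5 : α * (-Real.log S) ≤ r m₀ := by
    have := mul_le_mul_of_nonneg_left hlogS hα.le
    rwa [mul_div_cancel₀ _ hα.ne'] at this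
  have := mul_le_mul_of_nonneg_left hent hα.le
  linarith

end Gibbs

/-! ### Deterministic oracle inequalities -/

section Oracle

theorem norm_sq_sum_smul_le {E ι : Type*} [NormedAddCommGroup E] [InnerProductSpace ℝ E]
    {M : Finset ι} {w : ι → ℝ} (hw : ∀ m ∈ M, 0 ≤ w m)
    (hw1 : ∑ m ∈ M, w m = 1) (x : ι → E) :
    ‖∑ m ∈ M, w m • x m‖ ^ 2 ≤ ∑ m ∈ M, w m * ‖x m‖ ^ 2 := by
  have hc : ConvexOn ℝ Set.univ (fun y : E => ‖y‖ ^ 2) :=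
    (convexOn_univ_norm (E := E)).pow (fun _ _ => norm_nonneg _) 2
  simpa using hc.map_sum_le hw hw1 (fun _ _ => Set.mem_univ (x _))

variable {E ι : Type*} [NormedAddCommGroup E] [InnerProductSpace ℝ E] [FiniteDimensional ℝ E]

/-- Since `P_U^⊥ f = f - P_U f` lies in `U + span f`, only the projection of `h` on that space
enters the inner product; then `ab ≤ a² + b²/4`. Adjoining `f` costs one dimension and yields
control uniform in `U`. -/
theorem abs_inner_orthogonal_starProjection_le (U : Submodule ℝ E) (f h : E) {T : ℝ}
    (hT : ‖(U ⊔ Submodule.span ℝ {f}).starProjection h‖ ^ 2 ≤ T) :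
    |inner ℝ h (Uᗮ.starProjection f)| ≤ T + ‖Uᗮ.starProjection f‖ ^ 2 / 4 := by
  set V := U ⊔ Submodule.span ℝ {f} with hV
  have hmem : Uᗮ.starProjection f ∈ V := by
    have : Uᗮ.starProjection f = f - U.starProjection f := by
      rw [Submodule.starProjection_orthogonal]; rfl
    rw [this]
    exact V.sub_mem (le_sup_right (a := U) (Submodule.mem_span_singleton_self f))
      (le_sup_left (b := Submodule.span ℝ {f}) (U.starProjection_apply_mem f))
  have h1 : inner ℝ h (Uᗮ.starProjection f)
      = inner ℝ (V.starProjection h) (Uᗮ.starProjection f) := by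
    rw [Submodule.inner_starProjection_left_eq_right,
      Submodule.starProjection_eq_self_iff.2 hmem]
  rw [h1]
  have h2 := abs_real_inner_le_norm (V.starProjection h) (Uᗮ.starProjection f)
  nlinarith [sq_nonneg (‖V.starProjection h‖ - ‖Uᗮ.starProjection f‖ / 2)]

variable {M : Finset ι} (W : ι → Submodule ℝ E) (f ξ : E)

/-- Weights attached to the residual sums of squares of `f + ξ`. -/
theorem sum_weight_mul_norm_orthogonal_sq_le {α T : ℝ} (hα : 0 < α) {m₀ : ι} (hm₀ : m₀ ∈ M)
    (hT : ∀ m ∈ M, ‖(W m ⊔ Submodule.span ℝ {f}).starProjection ξ‖ ^ 2 ≤ T) :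
    ∑ m ∈ M, (Real.exp (-(1 / α) * ‖(W m)ᗮ.starProjection (f + ξ)‖ ^ 2) /
        ∑ k ∈ M, Real.exp (-(1 / α) * ‖(W k)ᗮ.starProjection (f + ξ)‖ ^ 2)) *
          ‖(W m)ᗮ.starProjection f‖ ^ 2
      ≤ 3 * ‖(W m₀)ᗮ.starProjection f‖ ^ 2 + 10 * T + 2 * α * Real.log M.card := by
  have hg := sum_gibbs_weight_mul_le (fun m => ‖(W m)ᗮ.starProjection (f + ξ)‖ ^ 2) hα hm₀
  have hSpos : 0 < ∑ k ∈ M, Real.exp (-(1 / α) * ‖(W k)ᗮ.starProjection (f + ξ)‖ ^ 2) :=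
    Finset.sum_pos (fun _ _ => Real.exp_pos _) ⟨m₀, hm₀⟩
  set S := ∑ k ∈ M, Real.exp (-(1 / α) * ‖(W k)ᗮ.starProjection (f + ξ)‖ ^ 2) with hS
  set w : ι → ℝ := fun m => Real.exp (-(1 / α) * ‖(W m)ᗮ.starProjection (f + ξ)‖ ^ 2) / S with hw
  have hwpos : ∀ m, 0 < w m := fun m => div_pos (Real.exp_pos _) hSpos
  have hwsum : ∑ m ∈ M, w m = 1 := by
    simp only [hw]
    rw [← Finset.sum_div, ← hS, div_self hSpos.ne']
  -- The residual sum of squares splits into squared bias, cross term, and `‖ξ‖²` less the part of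
  -- the noise that the model captures.
  have hexp : ∀ m, ‖(W m)ᗮ.starProjection (f + ξ)‖ ^ 2 = ‖(W m)ᗮ.starProjection f‖ ^ 2
      + 2 * inner ℝ ξ ((W m)ᗮ.starProjection f) + ‖ξ‖ ^ 2 - ‖(W m).starProjection ξ‖ ^ 2 := by
    intro m
    have h1 := Submodule.norm_sq_eq_add_norm_sq_starProjection ξ (W m)
    have h2 : inner ℝ ((W m)ᗮ.starProjection f) ((W m)ᗮ.starProjection ξ)
        = inner ℝ ξ ((W m)ᗮ.starProjection f) := by
      rw [← Submodule.inner_starProjection_left_eq_right,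
        Submodule.starProjection_eq_self_iff.2 ((W m)ᗮ.starProjection_apply_mem f),
        real_inner_comm]
    rw [map_add, norm_add_sq_real, h2, h1]
    ring
  -- The cross term costs half of the squared bias and `2T`, the captured noise another `T`. The
  -- large term `‖ξ‖²` is common to all models and cancels against the upper bound at `m₀`.
  have hlow : ∀ m ∈ M, ‖(W m)ᗮ.starProjection f‖ ^ 2 / 2 - 3 * T + ‖ξ‖ ^ 2
      ≤ ‖(W m)ᗮ.starProjection (f + ξ)‖ ^ 2 := by
    intro m hm
    have h1 := (abs_le.1 (abs_inner_orthogonal_starProjection_le (W m) f ξ (hT m hm))).1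
    have h2 : ‖(W m).starProjection ξ‖ ^ 2 ≤ T :=
      (pow_le_pow_left₀ (norm_nonneg _)
        (norm_starProjection_le_of_le le_sup_left ξ) 2).trans (hT m hm)
    rw [hexp m]
    linarith
  have hup : ‖(W m₀)ᗮ.starProjection (f + ξ)‖ ^ 2
      ≤ 3 / 2 * ‖(W m₀)ᗮ.starProjection f‖ ^ 2 + 2 * T + ‖ξ‖ ^ 2 := by
    have h1 := (abs_le.1 (abs_inner_orthogonal_starProjection_le (W m₀) f ξ (hT m₀ hm₀))).2
    rw [hexp m₀]
    nlinarith [sq_nonneg ‖(W m₀).starProjection ξ‖]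
  have hsum : ∑ m ∈ M, w m * (‖(W m)ᗮ.starProjection f‖ ^ 2 / 2 - 3 * T + ‖ξ‖ ^ 2)
      ≤ ∑ m ∈ M, w m * ‖(W m)ᗮ.starProjection (f + ξ)‖ ^ 2 :=
    Finset.sum_le_sum fun m hm => mul_le_mul_of_nonneg_left (hlow m hm) (hwpos m).le
  have hsum2 : ∑ m ∈ M, w m * (‖(W m)ᗮ.starProjection f‖ ^ 2 / 2 - 3 * T + ‖ξ‖ ^ 2)
      = (∑ m ∈ M, w m * ‖(W m)ᗮ.starProjection f‖ ^ 2) / 2 - 3 * T + ‖ξ‖ ^ 2 := by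
    have : ∀ m ∈ M, w m * (‖(W m)ᗮ.starProjection f‖ ^ 2 / 2 - 3 * T + ‖ξ‖ ^ 2)
        = w m * ‖(W m)ᗮ.starProjection f‖ ^ 2 / 2 + w m * (- 3 * T + ‖ξ‖ ^ 2) := by
      intro m _; ring
    rw [Finset.sum_congr rfl this, Finset.sum_add_distrib, ← Finset.sum_div, ← Finset.sum_mul,
      hwsum]
    ring
  change ∑ m ∈ M, w m * ‖(W m)ᗮ.starProjection f‖ ^ 2 ≤ _
  change ∑ m ∈ M, w m * ‖(W m)ᗮ.starProjection (f + ξ)‖ ^ 2 ≤ _ at hg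
  linarith

theorem sub_sum_smul_starProjection {w : ι → ℝ} (hw1 : ∑ m ∈ M, w m = 1) :
    f - ∑ m ∈ M, w m • (W m).starProjection (f + ξ)
      = ∑ m ∈ M, w m • ((W m)ᗮ.starProjection f - (W m).starProjection ξ) := by
  nth_rewrite 1 [← one_smul ℝ f]
  rw [← hw1, Finset.sum_smul, ← Finset.sum_sub_distrib]
  refine Finset.sum_congr rfl fun m _ => ?_
  rw [Submodule.starProjection_orthogonal, map_add, ← smul_sub]
  congr 1
  simp only [_root_.sub_apply, ContinuousLinearMap.id_apply]
  abel

/-- By convexity of the squared norm it suffices to treat each model, where bias and projected noise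
are orthogonal. -/
theorem norm_sub_sum_smul_starProjection_sq_le {w : ι → ℝ} (hw : ∀ m ∈ M, 0 ≤ w m)
    (hw1 : ∑ m ∈ M, w m = 1) {T : ℝ}
    (hT : ∀ m ∈ M, ‖(W m ⊔ Submodule.span ℝ {f}).starProjection ξ‖ ^ 2 ≤ T) :
    ‖f - ∑ m ∈ M, w m • (W m).starProjection (f + ξ)‖ ^ 2
      ≤ ∑ m ∈ M, w m * ‖(W m)ᗮ.starProjection f‖ ^ 2 + T := by
  rw [sub_sum_smul_starProjection W f ξ hw1]
  refine (norm_sq_sum_smul_le hw hw1 _).trans ?_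
  have : ∀ m ∈ M, w m * ‖(W m)ᗮ.starProjection f - (W m).starProjection ξ‖ ^ 2
      ≤ w m * ‖(W m)ᗮ.starProjection f‖ ^ 2 + w m * T := by
    intro m hm
    rw [← mul_add]
    refine mul_le_mul_of_nonneg_left ?_ (hw m hm)
    have h0 : inner ℝ ((W m)ᗮ.starProjection f) ((W m).starProjection ξ) = 0 :=
      Submodule.inner_left_of_mem_orthogonal ((W m).starProjection_apply_mem ξ)
        ((W m)ᗮ.starProjection_apply_mem f)
    have h2 : ‖(W m).starProjection ξ‖ ^ 2 ≤ T :=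
      (pow_le_pow_left₀ (norm_nonneg _)
        (norm_starProjection_le_of_le le_sup_left ξ) 2).trans (hT m hm)
    rw [norm_sub_sq_real, h0]
    linarith
  refine (Finset.sum_le_sum this).trans ?_
  rw [Finset.sum_add_distrib, ← Finset.sum_mul, hw1, one_mul]

/-- The weights may depend on `h` in any way, because each model's contribution is bounded
separately: the bias part by the enlarged-space argument, the noise part by Cauchy-Schwarz inside `W
m`. -/
theorem abs_inner_sub_sum_smul_starProjection_le (h : E) {w : ι → ℝ} (hw : ∀ m ∈ M, 0 ≤ w m)
    (hw1 : ∑ m ∈ M, w m = 1) {T : ℝ}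
    (hT : ∀ m ∈ M, ‖(W m ⊔ Submodule.span ℝ {f}).starProjection ξ‖ ^ 2 ≤ T)
    (hTh : ∀ m ∈ M, ‖(W m ⊔ Submodule.span ℝ {f}).starProjection h‖ ^ 2 ≤ T) :
    |inner ℝ h (f - ∑ m ∈ M, w m • (W m).starProjection (f + ξ))|
      ≤ ∑ m ∈ M, w m * ‖(W m)ᗮ.starProjection f‖ ^ 2 + 2 * T := by
  rw [sub_sum_smul_starProjection W f ξ hw1, inner_sum]
  refine (Finset.abs_sum_le_sum_abs _ _).trans ?_
  have : ∀ m ∈ M, |inner ℝ h (w m • ((W m)ᗮ.starProjection f - (W m).starProjection ξ))|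
      ≤ w m * ‖(W m)ᗮ.starProjection f‖ ^ 2 + w m * (2 * T) := by
    intro m hm
    rw [← mul_add, inner_smul_right, abs_mul, abs_of_nonneg (hw m hm)]
    refine mul_le_mul_of_nonneg_left ?_ (hw m hm)
    have h1 := abs_inner_orthogonal_starProjection_le (W m) f h (hTh m hm)
    have h2 : ‖(W m).starProjection ξ‖ ^ 2 ≤ T :=
      (pow_le_pow_left₀ (norm_nonneg _)
        (norm_starProjection_le_of_le le_sup_left ξ) 2).trans (hT m hm)
    have h3 : ‖(W m).starProjection h‖ ^ 2 ≤ T :=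
      (pow_le_pow_left₀ (norm_nonneg _)
        (norm_starProjection_le_of_le le_sup_left h) 2).trans (hTh m hm)
    have h4 : inner ℝ h ((W m).starProjection ξ)
        = inner ℝ ((W m).starProjection h) ((W m).starProjection ξ) := by
      rw [Submodule.inner_starProjection_left_eq_right,
        Submodule.starProjection_eq_self_iff.2 ((W m).starProjection_apply_mem ξ)]
    have h5 := abs_real_inner_le_norm ((W m).starProjection h) ((W m).starProjection ξ)
    rw [inner_sub_right, h4]
    refine (abs_sub _ _).trans ?_
    nlinarith [sq_nonneg (‖(W m).starProjection h‖ - ‖(W m).starProjection ξ‖),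
      sq_nonneg ‖(W m)ᗮ.starProjection f‖]
  refine (Finset.sum_le_sum this).trans ?_
  rw [Finset.sum_add_distrib, ← Finset.sum_mul, hw1, one_mul]

end Oracle

/-! ### Measurability of projections on random subspaces -/

section Measurability

variable {E ι Ω' : Type*} [NormedAddCommGroup E] [InnerProductSpace ℝ E] [FiniteDimensional ℝ E]
  [Fintype ι]

/-- Pythagoras turns the projection into a distance, and rational coefficients are dense, so the
distance is a countable infimum of measurable functions of the spanning vectors. This avoids any
choice of basis, whose size would jump with the rank. -/
theorem norm_starProjection_span_range_sq (A : ι → E) (h : E) :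
    ‖(Submodule.span ℝ (Set.range A)).starProjection h‖ ^ 2
      = ‖h‖ ^ 2 - (⨅ c : ι → ℚ, ‖h - ∑ i, (c i : ℝ) • A i‖) ^ 2 := by
  set V := Submodule.span ℝ (Set.range A) with hV
  have hPyth := Submodule.norm_sq_eq_add_norm_sq_starProjection h V
  have hperp : Vᗮ.starProjection h = h - V.starProjection h := by
    rw [Submodule.starProjection_orthogonal]; rfl
  suffices hinf : (⨅ c : ι → ℚ, ‖h - ∑ i, (c i : ℝ) • A i‖) = ‖h - V.starProjection h‖ by
    rw [hinf, ← hperp]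
    linarith
  have hbdd : BddBelow (Set.range fun c : ι → ℚ => ‖h - ∑ i, (c i : ℝ) • A i‖) :=
    ⟨0, by rintro _ ⟨c, rfl⟩; exact norm_nonneg _⟩
  apply le_antisymm
  · refine le_of_forall_pos_lt_add fun δ hδ => ?_
    obtain ⟨c, hc⟩ := (Submodule.mem_span_range_iff_exists_fun ℝ).1 (V.starProjection_apply_mem h)
    have hcont : Continuous fun c : ι → ℝ => ‖h - ∑ i, c i • A i‖ := by fun_prop
    have hopen : IsOpen {c : ι → ℝ | ‖h - ∑ i, c i • A i‖ < ‖h - V.starProjection h‖ + δ} :=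
      isOpen_lt hcont continuous_const
    have hdense : DenseRange (Pi.map fun (_ : ι) (x : ℚ) => (x : ℝ)) :=
      DenseRange.piMap fun _ => Rat.denseRange_cast
    obtain ⟨d, hd⟩ := hdense.exists_mem_open hopen
      ⟨c, by simp only [Set.mem_ofPred_eq, hc]; linarith⟩
    exact (ciInf_le hbdd d).trans_lt hd
  · refine le_ciInf fun c => ?_
    rw [Submodule.starProjection_minimal]
    refine ciInf_le (f := fun x : V => ‖h - (x : E)‖)
      ⟨0, by rintro _ ⟨c, rfl⟩; exact norm_nonneg _⟩
      ⟨∑ i, (c i : ℝ) • A i, Submodule.sum_mem _ fun i _ => Submodule.smul_mem _ _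
        (Submodule.subset_span ⟨i, rfl⟩)⟩

/-- Polarization, to deduce measurability of coordinates of the projection from that of its squared
norms. -/
theorem inner_starProjection_eq (V : Submodule ℝ E) (h e : E) :
    inner ℝ (V.starProjection h) e
      = (‖V.starProjection (h + e)‖ ^ 2 - ‖V.starProjection (h - e)‖ ^ 2) / 4 := by
  have h1 : inner ℝ (V.starProjection h) e
      = inner ℝ (V.starProjection h) (V.starProjection e) := by
    rw [← Submodule.inner_starProjection_left_eq_right,
      Submodule.starProjection_eq_self_iff.2 (V.starProjection_apply_mem h)]
  rw [h1, map_add, map_sub, norm_add_sq_real, norm_sub_sq_real]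
  ring

variable [MeasurableSpace Ω'] [MeasurableSpace E] [BorelSpace E]

theorem measurable_norm_starProjection_span_range_sq {A : Ω' → ι → E} {h : Ω' → E}
    (hA : ∀ i, Measurable fun ω => A ω i) (hh : Measurable h) :
    Measurable fun ω => ‖(Submodule.span ℝ (Set.range (A ω))).starProjection (h ω)‖ ^ 2 := by
  have : SecondCountableTopology E := secondCountable_of_proper
  simp only [norm_starProjection_span_range_sq]
  refine (hh.norm.pow_const 2).sub (Measurable.pow_const (Measurable.iInf fun c => ?_) 2)
  exact (hh.sub (Finset.measurable_fun_sum _ fun i _ => (hA i).const_smul (c i : ℝ))).norm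

theorem measurable_inner_starProjection_span_range {A : Ω' → ι → E} {h : Ω' → E}
    (hA : ∀ i, Measurable fun ω => A ω i) (hh : Measurable h) (e : E) :
    Measurable fun ω =>
      inner ℝ ((Submodule.span ℝ (Set.range (A ω))).starProjection (h ω)) e := by
  have : SecondCountableTopology E := secondCountable_of_proper
  simp only [inner_starProjection_eq]
  exact ((measurable_norm_starProjection_span_range_sq hA (hh.add_const e)).sub
    (measurable_norm_starProjection_span_range_sq hA (hh.sub_const e))).div_const 4

end Measurability

/-! ### Measurability of the estimator -/

section MeasurableEstimator

variable {n p q : ℕ} {Ω' : Type*} [MeasurableSpace Ω']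

theorem colSpace_eq_span_range (Z : Matrix (Fin n) (Fin p) ℝ) (m : Finset (Fin p)) :
    colSpace Z m = Submodule.span ℝ
      (Set.range fun j : m => (WithLp.toLp 2 (Z.col j) : EuclideanSpace ℝ (Fin n))) := by
  rw [colSpace]
  congr 1
  ext x
  simp

/-- The index `none` carries the extra vector `f`, so the family has `|m| + 1` members. -/
theorem colSpace_sup_eq_span_range (Z : Matrix (Fin n) (Fin p) ℝ) (m : Finset (Fin p))
    (f : EuclideanSpace ℝ (Fin n)) :
    colSpace Z m ⊔ Submodule.span ℝ {f} = Submodule.span ℝ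
      (Set.range fun o : Option m => o.elim f
        fun j => (WithLp.toLp 2 (Z.col j) : EuclideanSpace ℝ (Fin n))) := by
  rw [colSpace_eq_span_range, ← Submodule.span_union]
  congr 1
  ext x
  simp [Option.exists, eq_comm]

variable {Z : Ω' → Fin n → Fin p → ℝ} {X : Ω' → Fin n → Fin q → ℝ} {v : Ω' → Fin n → ℝ}

theorem measurable_toLp_col (hZ : Measurable Z) (j : Fin p) :
    Measurable fun ω => (WithLp.toLp 2 ((Matrix.of (Z ω)).col j) : EuclideanSpace ℝ (Fin n)) := by
  refine (WithLp.measurable_toLp 2 _).comp (measurable_pi_lambda _ fun i => ?_)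
  exact (measurable_pi_apply j).comp ((measurable_pi_apply i).comp hZ)

theorem measurable_rss (hZ : Measurable Z) (hv : Measurable v) (m : Finset (Fin p)) :
    Measurable fun ω => rss (Matrix.of (Z ω)) m (v ω) := by
  have hv' : Measurable fun ω => (WithLp.toLp 2 (v ω) : EuclideanSpace ℝ (Fin n)) :=
    (WithLp.measurable_toLp 2 _).comp hv
  have h : ∀ ω, rss (Matrix.of (Z ω)) m (v ω)
      = ‖(WithLp.toLp 2 (v ω) : EuclideanSpace ℝ (Fin n))‖ ^ 2
      - ‖(colSpace (Matrix.of (Z ω)) m).starProjection (WithLp.toLp 2 (v ω))‖ ^ 2 := by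
    intro ω
    have := Submodule.norm_sq_eq_add_norm_sq_starProjection
      (WithLp.toLp 2 (v ω) : EuclideanSpace ℝ (Fin n)) (colSpace (Matrix.of (Z ω)) m)
    rw [rss]
    linarith
  simp only [h, colSpace_eq_span_range]
  exact (hv'.norm.pow_const 2).sub (measurable_norm_starProjection_span_range_sq
    (fun j => measurable_toLp_col hZ j) hv')

theorem measurable_weight (hZ : Measurable Z) (hv : Measurable v) (u : ℕ) (α : ℝ)
    (m : Finset (Fin p)) : Measurable fun ω => weight (Matrix.of (Z ω)) u α (v ω) m := by
  unfold weight
  have h : ∀ k : Finset (Fin p),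
      Measurable fun ω => Real.exp (-(1 / α) * rss (Matrix.of (Z ω)) k (v ω)) :=
    fun k => ((measurable_rss hZ hv k).const_mul _).exp
  exact (h m).div (Finset.measurable_fun_sum _ fun k _ => h k)

theorem mulVec_ewCoef_apply (Z : Matrix (Fin n) (Fin p) ℝ) (u : ℕ) (α : ℝ) (v : Fin n → ℝ)
    (i : Fin n) : (Z *ᵥ ewCoef Z u α v) i = ∑ m ∈ models p u, weight Z u α v m *
      inner ℝ ((colSpace Z m).starProjection (WithLp.toLp 2 v))
        (EuclideanSpace.single i (1 : ℝ)) := by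
  have h1 : (Z *ᵥ ewCoef Z u α v) i = (WithLp.toLp 2 (Z *ᵥ ewCoef Z u α v) :
      EuclideanSpace ℝ (Fin n)) i := rfl
  rw [h1, mulVec_ewCoef]
  simp [EuclideanSpace.inner_single_right]

/-- The estimator of `β` sees the coefficients only through fitted values, which are weighted
projections; measurability of the generalized inverse is not needed. -/
theorem measurable_mulVec_ewCoef (hZ : Measurable Z) (hv : Measurable v) (u : ℕ) (α : ℝ) :
    Measurable fun ω => Matrix.of (Z ω) *ᵥ ewCoef (Matrix.of (Z ω)) u α (v ω) := by
  refine measurable_pi_lambda _ fun i => ?_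
  have hv' : Measurable fun ω => (WithLp.toLp 2 (v ω) : EuclideanSpace ℝ (Fin n)) :=
    (WithLp.measurable_toLp 2 _).comp hv
  simp only [mulVec_ewCoef_apply]
  refine Finset.measurable_fun_sum _ fun m _ => (measurable_weight hZ hv u α m).mul ?_
  simp only [colSpace_eq_span_range]
  exact measurable_inner_starProjection_span_range (fun j : m => measurable_toLp_col hZ j) hv' _

theorem measurable_matrix_inv_apply {κ : Type*} [Fintype κ] [DecidableEq κ] {S : Ω' → κ → κ → ℝ}
    (hS : Measurable S) (j k : κ) : Measurable fun ω => (Matrix.of (S ω))⁻¹ j k := by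
  have h : ∀ ω, (Matrix.of (S ω))⁻¹ j k
      = (Matrix.of (S ω)).det⁻¹ * (Matrix.of (S ω)).adjugate j k := by
    intro ω
    -- The formula also covers singular matrices: both sides are then zero, by `0⁻¹ = 0`.
    rw [Matrix.inv_def, Ring.inverse_eq_inv']
    rfl
  simp only [h]
  have hd : Continuous fun s : κ → κ → ℝ => (Matrix.of s).det := Continuous.matrix_det continuous_id
  have ha : Continuous fun s : κ → κ → ℝ => (Matrix.of s).adjugate j k :=
    (Continuous.matrix_adjugate (A := fun s : κ → κ → ℝ => Matrix.of s) continuous_id).matrix_elem j k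
  exact (hd.measurable.comp hS).inv.mul (ha.measurable.comp hS)

theorem measurable_betaEW {Y : Ω' → Fin n → ℝ} (hZ : Measurable Z) (hX : Measurable X)
    (hY : Measurable Y) (uδ : Fin q → ℕ) (αX : Fin q → ℝ) (uθ : ℕ) (αY : ℝ) :
    Measurable fun ω => betaEW (Matrix.of (Z ω)) uδ αX uθ αY (Matrix.of (X ω)) (Y ω) := by
  set R : Ω' → Fin n → Fin q → ℝ := fun ω i j =>
    (Matrix.of (X ω) - Matrix.of (Z ω) * ewDelta (Matrix.of (Z ω)) uδ αX (Matrix.of (X ω))) i j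
    with hR
  set e : Ω' → Fin n → ℝ := fun ω =>
    Y ω - Matrix.of (Z ω) *ᵥ ewCoef (Matrix.of (Z ω)) uθ αY (Y ω) with he
  have hXc : ∀ i j, Measurable fun ω => X ω i j := fun i j =>
    (measurable_pi_apply j).comp ((measurable_pi_apply i).comp hX)
  have heM : Measurable e := hY.sub (measurable_mulVec_ewCoef hZ hY uθ αY)
  have hRM : ∀ i j, Measurable fun ω => R ω i j := by
    intro i j
    have h1 : ∀ ω, R ω i j = X ω i j - (Matrix.of (Z ω) *ᵥ
        ewCoef (Matrix.of (Z ω)) (uδ j) (αX j) (fun i => X ω i j)) i := fun ω => rfl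
    simp only [h1]
    exact (hXc i j).sub ((measurable_pi_apply i).comp
      (measurable_mulVec_ewCoef hZ (measurable_pi_lambda _ fun i => hXc i j) _ _))
  have hG : Measurable fun ω => (fun j k => ∑ i, R ω i j * R ω i k : Fin q → Fin q → ℝ) :=
    measurable_pi_lambda _ fun j => measurable_pi_lambda _ fun k =>
      Finset.measurable_fun_sum _ fun i _ => (hRM i j).mul (hRM i k)
  have hb : ∀ ω j, betaEW (Matrix.of (Z ω)) uδ αX uθ αY (Matrix.of (X ω)) (Y ω) j
      = ∑ k, (Matrix.of fun j k => ∑ i, R ω i j * R ω i k)⁻¹ j k * ∑ i, R ω i k * e ω i := by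
    intro ω j
    rfl
  refine measurable_pi_lambda _ fun j => ?_
  simp only [hb]
  exact Finset.measurable_fun_sum _ fun k _ => (measurable_matrix_inv_apply hG j k).mul
    (Finset.measurable_fun_sum _ fun i _ => (hRM i k).mul ((measurable_pi_apply i).comp heM))

end MeasurableEstimator

/-! ### Tails of projected sub-Gaussian vectors -/

section SubgaussianTail

variable {Ω' : Type*} [MeasurableSpace Ω'] {P : Measure Ω'} {n : ℕ}
  {h : Ω' → EuclideanSpace ℝ (Fin n)} {c : ℝ≥0}

theorem hasSubgaussianMGF_inner (hind : iIndepFun (fun i ω => h ω i) P)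
    (hsub : ∀ i, HasSubgaussianMGF (fun ω => h ω i) c P) (a : EuclideanSpace ℝ (Fin n)) :
    HasSubgaussianMGF (fun ω => inner ℝ a (h ω)) (‖a‖₊ ^ 2 * c) P := by
  have h1 : iIndepFun (fun i ω => a i * h ω i) P :=
    hind.comp (fun i x => a i * x) fun i => measurable_const_mul _
  have h2 := HasSubgaussianMGF.sum_of_iIndepFun h1 (s := Finset.univ)
    (fun i _ => (hsub i).const_mul (a i))
  have e1 : (fun ω => ∑ i, a i * h ω i) = fun ω => inner ℝ a (h ω) := by
    funext ω
    simp [PiLp.inner_apply, mul_comm]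
  rw [e1] at h2
  convert h2 using 1
  ext
  simp only [NNReal.coe_mul, NNReal.coe_pow, NNReal.coe_sum, coe_nnnorm,
    EuclideanSpace.real_norm_sq_eq, Finset.sum_mul]
  rfl

theorem lintegral_exp_le_of_hasSubgaussianMGF {X : Ω' → ℝ} (hX : HasSubgaussianMGF X c P) :
    ∫⁻ ω, ENNReal.ofReal (Real.exp (X ω)) ∂P ≤ ENNReal.ofReal (Real.exp (c / 2)) := by
  have h1 := hX.integrable_exp_mul 1
  have h2 := hX.mgf_le 1
  simp only [one_mul, mgf, one_pow, mul_one] at h1 h2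
  rw [← ofReal_integral_eq_lintegral_ofReal h1 (Eventually.of_forall fun _ => (Real.exp_pos _).le)]
  exact ENNReal.ofReal_le_ofReal h2

variable [IsProbabilityMeasure P]

theorem lintegral_pi_exp_sum {d : ℕ} (γ : Measure ℝ) [IsProbabilityMeasure γ]
    {g : Fin d → ℝ → ℝ} (hg : ∀ k, Integrable (fun x => Real.exp (g k x)) γ) :
    ∫⁻ y, ENNReal.ofReal (Real.exp (∑ k, g k (y k))) ∂(Measure.pi fun _ : Fin d => γ)
      = ENNReal.ofReal (∏ k, ∫ x, Real.exp (g k x) ∂γ) := by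
  simp only [Real.exp_sum]
  rw [← ofReal_integral_eq_lintegral_ofReal, integral_fintype_prod_eq_prod
    (f := fun k x => Real.exp (g k x))]
  · exact Integrable.fintype_prod hg
  · exact Eventually.of_forall fun _ => Finset.prod_nonneg fun _ _ => (Real.exp_pos _).le

theorem integral_exp_mul_gaussianReal (t : ℝ) :
    ∫ x, Real.exp (t * x) ∂(gaussianReal 0 1) = Real.exp (t ^ 2 / 2) := by
  have := mgf_gaussianReal (p := gaussianReal 0 1) (X := id) (μ := 0) (v := 1) (by simp) t
  simpa [mgf] using this

theorem integrable_exp_mul_gaussianReal' (t : ℝ) :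
    Integrable (fun x => Real.exp (t * x)) (gaussianReal 0 1) :=
  integrable_exp_mul_gaussianReal t

/-- Gaussian linearization: `exp(l a²)` is the mean of `exp(√(2l) a y)` over a standard normal `y`.
After exchanging the integrals the exponent is linear in `h`, where the sub-Gaussian bound applies,
and the remaining Gaussian integral factorizes over the `d` coordinates. -/
theorem lintegral_exp_sum_sq_inner_le (hm : Measurable h)
    (hind : iIndepFun (fun i ω => h ω i) P)
    (hsub : ∀ i, HasSubgaussianMGF (fun ω => h ω i) c P) {d : ℕ}
    {b : Fin d → EuclideanSpace ℝ (Fin n)} (hb : Orthonormal ℝ b) {l : ℝ} (hl : 0 ≤ l)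
    (hint : Integrable (fun x => Real.exp (l * c * x ^ 2)) (gaussianReal 0 1)) :
    ∫⁻ ω, ENNReal.ofReal (Real.exp (l * ∑ k, inner ℝ (b k) (h ω) ^ 2)) ∂P
      ≤ ENNReal.ofReal ((∫ x, Real.exp (l * c * x ^ 2) ∂(gaussianReal 0 1)) ^ d) := by
  have hsq : √(2 * l) ^ 2 = 2 * l := Real.sq_sqrt (by positivity)
  have h1 : ∀ ω, ENNReal.ofReal (Real.exp (l * ∑ k, inner ℝ (b k) (h ω) ^ 2))
      = ∫⁻ y, ENNReal.ofReal (Real.exp (∑ k, (√(2 * l) * inner ℝ (b k) (h ω)) * y k))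
          ∂(Measure.pi fun _ : Fin d => gaussianReal 0 1) := by
    intro ω
    rw [lintegral_pi_exp_sum (gaussianReal 0 1)
      (g := fun k x => (√(2 * l) * inner ℝ (b k) (h ω)) * x)
      (fun k => integrable_exp_mul_gaussianReal' _)]
    simp only [integral_exp_mul_gaussianReal]
    rw [← Real.exp_sum, Finset.mul_sum]
    congr 2
    refine Finset.sum_congr rfl fun k _ => ?_
    rw [mul_pow, hsq]
    ring
  simp only [h1]
  rw [lintegral_lintegral_swap]
  · have h2 : ∀ y : Fin d → ℝ,
        ∫⁻ ω, ENNReal.ofReal (Real.exp (∑ k, (√(2 * l) * inner ℝ (b k) (h ω)) * y k)) ∂P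
          ≤ ENNReal.ofReal (Real.exp (∑ k, l * c * y k ^ 2)) := by
      intro y
      -- For fixed `y` the exponent is the inner product of `h` with this vector; orthonormality
      -- gives `‖a‖² = 2l ∑ y_k²`.
      set a : EuclideanSpace ℝ (Fin n) := √(2 * l) • ∑ k, y k • b k with ha
      have e1 : ∀ ω, ∑ k, (√(2 * l) * inner ℝ (b k) (h ω)) * y k = inner ℝ a (h ω) := by
        intro ω
        rw [ha, real_inner_smul_left, sum_inner, Finset.mul_sum]
        refine Finset.sum_congr rfl fun k _ => ?_
        rw [real_inner_smul_left]
        ring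
      have e2 : ‖a‖ ^ 2 = 2 * l * ∑ k, y k ^ 2 := by
        rw [ha, norm_smul, mul_pow, Real.norm_eq_abs, sq_abs, hsq, ← real_inner_self_eq_norm_sq,
          hb.inner_sum]
        simp [sq]
      simp only [e1]
      refine (lintegral_exp_le_of_hasSubgaussianMGF
        (hasSubgaussianMGF_inner hind hsub a)).trans (le_of_eq ?_)
      congr 2
      rw [NNReal.coe_mul, NNReal.coe_pow, coe_nnnorm, e2, ← Finset.mul_sum]
      ring
    refine (lintegral_mono h2).trans (le_of_eq ?_)
    rw [lintegral_pi_exp_sum (gaussianReal 0 1) (g := fun _ x => l * c * x ^ 2) (fun _ => hint)]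
    simp
  · refine Measurable.aemeasurable ?_
    simp only [Function.uncurry_def]
    refine (Measurable.exp (Finset.measurable_fun_sum _ fun k _ => ?_)).ennreal_ofReal
    have : Measurable fun ω => inner ℝ (b k) (h ω) := hm.const_inner
    exact ((this.comp measurable_fst).const_mul _).mul
      ((measurable_pi_apply k).comp measurable_snd)

theorem norm_starProjection_sq_eq_sum {E : Type*} [NormedAddCommGroup E] [InnerProductSpace ℝ E]
    [FiniteDimensional ℝ E] (V : Submodule ℝ E) (x : E) :
    ‖V.starProjection x‖ ^ 2 = ∑ k, inner ℝ ((stdOrthonormalBasis ℝ V k : V) : E) x ^ 2 := by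
  rw [Submodule.starProjection_apply, ← Submodule.coe_norm,
    ← (stdOrthonormalBasis ℝ V).sum_sq_inner_right]
  refine Finset.sum_congr rfl fun k _ => ?_
  rw [Submodule.inner_orthogonalProjectionOnto_eq_of_mem_left]

/-- Chernoff's bound for the exponential moment above. The constants depend on the sub-Gaussian
parameter only, hence not on the sample size, the space or the law. -/
theorem exists_tail_constants (c : ℝ≥0) : ∃ l K : ℝ, 0 < l ∧ 1 ≤ K ∧
    ∀ {Ω' : Type*} [MeasurableSpace Ω'] {P : Measure Ω'} [IsProbabilityMeasure P] {n : ℕ}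
      {h : Ω' → EuclideanSpace ℝ (Fin n)}, Measurable h → iIndepFun (fun i ω => h ω i) P →
      (∀ i, HasSubgaussianMGF (fun ω => h ω i) c P) →
      ∀ (V : Submodule ℝ (EuclideanSpace ℝ (Fin n))) (d : ℕ), Module.finrank ℝ V ≤ d → ∀ t : ℝ,
      P {ω | t < ‖V.starProjection (h ω)‖ ^ 2} ≤ ENNReal.ofReal (K ^ d * Real.exp (-(l * t))) := by
  obtain ⟨C, hC, hCint⟩ := IsGaussian.exists_integrable_exp_sq (gaussianReal 0 1)
  -- `C` is an exponent for which `exp(C x²)` is Gaussian-integrable; dividing by `c + 1` ensures `l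
  -- c ≤ C` and also covers `c = 0`.
  set l : ℝ := C / (c + 1) with hl
  have hlpos : 0 < l := by positivity
  have hlc : l * c ≤ C := by
    rw [hl, div_mul_eq_mul_div, div_le_iff₀ (by positivity)]
    nlinarith [c.2]
  have hint : Integrable (fun x : ℝ => Real.exp (l * c * x ^ 2)) (gaussianReal 0 1) := by
    refine hCint.mono' (by fun_prop) (Eventually.of_forall fun x => ?_)
    rw [Real.norm_of_nonneg (Real.exp_pos _).le, Real.norm_eq_abs, sq_abs]
    gcongr
  -- The maximum with 1 makes the bound monotone in the dimension, so `finrank V ≤ d` suffices.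
  refine ⟨l, max 1 (∫ x, Real.exp (l * c * x ^ 2) ∂(gaussianReal 0 1)), hlpos, le_max_left _ _, ?_⟩
  intro Ω' _ P _ n h hm hind hsub V d hd t
  set K0 := ∫ x, Real.exp (l * c * x ^ 2) ∂(gaussianReal 0 1) with hK0
  have hK0nn : 0 ≤ K0 := integral_nonneg fun _ => (Real.exp_pos _).le
  have hb : Orthonormal ℝ (fun k => ((stdOrthonormalBasis ℝ V k : V) : EuclideanSpace ℝ (Fin n))) :=
    (stdOrthonormalBasis ℝ V).orthonormal.comp_linearIsometry V.subtypeₗᵢ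
  have h1 := lintegral_exp_sum_sq_inner_le hm hind hsub hb hlpos.le hint
  simp only [← norm_starProjection_sq_eq_sum] at h1
  have hpowle : K0 ^ Module.finrank ℝ V ≤ max 1 K0 ^ d :=
    (pow_le_pow_left₀ hK0nn (le_max_right _ _) _).trans (pow_le_pow_right₀ (le_max_left _ _) hd)
  have h2 : ENNReal.ofReal (Real.exp (l * t)) * P {ω | t < ‖V.starProjection (h ω)‖ ^ 2}
      ≤ ENNReal.ofReal (max 1 K0 ^ d) := by
    refine le_trans ?_ (h1.trans (ENNReal.ofReal_le_ofReal hpowle))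
    refine le_trans ?_ (mul_meas_ge_le_lintegral₀ ?_ (ENNReal.ofReal (Real.exp (l * t))))
    · gcongr with ω
      intro hω
      gcongr
    · refine Measurable.aemeasurable ?_
      have : Measurable fun ω => V.starProjection (h ω) := V.starProjection.measurable.comp hm
      exact ((this.norm.pow_const 2).const_mul l).exp.ennreal_ofReal
  rw [mul_comm, Real.exp_neg, ENNReal.ofReal_mul (by positivity),
    ENNReal.ofReal_inv_of_pos (Real.exp_pos _)]
  exact (ENNReal.mul_le_iff_le_inv (by simpa using Real.exp_pos _) ENNReal.ofReal_ne_top).1 h2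

/-- Under independence the joint law is a product, so Fubini reduces the random subspace to a fixed
one. -/
theorem measure_lt_norm_starProjection_span_range_le {ι : Type*} [Fintype ι]
    {A : Ω' → ι → EuclideanSpace ℝ (Fin n)} (hA : Measurable A) (hm : Measurable h)
    (hAh : IndepFun A h P) {t : ℝ} {B : ENNReal}
    (hB : ∀ a : ι → EuclideanSpace ℝ (Fin n),
      P {ω | t < ‖(Submodule.span ℝ (Set.range a)).starProjection (h ω)‖ ^ 2} ≤ B) :
    P {ω | t < ‖(Submodule.span ℝ (Set.range (A ω))).starProjection (h ω)‖ ^ 2} ≤ B := by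
  set S : Set ((ι → EuclideanSpace ℝ (Fin n)) × EuclideanSpace ℝ (Fin n)) :=
    {x | t < ‖(Submodule.span ℝ (Set.range x.1)).starProjection x.2‖ ^ 2} with hS
  have hSm : MeasurableSet S := measurableSet_lt measurable_const
    (measurable_norm_starProjection_span_range_sq
      (fun i => (measurable_pi_apply i).comp measurable_fst) measurable_snd)
  have h1 : P {ω | t < ‖(Submodule.span ℝ (Set.range (A ω))).starProjection (h ω)‖ ^ 2}
      = (P.map A).prod (P.map h) S := by
    rw [← (indepFun_iff_map_prod_eq_prod_map_map hA.aemeasurable hm.aemeasurable).1 hAh,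
      Measure.map_apply (hA.prodMk hm) hSm]
    rfl
  have : IsProbabilityMeasure (P.map A) := Measure.isProbabilityMeasure_map hA.aemeasurable
  rw [h1, Measure.prod_apply hSm]
  calc ∫⁻ a, (P.map h) (Prod.mk a ⁻¹' S) ∂(P.map A) ≤ ∫⁻ _, B ∂(P.map A) := by
        refine lintegral_mono fun a => ?_
        rw [Measure.map_apply hm (measurable_prodMk_left hSm)]
        exact hB a
    _ = B := by simp

/-- The largest squared projection of `h` onto a model space enlarged by the vector `f`. -/
noncomputable def supProj {p : ℕ} (Z : Matrix (Fin n) (Fin p) ℝ) (u : ℕ)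
    (f h : EuclideanSpace ℝ (Fin n)) : ℝ :=
  ⨆ m : models p u, ‖(colSpace Z m ⊔ Submodule.span ℝ {f}).starProjection h‖ ^ 2

theorem le_supProj {p : ℕ} (Z : Matrix (Fin n) (Fin p) ℝ) {u : ℕ}
    (f h : EuclideanSpace ℝ (Fin n)) {m : Finset (Fin p)} (hm : m ∈ models p u) :
    ‖(colSpace Z m ⊔ Submodule.span ℝ {f}).starProjection h‖ ^ 2 ≤ supProj Z u f h :=
  le_ciSup (f := fun m : models p u =>
    ‖(colSpace Z m ⊔ Submodule.span ℝ {f}).starProjection h‖ ^ 2)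
    (Set.finite_range _).bddAbove ⟨m, hm⟩

theorem supProj_nonneg {p : ℕ} (Z : Matrix (Fin n) (Fin p) ℝ) (u : ℕ)
    (f h : EuclideanSpace ℝ (Fin n)) : 0 ≤ supProj Z u f h :=
  Real.iSup_nonneg fun _ => sq_nonneg _

/-- Union bound over at most `p^u` models, each giving a space of dimension at most `u + 1`. -/
theorem measure_lt_supProj_le {p : ℕ} {Z : Ω' → Fin n → Fin p → ℝ}
    {f : Ω' → EuclideanSpace ℝ (Fin n)} (hZ : Measurable Z) (hf : Measurable f) (hm : Measurable h)
    (hind : IndepFun (fun ω => (Z ω, f ω)) h P) (u : ℕ) {t : ℝ} (ht : 0 ≤ t) {l K : ℝ} (hK : 1 ≤ K)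
    (hB : ∀ (V : Submodule ℝ (EuclideanSpace ℝ (Fin n))) (d : ℕ), Module.finrank ℝ V ≤ d →
      P {ω | t < ‖V.starProjection (h ω)‖ ^ 2} ≤ ENNReal.ofReal (K ^ d * Real.exp (-(l * t)))) :
    P {ω | t < supProj (Matrix.of (Z ω)) u (f ω) (h ω)}
      ≤ ENNReal.ofReal (p ^ u * (K ^ (u + 1) * Real.exp (-(l * t)))) := by
  have h1 : {ω | t < supProj (Matrix.of (Z ω)) u (f ω) (h ω)} ⊆ ⋃ m ∈ models p u,
      {ω | t < ‖(colSpace (Matrix.of (Z ω)) m ⊔ Submodule.span ℝ {f ω}).starProjection (h ω)‖ ^ 2} := by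
    intro ω hω
    have hω' : t < supProj (Matrix.of (Z ω)) u (f ω) (h ω) := hω
    -- If `u > p` there are no models; the supremum is then zero by convention and cannot exceed `t
    -- ≥ 0`.
    rcases isEmpty_or_nonempty (models p u) with he | hne
    · rw [supProj, Real.iSup_of_isEmpty] at hω'
      exact absurd hω' (not_lt.2 ht)
    · obtain ⟨m, hm⟩ := exists_lt_of_lt_ciSup hω'
      exact Set.mem_biUnion m.2 hm
  refine (measure_mono h1).trans ((measure_biUnion_finset_le _ _).trans ?_)
  have h2 : ∀ m ∈ models p u, P {ω | t < ‖(colSpace (Matrix.of (Z ω)) m ⊔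
      Submodule.span ℝ {f ω}).starProjection (h ω)‖ ^ 2}
        ≤ ENNReal.ofReal (K ^ (u + 1) * Real.exp (-(l * t))) := by
    intro m hmm
    simp only [colSpace_sup_eq_span_range]
    set g : (Fin n → Fin p → ℝ) × EuclideanSpace ℝ (Fin n) → Option m → EuclideanSpace ℝ (Fin n) :=
      fun x o => o.elim x.2 fun j => WithLp.toLp 2 ((Matrix.of x.1).col j) with hg
    have hgm : Measurable g := by
      refine measurable_pi_lambda _ fun o => ?_
      cases o with
      | none => exact measurable_snd
      | some j => exact measurable_toLp_col measurable_fst j.1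
    refine measure_lt_norm_starProjection_span_range_le (A := fun ω => g (Z ω, f ω))
      (hgm.comp (hZ.prodMk hf)) hm (hind.comp hgm measurable_id) fun a => hB _ _ ?_
    refine (finrank_range_le_card a).trans ?_
    rw [Fintype.card_option, Fintype.card_coe, (Finset.mem_powersetCard.1 hmm).2]
  refine (Finset.sum_le_card_nsmul _ _ _ h2).trans ?_
  have hnn : 0 ≤ K ^ (u + 1) * Real.exp (-(l * t)) := by positivity
  rw [nsmul_eq_mul, ENNReal.ofReal_mul (p := (p : ℝ) ^ u) (by positivity)]
  refine mul_le_mul' ?_ le_rfl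
  rw [← Nat.cast_pow, ENNReal.ofReal_natCast]
  exact Nat.cast_le.2 (card_models_le p u)

end SubgaussianTail

/-! ### Calculus of `O_P` and `o_P` -/

section StochasticOrder

variable {Ω : ℕ → Type*} [∀ n, MeasurableSpace (Ω n)] {P : ∀ n, Measure (Ω n)}
  {V W : ∀ n, Ω n → ℝ} {a : ℕ → ℝ}

/-- This and the union bounds below use only monotonicity and subadditivity, so the exceptional
events need not be measurable. -/
theorem tendsto_measure_of_eventually_subset {A B : ∀ n, Set (Ω n)}
    (hB : Tendsto (fun n => P n (B n)) atTop (𝓝 0)) (h : ∀ᶠ n in atTop, A n ⊆ B n) :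
    Tendsto (fun n => P n (A n)) atTop (𝓝 0) :=
  tendsto_of_tendsto_of_tendsto_of_le_of_le' tendsto_const_nhds hB
    (Eventually.of_forall fun _ => zero_le) (h.mono fun _ hn => measure_mono hn)

theorem tendsto_measure_union {A B : ∀ n, Set (Ω n)}
    (hA : Tendsto (fun n => P n (A n)) atTop (𝓝 0))
    (hB : Tendsto (fun n => P n (B n)) atTop (𝓝 0)) :
    Tendsto (fun n => P n (A n ∪ B n)) atTop (𝓝 0) := by
  have := hA.add hB
  rw [add_zero] at this
  exact tendsto_of_tendsto_of_tendsto_of_le_of_le' tendsto_const_nhds this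
    (Eventually.of_forall fun _ => zero_le) (Eventually.of_forall fun _ => measure_union_le _ _)

theorem tendsto_measure_iUnion {ι : Type*} [Fintype ι] {A : ι → ∀ n, Set (Ω n)}
    (hA : ∀ i, Tendsto (fun n => P n (A i n)) atTop (𝓝 0)) :
    Tendsto (fun n => P n (⋃ i, A i n)) atTop (𝓝 0) := by
  have := tendsto_finsetSum Finset.univ fun i (_ : i ∈ Finset.univ) => hA i
  rw [Finset.sum_const_zero] at this
  exact tendsto_of_tendsto_of_tendsto_of_le_of_le' tendsto_const_nhds this
    (Eventually.of_forall fun _ => zero_le)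
    (Eventually.of_forall fun n => measure_iUnion_fintype_le (P n) _)

theorem IsLittleOInProb.add (hV : IsLittleOInProb P V a) (hW : IsLittleOInProb P W a) :
    IsLittleOInProb P (fun n ω => V n ω + W n ω) a := fun r hr => by
  refine tendsto_measure_of_eventually_subset
    (tendsto_measure_union (hV (r / 2) (half_pos hr)) (hW (r / 2) (half_pos hr)))
    (Eventually.of_forall fun n ω hω => ?_)
  simp only [Set.mem_union, Set.mem_ofPred_eq] at hω ⊢
  by_contra! hcon
  have := abs_add_le (V n ω) (W n ω)
  linarith [hcon.1, hcon.2]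

theorem IsLittleOInProb.const_mul (hV : IsLittleOInProb P V a) (c : ℝ) :
    IsLittleOInProb P (fun n ω => c * V n ω) a := fun r hr => by
  have hc : 0 < |c| + 1 := by positivity
  refine tendsto_measure_of_eventually_subset (hV (r / (|c| + 1)) (by positivity))
    (Eventually.of_forall fun n ω hω => ?_)
  simp only [Set.mem_ofPred_eq, abs_mul] at hω ⊢
  rw [div_mul_eq_mul_div, div_lt_iff₀ hc]
  nlinarith [abs_nonneg (V n ω), abs_nonneg c]

theorem isLittleOInProb_of_isLittleO [∀ n, IsProbabilityMeasure (P n)] {b : ℕ → ℝ}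
    (ha : ∀ n, 0 ≤ a n) (hb : b =o[atTop] a) : IsLittleOInProb P (fun n _ => b n) a := fun r hr => by
  refine tendsto_const_nhds.congr' ?_
  filter_upwards [hb.bound hr] with n hn
  rw [Real.norm_eq_abs, Real.norm_of_nonneg (ha n)] at hn
  simp [not_lt.2 hn]

theorem IsLittleOInProb.zero [∀ n, IsProbabilityMeasure (P n)] (ha : ∀ n, 0 ≤ a n) :
    IsLittleOInProb P (fun _ _ => 0) a :=
  isLittleOInProb_of_isLittleO ha (isLittleO_zero a atTop)

theorem IsLittleOInProb.sum [∀ n, IsProbabilityMeasure (P n)] {ι : Type*} {s : Finset ι}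
    {V : ι → ∀ n, Ω n → ℝ} (ha : ∀ n, 0 ≤ a n) (hV : ∀ i ∈ s, IsLittleOInProb P (V i) a) :
    IsLittleOInProb P (fun n ω => ∑ i ∈ s, V i n ω) a := by
  classical
  induction s using Finset.induction_on with
  | empty => simpa using IsLittleOInProb.zero ha
  | insert i s hi ih =>
    simp only [Finset.sum_insert hi]
    exact (hV i (Finset.mem_insert_self i s)).add
      (ih fun j hj => hV j (Finset.mem_insert_of_mem hj))

/-- Used to discard the event that a Gram matrix is singular. -/
theorem IsLittleOInProb.congr_of_tendsto (hV : IsLittleOInProb P V a)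
    (h : Tendsto (fun n => P n {ω | V n ω ≠ W n ω}) atTop (𝓝 0)) : IsLittleOInProb P W a :=
  fun r hr => by
  refine tendsto_measure_of_eventually_subset (tendsto_measure_union (hV r hr) h)
    (Eventually.of_forall fun n ω hω => ?_)
  simp only [Set.mem_union, Set.mem_ofPred_eq] at hω ⊢
  by_cases hVW : V n ω = W n ω
  · left; rwa [hVW]
  · right; exact hVW

theorem IsLittleOInProb.div_scale (hV : IsLittleOInProb P V a) {b : ℕ → ℝ}
    (hb : ∀ᶠ n in atTop, 0 < b n ∧ a n ≤ b n) :
    IsLittleOInProb P (fun n ω => V n ω / b n) fun _ => 1 := fun r hr => by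
  refine tendsto_measure_of_eventually_subset (hV r hr) (hb.mono fun n hn ω hω => ?_)
  simp only [Set.mem_ofPred_eq, abs_div, abs_of_pos hn.1, mul_one] at hω ⊢
  rw [lt_div_iff₀ hn.1] at hω
  exact (mul_le_mul_of_nonneg_left hn.2 hr.le).trans_lt hω

theorem IsLittleOInProb.mul_isBigOInProb (hV : IsLittleOInProb P V fun _ => 1)
    (hW : IsBigOInProb P W fun _ => 1) :
    IsLittleOInProb P (fun n ω => V n ω * W n ω) fun _ => 1 := fun r hr => by
  rw [ENNReal.tendsto_nhds_zero]
  intro e he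
  -- The target `e` may be infinite, while boundedness in probability is indexed by positive reals.
  obtain ⟨d, hd0, hd⟩ : ∃ d : ℝ, 0 < d ∧ ENNReal.ofReal d ≤ e / 2 := by
    have h2 : 0 < e / 2 := ENNReal.half_pos he.ne'
    obtain ⟨d, hd0, hd⟩ := ENNReal.lt_iff_exists_nnreal_btwn.1 h2
    exact ⟨d, by exact_mod_cast hd0, by rw [ENNReal.ofReal_coe_nnreal]; exact hd.le⟩
  obtain ⟨C, hC⟩ := hW d hd0
  -- The constant from boundedness in probability carries no sign, so it is replaced by one that can
  -- be divided by.
  have hCpos : 0 < max C 1 := lt_max_of_lt_right one_pos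
  have hV' := ENNReal.tendsto_nhds_zero.1 (hV (r / max C 1) (by positivity)) (e / 2)
    (ENNReal.half_pos he.ne')
  filter_upwards [hC, hV'] with n h1 h2
  calc P n {ω | r * 1 < |V n ω * W n ω|}
      ≤ P n ({ω | r / max C 1 * 1 < |V n ω|} ∪ {ω | C * 1 < |W n ω|}) := by
        refine measure_mono fun ω hω => ?_
        simp only [Set.mem_union, Set.mem_ofPred_eq, mul_one, abs_mul] at hω ⊢
        by_contra! hcon
        have h3 : |W n ω| ≤ max C 1 := hcon.2.trans (le_max_left _ _)
        have h4 : |V n ω| * |W n ω| ≤ r / max C 1 * max C 1 :=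
          mul_le_mul hcon.1 h3 (abs_nonneg _) (by positivity)
        rw [div_mul_cancel₀ _ hCpos.ne'] at h4
        linarith
    _ ≤ e / 2 + e / 2 := (measure_union_le _ _).trans (add_le_add h2 (h1.trans hd))
    _ = e := ENNReal.add_halves e

theorem IsBigOInProb.add_isLittleOInProb (hV : IsBigOInProb P V fun _ => 1)
    (hW : IsLittleOInProb P W fun _ => 1) :
    IsBigOInProb P (fun n ω => V n ω + W n ω) fun _ => 1 := fun r hr => by
  obtain ⟨C, hC⟩ := hV (r / 2) (half_pos hr)
  have hW' := ENNReal.tendsto_nhds_zero.1 (hW 1 one_pos) (ENNReal.ofReal (r / 2)) (by simpa)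
  refine ⟨C + 1, ?_⟩
  filter_upwards [hC, hW'] with n h1 h2
  calc P n {ω | (C + 1) * 1 < |V n ω + W n ω|}
      ≤ P n ({ω | C * 1 < |V n ω|} ∪ {ω | 1 * 1 < |W n ω|}) := by
        refine measure_mono fun ω hω => ?_
        simp only [Set.mem_union, Set.mem_ofPred_eq, mul_one] at hω ⊢
        by_contra! hcon
        have := abs_add_le (V n ω) (W n ω)
        linarith [hcon.1, hcon.2]
    _ ≤ ENNReal.ofReal (r / 2) + ENNReal.ofReal (r / 2) :=
        (measure_union_le _ _).trans (add_le_add h1 h2)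
    _ = ENNReal.ofReal r := by
        rw [← ENNReal.ofReal_add (half_pos hr).le (half_pos hr).le, add_halves]

theorem measure_lt_abs_le_of_integral_sq_le {Ω' : Type*} [MeasurableSpace Ω'] {Q : Measure Ω'}
    {X : Ω' → ℝ} (hX : Integrable (fun ω => X ω ^ 2) Q) {C R : ℝ} (hR : 0 < R)
    (hC : ∫ ω, X ω ^ 2 ∂Q ≤ C) : Q {ω | R < |X ω|} ≤ ENNReal.ofReal (C / R ^ 2) := by
  have h1 : Q {ω | R < |X ω|} ≤ Q {ω | ENNReal.ofReal (R ^ 2) ≤ ENNReal.ofReal (X ω ^ 2)} := by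
    refine measure_mono fun ω hω => ?_
    have hω' : R < |X ω| := hω
    refine ENNReal.ofReal_le_ofReal ?_
    rw [← sq_abs (X ω)]
    gcongr
  refine h1.trans ((meas_ge_le_lintegral_div hX.aemeasurable.ennreal_ofReal
    (by simpa using (pow_pos hR 2).ne') ENNReal.ofReal_ne_top).trans ?_)
  rw [← ofReal_integral_eq_lintegral_ofReal hX (Eventually.of_forall fun _ => sq_nonneg _),
    ← ENNReal.ofReal_div_of_pos (pow_pos hR 2)]
  exact ENNReal.ofReal_le_ofReal (by gcongr)

theorem isBigOInProb_of_integral_sq_le {C : ℝ}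
    (hV : ∀ᶠ n in atTop, Integrable (fun ω => V n ω ^ 2) (P n) ∧ ∫ ω, V n ω ^ 2 ∂(P n) ≤ C) :
    IsBigOInProb P V fun _ => 1 := fun r hr => by
  have hC : 0 < |C| + 1 := by positivity
  -- The radius at which Chebyshev's bound `(|C| + 1) / R²` equals `r`.
  have hR : 0 < √((|C| + 1) / r) := Real.sqrt_pos.2 (by positivity)
  refine ⟨√((|C| + 1) / r), hV.mono fun n hn => ?_⟩
  rw [mul_one]
  refine (measure_lt_abs_le_of_integral_sq_le hn.1 hR
    (hn.2.trans ((le_abs_self C).trans (le_add_of_nonneg_right zero_le_one)))).trans ?_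
  rw [Real.sq_sqrt (by positivity), div_div_cancel₀ hC.ne']

theorem isLittleOInProb_of_tendsto_integral_sq {b : ℕ → ℝ} (hb : Tendsto b atTop (𝓝 0))
    (hV : ∀ᶠ n in atTop, Integrable (fun ω => V n ω ^ 2) (P n) ∧ ∫ ω, V n ω ^ 2 ∂(P n) ≤ b n) :
    IsLittleOInProb P V fun _ => 1 := fun r hr => by
  have h1 : Tendsto (fun n => ENNReal.ofReal (b n / r ^ 2)) atTop (𝓝 0) := by
    have := ENNReal.tendsto_ofReal (hb.div_const (r ^ 2))
    simpa using this
  refine tendsto_of_tendsto_of_tendsto_of_le_of_le' tendsto_const_nhds h1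
    (Eventually.of_forall fun _ => zero_le) (hV.mono fun n hn => ?_)
  rw [mul_one]
  exact measure_lt_abs_le_of_integral_sq_le hn.1 hr hn.2

/-- Convergence in probability of finitely many coordinates is preserved by maps which are
continuous at the limit. -/
theorem isLittleOInProb_comp_continuousAt {κ : Type*} [Fintype κ] {M : ∀ n, Ω n → κ → ℝ}
    {c : κ → ℝ} {g : (κ → ℝ) → ℝ} (hg : ContinuousAt g c)
    (hM : ∀ k, IsLittleOInProb P (fun n ω => M n ω k - c k) fun _ => 1) :
    IsLittleOInProb P (fun n ω => g (M n ω) - g c) fun _ => 1 := fun r hr => by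
  obtain ⟨d, hd, hgd⟩ := Metric.continuousAt_iff.1 hg r hr
  refine tendsto_measure_of_eventually_subset
    (tendsto_measure_iUnion fun k => hM k (d / 2) (half_pos hd))
    (Eventually.of_forall fun n ω hω => ?_)
  simp only [Set.mem_iUnion, Set.mem_ofPred_eq, mul_one] at hω ⊢
  by_contra! hcon
  have h1 : dist (M n ω) c < d := by
    refine lt_of_le_of_lt ((dist_pi_le_iff (half_pos hd).le).2 fun k => ?_) (half_lt_self hd)
    rw [Real.dist_eq]
    exact hcon k
  have := hgd h1
  rw [Real.dist_eq] at this
  linarith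

end StochasticOrder

/-! ### The noise projections are uniformly `o_P(√n)` -/

section UniformProjection

variable {Ω : ℕ → Type*} [∀ n, MeasurableSpace (Ω n)] {P : ∀ n, Measure (Ω n)}
  [∀ n, IsProbabilityMeasure (P n)] {p u : ℕ → ℕ}

theorem isLittleO_natCast_of_mul_log (hp : ∀ᶠ n in atTop, n < p n)
    (hu : (fun n => (u n : ℝ) * Real.log (p n)) =o[atTop] fun n => √(n : ℝ)) :
    (fun n => (u n : ℝ)) =o[atTop] fun n => √(n : ℝ) := by
  refine IsBigO.trans_isLittleO (IsBigO.of_bound 1 ?_) hu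
  filter_upwards [hp, eventually_ge_atTop 3] with n hn hn3
  -- Holds because `p > n ≥ 3 > e`; the logarithm can then be dropped.
  have h1 : 1 ≤ Real.log (p n) := by
    rw [Real.le_log_iff_exp_le (by exact_mod_cast (by omega : 0 < p n))]
    have : (3 : ℝ) ≤ p n := by exact_mod_cast (by omega : 3 ≤ p n)
    linarith [Real.exp_one_lt_d9]
  rw [one_mul, Real.norm_of_nonneg (by positivity), Real.norm_of_nonneg (by positivity)]
  exact le_mul_of_one_le_right (by positivity) h1

/-- At level `r√n` the union bound has exponent `u log p + (u + 1) log K - l r √n`, and the positive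
terms are `o(√n)`. -/
theorem isLittleOInProb_supProj (hp : ∀ᶠ n in atTop, n < p n)
    (hu : (fun n => (u n : ℝ) * Real.log (p n)) =o[atTop] fun n => √(n : ℝ))
    {Z : ∀ n, Ω n → Fin n → Fin (p n) → ℝ} {f h : ∀ n, Ω n → EuclideanSpace ℝ (Fin n)}
    (hZ : ∀ n, Measurable (Z n)) (hf : ∀ n, Measurable (f n)) (hh : ∀ n, Measurable (h n))
    (hind : ∀ n, IndepFun (fun ω => (Z n ω, f n ω)) (h n) (P n))
    (hh_ind : ∀ n, iIndepFun (fun i ω => h n ω i) (P n)) {c : ℝ≥0}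
    (hsub : ∀ n i, HasSubgaussianMGF (fun ω => h n ω i) c (P n)) :
    IsLittleOInProb P (fun n ω => supProj (Matrix.of (Z n ω)) (u n) (f n ω) (h n ω))
      fun n => √(n : ℝ) := by
  intro r hr
  obtain ⟨l, K, hl, hK, htail⟩ := exists_tail_constants c
  -- Half of the exponential decay pays for the union bound; the other half tends to zero.
  have hlr : 0 < l * r / 2 := by positivity
  have hsum : (fun n => (u n : ℝ) * Real.log (p n) + ((u n : ℝ) + 1) * Real.log K)
      =o[atTop] fun n => √(n : ℝ) := by
    refine hu.add ?_
    have h1 : (fun _ : ℕ => (1 : ℝ)) =o[atTop] fun n : ℕ => √(n : ℝ) := by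
      rw [isLittleO_const_left]
      right
      exact tendsto_norm_atTop_atTop.comp (Real.tendsto_sqrt_atTop.comp tendsto_natCast_atTop_atTop)
    have := ((isLittleO_natCast_of_mul_log hp hu).add h1).const_mul_left (Real.log K)
    simpa only [mul_comm] using this
  have hlim : Tendsto (fun n : ℕ => ENNReal.ofReal (Real.exp (-(l * r / 2 * √(n : ℝ))))) atTop
      (𝓝 0) := by
    have h1 : Tendsto (fun n : ℕ => l * r / 2 * √(n : ℝ)) atTop atTop :=
      (Real.tendsto_sqrt_atTop.comp tendsto_natCast_atTop_atTop).const_mul_atTop hlr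
    have h2 := ENNReal.tendsto_ofReal
      (Real.tendsto_exp_atBot.comp (tendsto_neg_atTop_atBot.comp h1))
    simpa using h2
  refine tendsto_of_tendsto_of_tendsto_of_le_of_le' tendsto_const_nhds hlim
    (Eventually.of_forall fun _ => zero_le) ?_
  filter_upwards [hp, hsum.bound hlr] with n hn hbd
  have hpn : (0 : ℝ) < p n := by exact_mod_cast (by omega : 0 < p n)
  have hKpos : 0 < K := by linarith
  have habs : ∀ ω, |supProj (Matrix.of (Z n ω)) (u n) (f n ω) (h n ω)|
      = supProj (Matrix.of (Z n ω)) (u n) (f n ω) (h n ω) :=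
    fun ω => abs_of_nonneg (supProj_nonneg _ _ _ _)
  simp only [habs]
  refine (measure_lt_supProj_le (hZ n) (hf n) (hh n) (hind n) (u n)
    (t := r * √(n : ℝ)) (by positivity) hK
    (fun V d hd => htail (hh n) (hh_ind n) (hsub n) V d hd _)).trans ?_
  refine ENNReal.ofReal_le_ofReal ?_
  rw [Real.norm_eq_abs, Real.norm_of_nonneg (Real.sqrt_nonneg _)] at hbd
  have hbd' := (le_abs_self _).trans hbd
  have e1 : (p n : ℝ) ^ u n = Real.exp (u n * Real.log (p n)) := by
    rw [mul_comm, Real.exp_mul, Real.exp_log hpn, Real.rpow_natCast]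
  have e2 : K ^ (u n + 1) = Real.exp (((u n : ℝ) + 1) * Real.log K) := by
    rw [mul_comm, Real.exp_mul, Real.exp_log hKpos, ← Nat.cast_succ, Real.rpow_natCast]
  rw [e1, e2, ← Real.exp_add, ← Real.exp_add]
  refine Real.exp_le_exp.2 ?_
  have : l * (r * √(n : ℝ)) = l * r / 2 * √(n : ℝ) + l * r / 2 * √(n : ℝ) := by ring
  linarith

end UniformProjection

/-! ### Moments and independence of sub-Gaussian rows -/

section Moments

variable {Ω' : Type*} [MeasurableSpace Ω'] {P : Measure Ω'} [IsProbabilityMeasure P]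

/-- From `1 + tm ≤ E e^{tX} ≤ e^{ct²/2}`, the function `e^{ct²/2} - tm` has a minimum at `t = 0`,
where its derivative is `-m`. -/
theorem integral_eq_zero_of_hasSubgaussianMGF {X : Ω' → ℝ} {c : ℝ≥0}
    (hX : HasSubgaussianMGF X c P) : ∫ ω, X ω ∂P = 0 := by
  set m := ∫ ω, X ω ∂P with hm
  have h1 : ∀ t : ℝ, 1 + t * m ≤ Real.exp (c * t ^ 2 / 2) := by
    intro t
    refine le_trans ?_ (hX.mgf_le t)
    have h2 : ∫ ω, (1 + t * X ω) ∂P = 1 + t * m := by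
      rw [integral_add (integrable_const _) (hX.integrable.const_mul t), integral_const_mul]
      simp [hm]
    rw [← h2]
    refine integral_mono ((integrable_const _).add (hX.integrable.const_mul t))
      (hX.integrable_exp_mul t) fun ω => ?_
    have := Real.add_one_le_exp (t * X ω)
    simp only
    linarith
  have hmin : IsLocalMin (fun t : ℝ => Real.exp (c * t ^ 2 / 2) - t * m) 0 :=
    Eventually.of_forall fun t => by
      have := h1 t
      simp only [ne_eq, OfNat.ofNat_ne_zero, not_false_eq_true, zero_pow, mul_zero, zero_div,
        Real.exp_zero, zero_mul, sub_zero]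
      linarith
  have hder : HasDerivAt (fun t : ℝ => Real.exp (c * t ^ 2 / 2) - t * m)
      (Real.exp (c * 0 ^ 2 / 2) * (c * (2 * (0 : ℝ) ^ (2 - 1) * 1) / 2) - 1 * m) 0 :=
    (((((hasDerivAt_id (0 : ℝ)).pow 2).const_mul (c : ℝ)).div_const 2).exp).sub
      ((hasDerivAt_id (0 : ℝ)).mul_const m)
  have := hmin.hasDerivAt_eq_zero hder
  simpa using this

theorem integrable_pow_of_hasSubgaussianMGF {X : Ω' → ℝ} {c : ℝ≥0}
    (hX : HasSubgaussianMGF X c P) (k : ℕ) : Integrable (fun ω => X ω ^ k) P := by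
  have h := (hX.memLp k).integrable_norm_pow'
  refine h.mono' (hX.aestronglyMeasurable.pow k) (Eventually.of_forall fun ω => ?_)
  rw [norm_pow]

/-- Integrate `x⁴ / 4! ≤ e^{|x|} ≤ e^x + e^{-x}`; the explicit constant gives bounds uniform in `n`.
-/
theorem integral_pow_four_le_of_hasSubgaussianMGF {X : Ω' → ℝ} {c : ℝ≥0}
    (hX : HasSubgaussianMGF X c P) : ∫ ω, X ω ^ 4 ∂P ≤ 48 * Real.exp (c / 2) := by
  have h1 := hX.integrable_exp_mul 1
  have h2 := hX.integrable_exp_mul (-1)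
  have h3 := hX.mgf_le 1
  have h4 := hX.mgf_le (-1)
  simp only [mgf, one_pow, mul_one, neg_sq] at h3 h4
  have h5 : ∫ ω, X ω ^ 4 ∂P
      ≤ ∫ ω, 24 * (Real.exp (1 * X ω) + Real.exp (-1 * X ω)) ∂P := by
    refine integral_mono (integrable_pow_of_hasSubgaussianMGF hX 4) ((h1.add h2).const_mul 24)
      fun ω => ?_
    have h6 := Real.pow_div_factorial_le_exp |X ω| (abs_nonneg _) 4
    have h7 : Real.exp |X ω| ≤ Real.exp (1 * X ω) + Real.exp (-1 * X ω) := by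
      rcases abs_cases (X ω) with ⟨h, _⟩ | ⟨h, _⟩ <;> rw [h]
      · rw [one_mul]; linarith [Real.exp_pos (-1 * X ω)]
      · rw [neg_one_mul]; linarith [Real.exp_pos (1 * X ω)]
    have h8 : |X ω| ^ 4 = X ω ^ 4 := by
      rw [show (4 : ℕ) = 2 * 2 from rfl, pow_mul, pow_mul, sq_abs]
    have h9 : ((Nat.factorial 4 : ℕ) : ℝ) = 24 := by norm_num [Nat.factorial]
    rw [h8, h9, div_le_iff₀ (by norm_num)] at h6
    simp only
    linarith
  rw [integral_const_mul, integral_add h1 h2] at h5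
  linarith

theorem integral_sum_sq_of_iIndepFun {ι : Type*} [Fintype ι] {X : ι → Ω' → ℝ}
    (hX : ∀ i, MemLp (X i) 2 P) (hind : iIndepFun X P) (h0 : ∀ i, ∫ ω, X i ω ∂P = 0) :
    ∫ ω, (∑ i, X i ω) ^ 2 ∂P = ∑ i, ∫ ω, X i ω ^ 2 ∂P := by
  have h1 := IndepFun.variance_sum (s := Finset.univ) (fun i _ => hX i)
    (fun i _ j _ hij => hind.indepFun hij)
  have e1 : (∑ i, X i) = fun ω => ∑ i, X i ω := by
    funext ω; simp
  rw [e1, variance_of_integral_eq_zero] at h1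
  · rw [h1]
    exact Finset.sum_congr rfl fun i _ =>
      variance_of_integral_eq_zero (hX i).aestronglyMeasurable.aemeasurable (h0 i)
  · exact Finset.aemeasurable_fun_sum _ fun i _ => (hX i).aestronglyMeasurable.aemeasurable
  · rw [integral_finsetSum _ fun i _ => (hX i).integrable one_le_two]
    exact Finset.sum_eq_zero fun i _ => h0 i

/-- On rectangles, which form a generating π-system, the probability factors first between `f` and
`g` and then over the index. It makes the pairs `(H_i, ε_i)` independent across `i`. -/
theorem iIndepFun_prodMk_of_indepFun {ι α β : Type*} [Fintype ι] [MeasurableSpace α]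
    [MeasurableSpace β] {f : Ω' → ι → α} {g : Ω' → ι → β} (hf : Measurable f) (hg : Measurable g)
    (hfi : iIndepFun (fun i ω => f ω i) P) (hgi : iIndepFun (fun i ω => g ω i) P)
    (hfg : IndepFun f g P) : iIndepFun (fun i ω => (f ω i, g ω i)) P := by
  have hfm : ∀ i, Measurable fun ω => f ω i := fun i => (measurable_pi_apply i).comp hf
  have hgm : ∀ i, Measurable fun ω => g ω i := fun i => (measurable_pi_apply i).comp hg
  have hm : ∀ i, Measurable fun ω => (f ω i, g ω i) := fun i => (hfm i).prodMk (hgm i)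
  rw [iIndepFun_iff_map_fun_eq_pi_map fun i => (hm i).aemeasurable]
  symm
  have hp : ∀ i, IsProbabilityMeasure (P.map fun ω => (f ω i, g ω i)) := fun i =>
    Measure.isProbabilityMeasure_map (hm i).aemeasurable
  refine Measure.pi_eq_generateFrom (fun _ => generateFrom_prod) (fun _ => isPiSystem_prod)
    (fun i => ⟨fun _ => Set.univ, fun _ => ⟨Set.univ, MeasurableSet.univ, Set.univ,
      MeasurableSet.univ, Set.univ_prod_univ⟩, fun _ => measure_lt_top _ _, Set.iUnion_const _⟩)
    fun s hs => ?_
  choose A hA B hB hAB using hs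
  have hA' : ∀ i, MeasurableSet (A i) := hA
  have hB' : ∀ i, MeasurableSet (B i) := hB
  have hs' : ∀ i, s i = A i ×ˢ B i := fun i => (hAB i).symm
  have hsm : ∀ i, MeasurableSet (s i) := fun i => by rw [hs']; exact (hA' i).prod (hB' i)
  have hfg_i : ∀ i, IndepFun (fun ω => f ω i) (fun ω => g ω i) P := fun i =>
    hfg.comp (measurable_pi_apply i) (measurable_pi_apply i)
  rw [Measure.map_apply (measurable_pi_lambda _ hm) (MeasurableSet.univ_pi hsm)]
  have e1 : (fun ω i => (f ω i, g ω i)) ⁻¹' Set.univ.pi s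
      = f ⁻¹' (Set.univ.pi A) ∩ g ⁻¹' (Set.univ.pi B) := by
    ext ω
    simp [hs', Set.mem_prod, forall_and]
  rw [e1, hfg.measure_inter_preimage_eq_mul _ _ (MeasurableSet.univ_pi hA')
    (MeasurableSet.univ_pi hB')]
  have e2 : f ⁻¹' (Set.univ.pi A) = ⋂ i, (fun ω => f ω i) ⁻¹' A i := by ext; simp
  have e3 : g ⁻¹' (Set.univ.pi B) = ⋂ i, (fun ω => g ω i) ⁻¹' B i := by ext; simp
  rw [e2, e3, hfi.meas_iInter fun i => ⟨A i, hA' i, rfl⟩,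
    hgi.meas_iInter fun i => ⟨B i, hB' i, rfl⟩, ← Finset.prod_mul_distrib]
  refine Finset.prod_congr rfl fun i _ => ?_
  rw [Measure.map_apply (hm i) (hsm i), hs' i,
    ← (hfg_i i).measure_inter_preimage_eq_mul _ _ (hA' i) (hB' i)]
  rfl

end Moments

/-! ### Central limit theorem for triangular arrays -/

section CentralLimit

/-- Telescoping: factors in the unit disc are exchanged one at a time. -/
theorem norm_prod_sub_prod_le {ι : Type*} (s : Finset ι) {a b : ι → ℂ} (ha : ∀ i, ‖a i‖ ≤ 1)
    (hb : ∀ i, ‖b i‖ ≤ 1) : ‖∏ i ∈ s, a i - ∏ i ∈ s, b i‖ ≤ ∑ i ∈ s, ‖a i - b i‖ := by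
  classical
  induction s using Finset.induction_on with
  | empty => simp
  | insert i s hi ih =>
    rw [Finset.prod_insert hi, Finset.prod_insert hi, Finset.sum_insert hi]
    have e : a i * ∏ j ∈ s, a j - b i * ∏ j ∈ s, b j
        = (a i - b i) * ∏ j ∈ s, a j + b i * (∏ j ∈ s, a j - ∏ j ∈ s, b j) := by ring
    have h1 : ‖∏ j ∈ s, a j‖ ≤ 1 := by
      rw [norm_prod]
      exact Finset.prod_le_one (fun _ _ => norm_nonneg _) fun j _ => ha j
    rw [e]
    refine (norm_add_le _ _).trans ?_
    rw [norm_mul, norm_mul]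
    nlinarith [norm_nonneg (a i - b i), norm_nonneg (∏ j ∈ s, a j - ∏ j ∈ s, b j), hb i,
      norm_nonneg (b i)]

/-- For `|x| ≤ 1` this is the Taylor remainder with `e^{|x|} ≤ 4`; for `|x| > 1` the triangle
inequality suffices. -/
theorem norm_exp_mul_I_sub_taylor_two_le (x : ℝ) :
    ‖Complex.exp (x * Complex.I) - (1 + x * Complex.I - x ^ 2 / 2)‖ ≤ 4 * |x| ^ 3 := by
  rcases le_or_gt |x| 1 with hx | hx
  · have h := Complex.norm_exp_sub_sum_le_norm_mul_exp (x * Complex.I) 3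
    have e : ∑ m ∈ Finset.range 3, (x * Complex.I) ^ m / (m.factorial : ℂ)
        = 1 + x * Complex.I - x ^ 2 / 2 := by
      simp [Finset.sum_range_succ, mul_pow]
      ring
    rw [e, norm_mul, Complex.norm_I, mul_one, Complex.norm_real, Real.norm_eq_abs] at h
    refine h.trans ?_
    rw [mul_comm]
    have h2 : Real.exp |x| ≤ 4 := by
      refine (Real.exp_le_exp.2 hx).trans ?_
      linarith [Real.exp_one_lt_d9]
    gcongr
  · have h1 : ‖Complex.exp (x * Complex.I)‖ = 1 := Complex.norm_exp_ofReal_mul_I x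
    have h2 : ‖(1 + x * Complex.I - x ^ 2 / 2 : ℂ)‖ ≤ 1 + |x| + |x| ^ 2 / 2 := by
      refine (norm_sub_le _ _).trans (add_le_add ((norm_add_le _ _).trans ?_) ?_)
      · simp
      · simp
    refine (norm_sub_le _ _).trans ?_
    rw [h1]
    nlinarith [pow_pos (zero_lt_one.trans hx) 2, mul_pos (sub_pos.2 hx) (sub_pos.2 hx)]

/-- The second-order expansion is integrated, with the third absolute moment dominated through `|x|³
≤ 1 + x⁴`. -/
theorem norm_charFun_map_sub_le {Ω' : Type*} [MeasurableSpace Ω'] {P : Measure Ω'}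
    [IsProbabilityMeasure P] {X : Ω' → ℝ} (hX : Measurable X) (h0 : ∫ ω, X ω ∂P = 0)
    {v C : ℝ} (hv : ∫ ω, X ω ^ 2 ∂P = v) (h4 : Integrable (fun ω => X ω ^ 4) P)
    (hC : ∫ ω, X ω ^ 4 ∂P ≤ C) (s : ℝ) :
    ‖charFun (P.map X) s - (1 - s ^ 2 * v / 2)‖ ≤ 4 * |s| ^ 3 * (1 + C) := by
  have hdom : ∀ x : ℝ, |x| ^ 3 ≤ 1 + x ^ 4 := by
    intro x
    have h4' : x ^ 4 = |x| ^ 4 := by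
      rw [show (4 : ℕ) = 2 * 2 from rfl, pow_mul, pow_mul, sq_abs]
    rw [h4']
    rcases le_or_gt |x| 1 with h | h
    · nlinarith [pow_le_one₀ (n := 3) (abs_nonneg x) h, pow_nonneg (abs_nonneg x) 4]
    · nlinarith [pow_le_pow_right₀ h.le (by norm_num : 3 ≤ 4)]
  have hi4 : Integrable (fun ω => 1 + X ω ^ 4) P := (integrable_const _).add h4
  have hi3 : Integrable (fun ω => |X ω| ^ 3) P :=
    hi4.mono' (by fun_prop) (Eventually.of_forall fun ω => by
      rw [Real.norm_of_nonneg (by positivity)]; exact hdom _)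
  have hi2 : Integrable (fun ω => X ω ^ 2) P :=
    hi4.mono' (by fun_prop) (Eventually.of_forall fun ω => by
      rw [Real.norm_of_nonneg (by positivity)]
      nlinarith [sq_nonneg (X ω ^ 2 - 1), sq_nonneg (X ω ^ 2)])
  have hi1 : Integrable X P :=
    ((integrable_const (1 : ℝ)).add hi2).mono' (by fun_prop) (Eventually.of_forall fun ω => by
      rw [Real.norm_eq_abs]
      simp only [Pi.add_apply]
      nlinarith [sq_abs (X ω), sq_nonneg (|X ω| - 1)])
  have hiT : Integrable (fun ω => (1 + ((s * X ω : ℝ) : ℂ) * Complex.I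
      - ((s * X ω : ℝ) : ℂ) ^ 2 / 2)) P := by
    refine ((integrable_const _).add ((hi1.const_mul s).ofReal.mul_const _)).sub ?_
    have hsq : Integrable (fun ω => (s * X ω) ^ 2) P := by
      simp only [mul_pow]
      exact hi2.const_mul _
    have hsq' := (hsq.ofReal (𝕜 := ℂ)).div_const 2
    simpa using hsq'
  have hiE : Integrable (fun ω => Complex.exp (((s * X ω : ℝ) : ℂ) * Complex.I)) P :=
    (integrable_const (1 : ℝ)).mono' (by fun_prop) (Eventually.of_forall fun ω => by
      rw [Complex.norm_exp_ofReal_mul_I])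
  have e1 : charFun (P.map X) s = ∫ ω, Complex.exp (((s * X ω : ℝ) : ℂ) * Complex.I) ∂P := by
    rw [charFun_apply_real, integral_map hX.aemeasurable (by fun_prop)]
    push_cast
    rfl
  have e2 : ∫ ω, (1 + ((s * X ω : ℝ) : ℂ) * Complex.I - ((s * X ω : ℝ) : ℂ) ^ 2 / 2 : ℂ) ∂P
      = 1 - s ^ 2 * v / 2 := by
    have a1 : ∀ ω, (1 + ((s * X ω : ℝ) : ℂ) * Complex.I - ((s * X ω : ℝ) : ℂ) ^ 2 / 2 : ℂ)
        = (1 + ((X ω : ℝ) : ℂ) * (s * Complex.I)) - ((X ω ^ 2 : ℝ) : ℂ) * (s ^ 2 / 2) := by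
      intro ω; push_cast; ring
    simp only [a1]
    rw [integral_sub ((integrable_const _).add (hi1.ofReal.mul_const _))
      (hi2.ofReal.mul_const _), integral_add (integrable_const _) (hi1.ofReal.mul_const _),
      integral_mul_const, integral_mul_const, integral_complex_ofReal, integral_complex_ofReal, h0,
      hv]
    simp
    ring
  rw [e1, ← e2, ← integral_sub hiE hiT]
  refine (norm_integral_le_integral_norm _).trans ?_
  calc ∫ ω, ‖Complex.exp (((s * X ω : ℝ) : ℂ) * Complex.I)
          - (1 + ((s * X ω : ℝ) : ℂ) * Complex.I - ((s * X ω : ℝ) : ℂ) ^ 2 / 2)‖ ∂P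
      ≤ ∫ ω, 4 * |s| ^ 3 * (1 + X ω ^ 4) ∂P := by
        refine integral_mono (hiE.sub hiT).norm (hi4.const_mul _) fun ω => ?_
        refine (norm_exp_mul_I_sub_taylor_two_le (s * X ω)).trans ?_
        rw [abs_mul, mul_pow, ← mul_assoc]
        exact mul_le_mul_of_nonneg_left (hdom _) (by positivity)
    _ = 4 * |s| ^ 3 * (1 + ∫ ω, X ω ^ 4 ∂P) := by
        rw [integral_const_mul, integral_add (integrable_const _) h4]
        simp
    _ ≤ 4 * |s| ^ 3 * (1 + C) := by gcongr

/-- The central limit theorem for triangular arrays with bounded fourth moments, in terms of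
characteristic functions. -/
theorem tendsto_charFun_inv_sqrt_mul_sum {Ω : ℕ → Type*} [∀ n, MeasurableSpace (Ω n)]
    {P : ∀ n, Measure (Ω n)} [∀ n, IsProbabilityMeasure (P n)] {X : ∀ n, Fin n → Ω n → ℝ}
    (hX : ∀ n i, Measurable (X n i)) (hind : ∀ n, iIndepFun (X n) (P n))
    (h0 : ∀ n i, ∫ ω, X n i ω ∂(P n) = 0) {v C : ℝ} (hv0 : 0 ≤ v)
    (hv : ∀ n i, ∫ ω, X n i ω ^ 2 ∂(P n) = v)
    (h4 : ∀ n i, Integrable (fun ω => X n i ω ^ 4) (P n))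
    (hC : ∀ n i, ∫ ω, X n i ω ^ 4 ∂(P n) ≤ C) :
    Tendsto (fun n : ℕ => charFun ((P n).map fun ω => (√(n : ℝ))⁻¹ * ∑ i, X n i ω) 1) atTop
      (𝓝 (Complex.exp (-(v / 2)))) := by
  have hs : Tendsto (fun n : ℕ => (√(n : ℝ))⁻¹) atTop (𝓝 0) :=
    tendsto_inv_atTop_zero.comp (Real.tendsto_sqrt_atTop.comp tendsto_natCast_atTop_atTop)
  have hlim : Tendsto (fun n : ℕ => (√(n : ℝ))⁻¹ * (4 * (1 + C) + v ^ 2 / 4)) atTop (𝓝 0) := by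
    simpa using hs.mul_const (4 * (1 + C) + v ^ 2 / 4)
  have hsmall : ∀ᶠ n : ℕ in atTop, (√(n : ℝ))⁻¹ ^ 2 * v / 2 ≤ 1 := by
    have : Tendsto (fun n : ℕ => (√(n : ℝ))⁻¹ ^ 2 * v / 2) atTop (𝓝 0) := by
      simpa using ((hs.pow 2).mul_const v).div_const 2
    exact this.eventually_le_const one_pos
  rw [tendsto_iff_norm_sub_tendsto_zero]
  refine squeeze_zero' (Eventually.of_forall fun _ => norm_nonneg _) ?_ hlim
  filter_upwards [hsmall, eventually_ge_atTop 1] with n hn hn1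
  have hnpos : (0 : ℝ) < n := by exact_mod_cast hn1
  have hspos : 0 < √(n : ℝ) := Real.sqrt_pos.2 hnpos
  set s : ℝ := (√(n : ℝ))⁻¹ with hsdef
  have hs0 : 0 < s := inv_pos.2 hspos
  have hsn : (n : ℝ) * s ^ 2 = 1 := by
    rw [hsdef, inv_pow, Real.sq_sqrt hnpos.le, mul_inv_cancel₀ hnpos.ne']
  have hs1 : s ≤ 1 := by
    have h1n : (1 : ℝ) ≤ n := by exact_mod_cast hn1
    nlinarith
  -- The `n`-th root of the Gaussian limit, so that the limit becomes a product of `n` equal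
  -- factors.
  set b : ℂ := Complex.exp (-(s ^ 2 * v / 2)) with hb
  have hbn : ‖b‖ ≤ 1 := by
    rw [hb, Complex.norm_exp, Real.exp_le_one_iff]
    have : (-((s : ℂ) ^ 2 * v / 2)).re = -(s ^ 2 * v / 2) := by
      have h : (-((s : ℂ) ^ 2 * v / 2)) = ((-(s ^ 2 * v / 2) : ℝ) : ℂ) := by push_cast; ring
      rw [h, Complex.ofReal_re]
    rw [this]
    have : 0 ≤ s ^ 2 * v / 2 := by positivity
    linarith
  have e1 : charFun ((P n).map fun ω => s * ∑ i, X n i ω) 1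
      = ∏ i, charFun ((P n).map (X n i)) s := by
    rw [charFun_map_mul_comp (Finset.aemeasurable_fun_sum _ fun i _ => (hX n i).aemeasurable),
      (hind n).charFun_map_fun_sum_eq_prod fun i => (hX n i).aemeasurable]
    simp
  have e2 : Complex.exp (-(v / 2)) = ∏ _i : Fin n, b := by
    rw [Finset.prod_const, Finset.card_univ, Fintype.card_fin, hb, ← Complex.exp_nat_mul]
    congr 1
    have : ((n : ℝ) : ℂ) * (s : ℂ) ^ 2 = 1 := by exact_mod_cast congrArg (fun x : ℝ => (x : ℂ)) hsn
    rw [Complex.ofReal_natCast] at this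
    linear_combination (v / 2 : ℂ) * this
  rw [e1, e2]
  have hpr : ∀ i, IsProbabilityMeasure ((P n).map (X n i)) := fun i =>
    Measure.isProbabilityMeasure_map (hX n i).aemeasurable
  refine (norm_prod_sub_prod_le _ (fun i => norm_charFun_le_one _) fun _ => hbn).trans ?_
  -- Each factor differs by `O(s³)` with `s = n^{-1/2}`, so the `n` differences add up to `O(s)`.
  have hone : ∀ i, ‖charFun ((P n).map (X n i)) s - b‖
      ≤ 4 * s ^ 3 * (1 + C) + (s ^ 2 * v / 2) ^ 2 := by
    intro i
    have t1 := norm_charFun_map_sub_le (hX n i) (h0 n i) (hv n i) (h4 n i) (hC n i) s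
    rw [abs_of_pos hs0] at t1
    have t2 : ‖(1 - s ^ 2 * v / 2 : ℂ) - b‖ ≤ (s ^ 2 * v / 2) ^ 2 := by
      have h5 := Real.abs_exp_sub_one_sub_id_le (x := -(s ^ 2 * v / 2))
        (by rw [abs_neg, abs_of_nonneg (by positivity)]; exact hn)
      have h6 : (1 - s ^ 2 * v / 2 : ℂ) - b
          = ((-(Real.exp (-(s ^ 2 * v / 2)) - 1 - -(s ^ 2 * v / 2)) : ℝ) : ℂ) := by
        rw [hb]; push_cast; ring
      rw [h6, Complex.norm_real, Real.norm_eq_abs, abs_neg]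
      rwa [neg_sq] at h5
    calc ‖charFun ((P n).map (X n i)) s - b‖
        = ‖(charFun ((P n).map (X n i)) s - (1 - s ^ 2 * v / 2))
            + ((1 - s ^ 2 * v / 2 : ℂ) - b)‖ := by congr 1; ring
      _ ≤ _ := (norm_add_le _ _).trans (add_le_add t1 t2)
  refine (Finset.sum_le_sum fun i _ => hone i).trans ?_
  rw [Finset.sum_const, Finset.card_univ, Fintype.card_fin, nsmul_eq_mul]
  have e3 : (n : ℝ) * (4 * s ^ 3 * (1 + C) + (s ^ 2 * v / 2) ^ 2)
      = (n * s ^ 2) * (4 * s * (1 + C) + s ^ 2 * v ^ 2 / 4) := by ring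
  rw [e3, hsn, one_mul]
  have : s ^ 2 ≤ s := by nlinarith
  nlinarith [sq_nonneg v]

/-- Slutsky's theorem for characteristic functions: `|e^{iV} - e^{iW}|` is at most `|V - W|`, and at
most 2 on the exceptional event. -/
theorem tendsto_charFun_sub_of_isLittleOInProb {Ω : ℕ → Type*} [∀ n, MeasurableSpace (Ω n)]
    {P : ∀ n, Measure (Ω n)} [∀ n, IsProbabilityMeasure (P n)] {V W : ∀ n, Ω n → ℝ}
    (hV : ∀ n, Measurable (V n)) (hW : ∀ n, Measurable (W n))
    (hVW : IsLittleOInProb P (fun n ω => V n ω - W n ω) fun _ => 1) :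
    Tendsto (fun n => charFun ((P n).map (V n)) 1 - charFun ((P n).map (W n)) 1) atTop (𝓝 0) := by
  rw [Metric.tendsto_nhds]
  intro e he
  -- The total is then at most `e/4 + 2 · e/8 = e/2`.
  have h1 := (ENNReal.tendsto_nhds_zero.1 (hVW (e / 4) (by positivity))) (ENNReal.ofReal (e / 8))
    (by simpa using he)
  filter_upwards [h1] with n hn
  rw [dist_zero_right]
  have e1 : ∀ {U : Ω n → ℝ}, Measurable U →
      charFun ((P n).map U) 1 = ∫ ω, Complex.exp ((U ω : ℂ) * Complex.I) ∂(P n) := by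
    intro U hU
    rw [charFun_apply_real, integral_map hU.aemeasurable (by fun_prop)]
    simp
  have hi : ∀ {U : Ω n → ℝ}, Measurable U →
      Integrable (fun ω => Complex.exp ((U ω : ℂ) * Complex.I)) (P n) := fun hU =>
    (integrable_const (1 : ℝ)).mono' (by fun_prop) (Eventually.of_forall fun ω => by
      rw [Complex.norm_exp_ofReal_mul_I])
  rw [e1 (hV n), e1 (hW n), ← integral_sub (hi (hV n)) (hi (hW n))]
  set S : Set (Ω n) := {ω | e / 4 * 1 < |V n ω - W n ω|} with hS
  have hSm : MeasurableSet S := measurableSet_lt measurable_const ((hV n).sub (hW n)).norm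
  have hpt : ∀ ω, ‖Complex.exp ((V n ω : ℂ) * Complex.I) - Complex.exp ((W n ω : ℂ) * Complex.I)‖
      ≤ e / 4 + S.indicator (fun _ => (2 : ℝ)) ω := by
    intro ω
    by_cases hω : ω ∈ S
    · rw [Set.indicator_of_mem hω]
      refine (norm_sub_le _ _).trans ?_
      rw [Complex.norm_exp_ofReal_mul_I, Complex.norm_exp_ofReal_mul_I]
      linarith
    · rw [Set.indicator_of_notMem hω, add_zero]
      have h2 : |V n ω - W n ω| ≤ e / 4 := by
        have := not_lt.1 (show ¬ (e / 4 * 1 < |V n ω - W n ω|) from hω)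
        linarith
      refine le_trans ?_ h2
      have h3 : Complex.exp ((V n ω : ℂ) * Complex.I) - Complex.exp ((W n ω : ℂ) * Complex.I)
          = Complex.exp ((W n ω : ℂ) * Complex.I)
            * (Complex.exp (Complex.I * ((V n ω - W n ω : ℝ) : ℂ)) - 1) := by
        rw [mul_sub, ← Complex.exp_add, mul_one]
        congr 2
        push_cast
        ring
      rw [h3, norm_mul, Complex.norm_exp_ofReal_mul_I, one_mul]
      exact Real.norm_exp_I_mul_ofReal_sub_one_le
  have hint : Integrable (fun ω => e / 4 + S.indicator (fun _ => (2 : ℝ)) ω) (P n) :=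
    (integrable_const _).add ((integrable_const _).indicator hSm)
  refine (norm_integral_le_of_norm_le hint (Eventually.of_forall hpt)).trans_lt ?_
  rw [integral_add (integrable_const _) ((integrable_const _).indicator hSm),
    integral_indicator hSm]
  have hr : (P n).real S ≤ e / 8 := ENNReal.toReal_le_of_le_ofReal (by positivity) hn
  simp
  linarith

end CentralLimit

/-! ### Error of an exponential-weights fit -/

section FitError

/-- The error of the exponential-weights fit of the mean `f` from the response `f + ξ`. -/
noncomputable def fitError {n p : ℕ} (Z : Matrix (Fin n) (Fin p) ℝ) (u : ℕ) (α : ℝ)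
    (f ξ : Fin n → ℝ) : Fin n → ℝ :=
  f - Z *ᵥ ewCoef Z u α (f + ξ)

/-- The weighted squared bias contributes `10 T`. The squared norm adds `T` and the inner product
`2T`, so `12 T` serves for both. -/
theorem fitError_bounds {n p u : ℕ} (Z : Matrix (Fin n) (Fin p) ℝ) {α : ℝ} (hα : 0 < α)
    (f ξ : Fin n → ℝ) {m₀ : Finset (Fin p)} (hm₀ : m₀ ∈ models p u) {T : ℝ}
    (hT : supProj Z u (WithLp.toLp 2 f) (WithLp.toLp 2 ξ) ≤ T) :
    ‖(WithLp.toLp 2 (fitError Z u α f ξ) : EuclideanSpace ℝ (Fin n))‖ ^ 2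
        ≤ 3 * rss Z m₀ f + 12 * T + 2 * α * (u * Real.log p) ∧
      ∀ h : EuclideanSpace ℝ (Fin n), supProj Z u (WithLp.toLp 2 f) h ≤ T →
        |inner ℝ h (WithLp.toLp 2 (fitError Z u α f ξ))|
          ≤ 3 * rss Z m₀ f + 12 * T + 2 * α * (u * Real.log p) := by
  set f' : EuclideanSpace ℝ (Fin n) := WithLp.toLp 2 f with hf'
  set ξ' : EuclideanSpace ℝ (Fin n) := WithLp.toLp 2 ξ with hξ'
  have hcard : Real.log (models p u).card ≤ u * Real.log p := by
    rw [← Real.log_pow]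
    refine Real.log_le_log (by exact_mod_cast Finset.card_pos.2 ⟨m₀, hm₀⟩) ?_
    exact_mod_cast card_models_le p u
  have hTm : ∀ m ∈ models p u,
      ‖(colSpace Z m ⊔ Submodule.span ℝ {f'}).starProjection ξ'‖ ^ 2 ≤ T := fun m hm =>
    (le_supProj Z f' ξ' hm).trans hT
  have hw0 : ∀ m ∈ models p u, 0 ≤ weight Z u α (f + ξ) m := fun m _ =>
    div_nonneg (Real.exp_pos _).le (Finset.sum_nonneg fun _ _ => (Real.exp_pos _).le)
  have hw1 : ∑ m ∈ models p u, weight Z u α (f + ξ) m = 1 := by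
    simp only [weight]
    rw [← Finset.sum_div, div_self (Finset.sum_pos (fun _ _ => Real.exp_pos _) ⟨m₀, hm₀⟩).ne']
  have hT0 : 0 ≤ T := (supProj_nonneg _ _ _ _).trans hT
  have hD : ∑ m ∈ models p u, weight Z u α (f + ξ) m * ‖(colSpace Z m)ᗮ.starProjection f'‖ ^ 2
      ≤ 3 * rss Z m₀ f + 10 * T + 2 * α * (u * Real.log p) := by
    refine (sum_weight_mul_norm_orthogonal_sq_le (colSpace Z) f' ξ' hα hm₀ hTm).trans ?_
    have h1 : 2 * α * Real.log (models p u).card ≤ 2 * α * (u * Real.log p) := by gcongr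
    have h2 : ‖(colSpace Z m₀)ᗮ.starProjection f'‖ ^ 2 = rss Z m₀ f := rfl
    linarith
  have he : (WithLp.toLp 2 (fitError Z u α f ξ) : EuclideanSpace ℝ (Fin n))
      = f' - ∑ m ∈ models p u, weight Z u α (f + ξ) m • (colSpace Z m).starProjection (f' + ξ') := by
    rw [fitError, WithLp.toLp_sub, mulVec_ewCoef, WithLp.toLp_add]
  rw [he]
  refine ⟨?_, fun h hh => ?_⟩
  · have := norm_sub_sum_smul_starProjection_sq_le (colSpace Z) f' ξ' hw0 hw1 hTm
    linarith
  · have := abs_inner_sub_sum_smul_starProjection_le (colSpace Z) f' ξ' h hw0 hw1 hTm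
      fun m hm => (le_supProj Z f' h hm).trans hh
    linarith

variable {Ω : ℕ → Type*} [∀ n, MeasurableSpace (Ω n)] {P : ∀ n, Measure (Ω n)}
  [∀ n, IsProbabilityMeasure (P n)] {p u s : ℕ → ℕ}

/-- Eventually `u ≤ √n ≤ n < p`, so models of size `u` exist. -/
theorem eventually_le_of_mul_log (hp : ∀ᶠ n in atTop, n < p n)
    (hu : (fun n => (u n : ℝ) * Real.log (p n)) =o[atTop] fun n => √(n : ℝ)) :
    ∀ᶠ n in atTop, u n ≤ p n := by
  filter_upwards [hp, (isLittleO_natCast_of_mul_log hp hu).bound one_pos, eventually_ge_atTop 1]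
    with n hn hb h1
  rw [one_mul, Real.norm_of_nonneg (by positivity), Real.norm_of_nonneg (by positivity)] at hb
  have h2 : √(n : ℝ) ≤ n := by
    rw [Real.sqrt_le_left (by positivity)]
    have : (1 : ℝ) ≤ n := by exact_mod_cast h1
    nlinarith
  have h3 : u n ≤ n := by exact_mod_cast hb.trans h2
  omega

/-- The bound `B` is chosen before the noise vectors: one `o_P(√n)` variable serves all `ξ` and `h`
whose projections are controlled by `T`. -/
theorem exists_fitError_bound (hp : ∀ᶠ n in atTop, n < p n)
    (hu : (fun n => (u n : ℝ) * Real.log (p n)) =o[atTop] fun n => √(n : ℝ))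
    {Z : ∀ n, Ω n → Fin n → Fin (p n) → ℝ} {f : ∀ n, Ω n → Fin n → ℝ}
    (hf : WeaklySparse P Z f s fun n => √(n : ℝ)) (hsu : ∀ᶠ n in atTop, s n ≤ u n)
    {α : ℝ} (hα : 0 < α) {T : ∀ n, Ω n → ℝ} (hT : IsLittleOInProb P T fun n => √(n : ℝ)) :
    ∃ B : ∀ n, Ω n → ℝ, IsLittleOInProb P B (fun n => √(n : ℝ)) ∧
      ∀ᶠ n in atTop, ∀ ω, ∀ ξ : Fin n → ℝ,
        supProj (Matrix.of (Z n ω)) (u n) (WithLp.toLp 2 (f n ω)) (WithLp.toLp 2 ξ) ≤ T n ω →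
        ‖(WithLp.toLp 2 (fitError (Matrix.of (Z n ω)) (u n) α (f n ω) ξ) :
            EuclideanSpace ℝ (Fin n))‖ ^ 2 ≤ B n ω ∧
        ∀ h : EuclideanSpace ℝ (Fin n),
          supProj (Matrix.of (Z n ω)) (u n) (WithLp.toLp 2 (f n ω)) h ≤ T n ω →
          |inner ℝ h (WithLp.toLp 2 (fitError (Matrix.of (Z n ω)) (u n) α (f n ω) ξ))| ≤ B n ω := by
  obtain ⟨m, hm, hrss⟩ := hf
  refine ⟨fun n ω => 3 * rss (Matrix.of (Z n ω)) (m n) (f n ω) + 12 * T n ω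
    + 2 * α * (u n * Real.log (p n)), ?_, ?_⟩
  · exact ((hrss.const_mul 3).add (hT.const_mul 12)).add
      (isLittleOInProb_of_isLittleO (fun n => Real.sqrt_nonneg _) (hu.const_mul_left _))
  · filter_upwards [hsu, eventually_le_of_mul_log hp hu] with n hn hup ω ξ hξ
    have hcard : (m n).card = s n := (Finset.mem_powersetCard.1 (hm n)).2
    -- The sparse model has size `s ≤ u`; enlarging it to size `u` only lowers its residual sum of
    -- squares.
    obtain ⟨m₀, hsub, hm₀⟩ := Finset.exists_superset_card_eq (s := m n) (n := u n)
      (hcard.trans_le hn) (by simpa using hup)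
    have hmem : m₀ ∈ models (p n) (u n) :=
      Finset.mem_powersetCard.2 ⟨Finset.subset_univ _, hm₀⟩
    have hb := fitError_bounds (Matrix.of (Z n ω)) hα (f n ω) ξ hmem hξ
    have hle := rss_mono (Matrix.of (Z n ω)) hsub (f n ω)
    exact ⟨hb.1.trans (by linarith), fun h hh => (hb.2 h hh).trans (by linarith)⟩

end FitError

/-! ### Noise combinations, Gram matrix and score -/

section Noise

variable {Ω : ℕ → Type*} [∀ n, MeasurableSpace (Ω n)] {P : ∀ n, Measure (Ω n)} {q : ℕ}
  {H : ∀ n, Ω n → Fin n → Fin q → ℝ}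
  {ε : ∀ n, Ω n → Fin n → ℝ}

theorem indepFun_pow_pow {n : ℕ} (hHε : ∀ n, IndepFun (H n) (ε n) (P n))
    (t : Fin q → ℝ) (i : Fin n) (k : ℕ) :
    IndepFun (fun ω => (∑ j, t j * H n ω i j) ^ k) (fun ω => ε n ω i ^ k) (P n) :=
  (hHε n).comp (φ := fun x : Fin n → Fin q → ℝ => (∑ j, t j * x i j) ^ k)
    (ψ := fun y : Fin n → ℝ => y i ^ k) (by fun_prop) (by fun_prop)

variable [∀ n, IsProbabilityMeasure (P n)]

/-- Entries within one row of `H` may be dependent, so parameters are added without independence.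
Only a value common to all `n` and `i` matters. -/
theorem exists_hasSubgaussianMGF_sum_mul {Kη : Fin q → ℝ≥0}
    (hHsub : ∀ n i j, HasSubgaussianMGF (fun ω => H n ω i j) (Kη j) (P n)) (t : Fin q → ℝ) :
    ∃ c : ℝ≥0, ∀ n i, HasSubgaussianMGF (fun ω => ∑ j, t j * H n ω i j) c (P n) := by
  classical
  have h : ∀ s : Finset (Fin q), ∃ c : ℝ≥0, ∀ n i,
      HasSubgaussianMGF (fun ω => ∑ j ∈ s, t j * H n ω i j) c (P n) := by
    intro s
    induction s using Finset.induction_on with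
    | empty => exact ⟨0, fun n i => by simp⟩
    | insert j s hj ih =>
      obtain ⟨c, hc⟩ := ih
      have h1 := fun n i => ((hHsub n i j).const_mul (t j)).add (hc n i)
      simp only [Finset.sum_insert hj]
      exact ⟨_, h1⟩
  exact h Finset.univ

/-- General coefficients cover at once the columns of `H`, the error `ε` and the noise `Hβ + ε` of
the response. -/
theorem isLittleOInProb_supProj_noise {p u : ℕ → ℕ} (hp : ∀ᶠ n in atTop, n < p n)
    (hu : (fun n => (u n : ℝ) * Real.log (p n)) =o[atTop] fun n => √(n : ℝ))
    {Z : ∀ n, Ω n → Fin n → Fin (p n) → ℝ} {f : ∀ n, Ω n → Fin n → ℝ}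
    (hZ : ∀ n, Measurable (Z n)) (hf : ∀ n, Measurable (f n)) (hH : ∀ n, Measurable (H n))
    (hε : ∀ n, Measurable (ε n))
    (hHindep : ∀ n, iIndepFun (fun i ω => H n ω i) (P n))
    (hεindep : ∀ n, iIndepFun (fun i ω => ε n ω i) (P n))
    (hHε : ∀ n, IndepFun (H n) (ε n) (P n))
    (hind : ∀ n, IndepFun (fun ω => (H n ω, ε n ω)) (fun ω => (Z n ω, f n ω)) (P n))
    {Kη : Fin q → ℝ≥0} {Kε : ℝ≥0}
    (hHsub : ∀ n i j, HasSubgaussianMGF (fun ω => H n ω i j) (Kη j) (P n))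
    (hεsub : ∀ n i, HasSubgaussianMGF (fun ω => ε n ω i) Kε (P n)) (t : Fin q → ℝ) (t₀ : ℝ) :
    IsLittleOInProb P (fun n ω => supProj (Matrix.of (Z n ω)) (u n) (WithLp.toLp 2 (f n ω))
      (WithLp.toLp 2 fun i => ∑ j, t j * H n ω i j + t₀ * ε n ω i)) fun n => √(n : ℝ) := by
  obtain ⟨c, hc⟩ := exists_hasSubgaussianMGF_sum_mul hHsub t
  have hφ : Measurable fun x : (Fin q → ℝ) × ℝ => ∑ j, t j * x.1 j + t₀ * x.2 := by fun_prop
  have hΦ : ∀ n, Measurable fun x : (Fin n → Fin q → ℝ) × (Fin n → ℝ) =>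
      (WithLp.toLp 2 fun i => ∑ j, t j * x.1 i j + t₀ * x.2 i : EuclideanSpace ℝ (Fin n)) := by
    intro n
    refine (WithLp.measurable_toLp 2 _).comp (measurable_pi_lambda _ fun i => ?_)
    fun_prop
  refine isLittleOInProb_supProj hp hu (f := fun n ω => WithLp.toLp 2 (f n ω)) hZ
    (fun n => (WithLp.measurable_toLp 2 _).comp (hf n))
    (fun n => (hΦ n).comp ((hH n).prodMk (hε n))) (fun n => ?_) (fun n => ?_) fun n i =>
      (hc n i).add ((hεsub n i).const_mul t₀)
  · have hψ : Measurable fun x : (Fin n → Fin (p n) → ℝ) × (Fin n → ℝ) =>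
        (x.1, (WithLp.toLp 2 x.2 : EuclideanSpace ℝ (Fin n))) :=
      measurable_fst.prodMk ((WithLp.measurable_toLp 2 _).comp measurable_snd)
    exact (hind n).symm.comp hψ (hΦ n)
  · exact (iIndepFun_prodMk_of_indepFun (hH n) (hε n) (hHindep n) (hεindep n) (hHε n)).comp
      (fun _ x => ∑ j, t j * x.1 j + t₀ * x.2) fun _ => hφ

variable {SigmaH : Matrix (Fin q) (Fin q) ℝ} {σε2 : ℝ} {Kη : Fin q → ℝ≥0} {Kε : ℝ≥0}

theorem integral_mul_eq_of_covariance
    (hHsub : ∀ n i j, HasSubgaussianMGF (fun ω => H n ω i j) (Kη j) (P n))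
    (hSigmaH : ∀ n i j k, covariance (fun ω => H n ω i j) (fun ω => H n ω i k) (P n) = SigmaH j k)
    (n : ℕ) (i : Fin n) (j k : Fin q) : ∫ ω, H n ω i j * H n ω i k ∂(P n) = SigmaH j k := by
  have h := covariance_eq_sub ((hHsub n i j).memLp 2) ((hHsub n i k).memLp 2)
  rw [hSigmaH, integral_eq_zero_of_hasSubgaussianMGF (hHsub n i j), zero_mul, sub_zero] at h
  exact h.symm

theorem integral_sq_eq_of_variance
    (hεsub : ∀ n i, HasSubgaussianMGF (fun ω => ε n ω i) Kε (P n))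
    (hσε : ∀ n i, variance (fun ω => ε n ω i) (P n) = σε2) (n : ℕ) (i : Fin n) :
    ∫ ω, ε n ω i ^ 2 ∂(P n) = σε2 := by
  rw [← hσε n i, variance_of_integral_eq_zero (hεsub n i).aemeasurable
    (integral_eq_zero_of_hasSubgaussianMGF (hεsub n i))]

theorem integrable_mul_of_hasSubgaussianMGF {Ω' : Type*} [MeasurableSpace Ω'] {Q : Measure Ω'}
    [IsProbabilityMeasure Q] {X Y : Ω' → ℝ} {c d : ℝ≥0} (hX : HasSubgaussianMGF X c Q)
    (hY : HasSubgaussianMGF Y d Q) : Integrable (fun ω => X ω * Y ω) Q :=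
  MemLp.integrable_mul (p := 2) (q := 2) (hX.memLp 2) (hY.memLp 2)

theorem integral_sum_mul_sq
    (hHsub : ∀ n i j, HasSubgaussianMGF (fun ω => H n ω i j) (Kη j) (P n))
    (hSigmaH : ∀ n i j k, covariance (fun ω => H n ω i j) (fun ω => H n ω i k) (P n) = SigmaH j k)
    (n : ℕ) (i : Fin n) (t : Fin q → ℝ) :
    ∫ ω, (∑ j, t j * H n ω i j) ^ 2 ∂(P n) = t ⬝ᵥ SigmaH *ᵥ t := by
  have e : ∀ ω, (∑ j, t j * H n ω i j) ^ 2
      = ∑ j, ∑ k, t j * t k * (H n ω i j * H n ω i k) := by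
    intro ω
    rw [sq, Finset.sum_mul_sum]
    exact Finset.sum_congr rfl fun j _ => Finset.sum_congr rfl fun k _ => by ring
  have hint : ∀ j k, Integrable (fun ω => t j * t k * (H n ω i j * H n ω i k)) (P n) := fun j k =>
    (integrable_mul_of_hasSubgaussianMGF (hHsub n i j) (hHsub n i k)).const_mul _
  simp only [e]
  rw [integral_finsetSum _ fun j _ => integrable_finsetSum _ fun k _ => hint j k]
  simp only [dotProduct, Matrix.mulVec, Finset.mul_sum]
  refine Finset.sum_congr rfl fun j _ => ?_
  rw [integral_finsetSum _ fun k _ => hint j k]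
  refine Finset.sum_congr rfl fun k _ => ?_
  rw [integral_const_mul, integral_mul_eq_of_covariance hHsub hSigmaH]
  ring

theorem posSemidef_of_covariance
    (hHsub : ∀ n i j, HasSubgaussianMGF (fun ω => H n ω i j) (Kη j) (P n))
    (hSigmaH : ∀ n i j k, covariance (fun ω => H n ω i j) (fun ω => H n ω i k) (P n) = SigmaH j k) :
    SigmaH.PosSemidef := by
  refine Matrix.PosSemidef.of_dotProduct_mulVec_nonneg ?_ fun t => ?_
  · ext j k
    rw [Matrix.conjTranspose_apply, star_trivial, ← hSigmaH 1 0, ← hSigmaH 1 0, covariance_comm]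
  -- Sample size 1 is the smallest with a row; the quadratic form is the second moment of a
  -- combination of that row.
  · rw [star_trivial, ← integral_sum_mul_sq hHsub hSigmaH 1 0 t]
    exact integral_nonneg fun ω => sq_nonneg _

/-- The weak law of large numbers for the Gram matrix of `H`. -/
theorem isLittleOInProb_gram_sub (hH : ∀ n, Measurable (H n))
    (hHindep : ∀ n, iIndepFun (fun i ω => H n ω i) (P n))
    (hHsub : ∀ n i j, HasSubgaussianMGF (fun ω => H n ω i j) (Kη j) (P n))
    (hSigmaH : ∀ n i j k, covariance (fun ω => H n ω i j) (fun ω => H n ω i k) (P n) = SigmaH j k)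
    (j k : Fin q) :
    IsLittleOInProb P (fun n ω => (∑ i, H n ω i j * H n ω i k) / n - SigmaH j k) fun _ => 1 := by
  have hm : ∀ n i, ∫ ω, H n ω i j * H n ω i k ∂(P n) = SigmaH j k := fun n i =>
    integral_mul_eq_of_covariance hHsub hSigmaH n i j k
  generalize SigmaH j k = m at hm ⊢
  set C : ℝ := 48 * Real.exp (Kη j / 2) + 48 * Real.exp (Kη k / 2) + m ^ 2 with hC
  have hb : Tendsto (fun n : ℕ => 2 * C / n) atTop (𝓝 0) :=
    tendsto_const_div_atTop_nhds_zero_nat _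
  -- Chebyshev: the centred products are independent with second moment at most `2C`, so their mean
  -- has second moment at most `2C / n`.
  refine isLittleOInProb_of_tendsto_integral_sq hb ?_
  filter_upwards [eventually_ge_atTop 1] with n hn
  have hn0 : (n : ℝ) ≠ 0 := by exact_mod_cast (by omega : n ≠ 0)
  set X : Fin n → Ω n → ℝ := fun i ω => H n ω i j * H n ω i k - m with hX
  have hHm : ∀ i j, Measurable fun ω => H n ω i j := fun i j =>
    (measurable_pi_apply j).comp ((measurable_pi_apply i).comp (hH n))
  have hXm : ∀ i, Measurable (X i) := fun i => ((hHm i j).mul (hHm i k)).sub_const _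
  have hdom : ∀ i ω, X i ω ^ 2 ≤ 2 * (H n ω i j ^ 4 + H n ω i k ^ 4 + m ^ 2) := by
    intro i ω
    simp only [hX]
    nlinarith [sq_nonneg (H n ω i j ^ 2 - H n ω i k ^ 2), sq_nonneg (H n ω i j ^ 2),
      sq_nonneg (H n ω i k ^ 2), sq_nonneg (H n ω i j * H n ω i k + m)]
  have hdomint : ∀ i, Integrable
      (fun ω => 2 * (H n ω i j ^ 4 + H n ω i k ^ 4 + m ^ 2)) (P n) := fun i =>
    (((integrable_pow_of_hasSubgaussianMGF (hHsub n i j) 4).add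
      (integrable_pow_of_hasSubgaussianMGF (hHsub n i k) 4)).add (integrable_const _)).const_mul 2
  have hX2 : ∀ i, Integrable (fun ω => X i ω ^ 2) (P n) := fun i =>
    (hdomint i).mono' ((hXm i).pow_const 2).aestronglyMeasurable (Eventually.of_forall fun ω => by
      rw [Real.norm_of_nonneg (sq_nonneg _)]; exact hdom i ω)
  have hXL : ∀ i, MemLp (X i) 2 (P n) := fun i =>
    (memLp_two_iff_integrable_sq (hXm i).aestronglyMeasurable).2 (hX2 i)
  have hXC : ∀ i, ∫ ω, X i ω ^ 2 ∂(P n) ≤ 2 * C := by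
    intro i
    refine (integral_mono (hX2 i) (hdomint i) (hdom i)).trans ?_
    have hI : Integrable (fun ω => H n ω i j ^ 4 + H n ω i k ^ 4) (P n) :=
      (integrable_pow_of_hasSubgaussianMGF (hHsub n i j) 4).add
        (integrable_pow_of_hasSubgaussianMGF (hHsub n i k) 4)
    rw [integral_const_mul, integral_add hI (integrable_const _),
      integral_add (integrable_pow_of_hasSubgaussianMGF (hHsub n i j) 4)
        (integrable_pow_of_hasSubgaussianMGF (hHsub n i k) 4)]
    have h1 := integral_pow_four_le_of_hasSubgaussianMGF (hHsub n i j)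
    have h2 := integral_pow_four_le_of_hasSubgaussianMGF (hHsub n i k)
    simp only [integral_const, probReal_univ, one_smul]
    linarith
  have hX0 : ∀ i, ∫ ω, X i ω ∂(P n) = 0 := by
    intro i
    simp only [hX]
    rw [integral_sub (integrable_mul_of_hasSubgaussianMGF (hHsub n i j) (hHsub n i k))
      (integrable_const _), hm n i]
    simp
  have hXind : iIndepFun X (P n) :=
    (hHindep n).comp (fun _ x => x j * x k - m) fun _ => by fun_prop
  have hS := integral_sum_sq_of_iIndepFun hXL hXind hX0
  have hSL : MemLp (fun ω => ∑ i, X i ω) 2 (P n) := memLp_finsetSum _ fun i _ => hXL i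
  have e : ∀ ω, ((∑ i, H n ω i j * H n ω i k) / n - m) ^ 2
      = (1 / (n : ℝ) ^ 2) * (∑ i, X i ω) ^ 2 := by
    intro ω
    have : ∑ i, X i ω = ∑ i, H n ω i j * H n ω i k - n * m := by
      simp [hX, Finset.sum_sub_distrib]
    rw [this]
    field_simp
  simp only [e]
  refine ⟨hSL.integrable_sq.const_mul _, ?_⟩
  rw [integral_const_mul, hS]
  calc 1 / (n : ℝ) ^ 2 * ∑ i, ∫ ω, X i ω ^ 2 ∂(P n) ≤ 1 / (n : ℝ) ^ 2 * ∑ _i : Fin n, 2 * C := by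
        gcongr with i _
        exact hXC i
    _ = 2 * C / n := by
        rw [Finset.sum_const, Finset.card_univ, Fintype.card_fin, nsmul_eq_mul]
        field_simp

/-- The central limit theorem for the score `Hᵀ ε`, together with its second moments. -/
theorem score_moments_and_limit (hH : ∀ n, Measurable (H n)) (hε : ∀ n, Measurable (ε n))
    (hHindep : ∀ n, iIndepFun (fun i ω => H n ω i) (P n))
    (hεindep : ∀ n, iIndepFun (fun i ω => ε n ω i) (P n))
    (hHε : ∀ n, IndepFun (H n) (ε n) (P n))
    (hHsub : ∀ n i j, HasSubgaussianMGF (fun ω => H n ω i j) (Kη j) (P n))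
    (hεsub : ∀ n i, HasSubgaussianMGF (fun ω => ε n ω i) Kε (P n))
    (hSigmaH : ∀ n i j k, covariance (fun ω => H n ω i j) (fun ω => H n ω i k) (P n) = SigmaH j k)
    (hσε : ∀ n i, variance (fun ω => ε n ω i) (P n) = σε2) (t : Fin q → ℝ) :
    IsBigOInProb P (fun n ω => (√(n : ℝ))⁻¹ * ∑ i, (∑ j, t j * H n ω i j) * ε n ω i) (fun _ => 1) ∧
    Tendsto (fun n : ℕ => charFun ((P n).map fun ω =>
      (√(n : ℝ))⁻¹ * ∑ i, (∑ j, t j * H n ω i j) * ε n ω i) 1) atTop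
      (𝓝 (Complex.exp (-(((t ⬝ᵥ SigmaH *ᵥ t) * σε2 : ℝ) / 2)))) := by
  obtain ⟨c, hc⟩ := exists_hasSubgaussianMGF_sum_mul hHsub t
  set X : ∀ n, Fin n → Ω n → ℝ := fun n i ω => (∑ j, t j * H n ω i j) * ε n ω i with hX
  have hHm : ∀ n i j, Measurable fun ω => H n ω i j := fun n i j =>
    (measurable_pi_apply j).comp ((measurable_pi_apply i).comp (hH n))
  have hεm : ∀ n i, Measurable fun ω => ε n ω i := fun n i => (measurable_pi_apply i).comp (hε n)
  have hζm : ∀ n i, Measurable fun ω => ∑ j, t j * H n ω i j := fun n i =>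
    Finset.measurable_fun_sum _ fun j _ => (hHm n i j).const_mul _
  have hXm : ∀ n i, Measurable (X n i) := fun n i => (hζm n i).mul (hεm n i)
  have hXind : ∀ n, iIndepFun (X n) (P n) := fun n =>
    (iIndepFun_prodMk_of_indepFun (hH n) (hε n) (hHindep n) (hεindep n) (hHε n)).comp
      (fun _ x => (∑ j, t j * x.1 j) * x.2) fun _ => by fun_prop
  -- Independence of `H` and `ε` factorizes the moments, giving mean zero, the limiting variance and
  -- a uniform fourth-moment bound.
  have hpow : ∀ n i k, ∫ ω, X n i ω ^ k ∂(P n)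
      = (∫ ω, (∑ j, t j * H n ω i j) ^ k ∂(P n)) * ∫ ω, ε n ω i ^ k ∂(P n) := by
    intro n i k
    simp only [hX, mul_pow]
    exact (indepFun_pow_pow hHε t i k).integral_fun_mul_eq_mul_integral
      ((hζm n i).pow_const k).aestronglyMeasurable ((hεm n i).pow_const k).aestronglyMeasurable
  have hpowint : ∀ n i k, Integrable (fun ω => X n i ω ^ k) (P n) := by
    intro n i k
    simp only [hX, mul_pow]
    exact (indepFun_pow_pow hHε t i k).integrable_mul
      (integrable_pow_of_hasSubgaussianMGF (hc n i) k)
      (integrable_pow_of_hasSubgaussianMGF (hεsub n i) k)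
  have h0 : ∀ n i, ∫ ω, X n i ω ∂(P n) = 0 := by
    intro n i
    have := hpow n i 1
    simp only [pow_one] at this
    rw [this, integral_eq_zero_of_hasSubgaussianMGF (hc n i), zero_mul]
  have h2 : ∀ n i, ∫ ω, X n i ω ^ 2 ∂(P n) = (t ⬝ᵥ SigmaH *ᵥ t) * σε2 := by
    intro n i
    rw [hpow, integral_sum_mul_sq hHsub hSigmaH, integral_sq_eq_of_variance hεsub hσε]
  have h4 : ∀ n i, ∫ ω, X n i ω ^ 4 ∂(P n)
      ≤ 48 * Real.exp (c / 2) * (48 * Real.exp (Kε / 2)) := by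
    intro n i
    rw [hpow]
    refine mul_le_mul (integral_pow_four_le_of_hasSubgaussianMGF (hc n i))
      (integral_pow_four_le_of_hasSubgaussianMGF (hεsub n i)) ?_ (by positivity)
    exact integral_nonneg fun ω => by positivity
  have hv0 : 0 ≤ (t ⬝ᵥ SigmaH *ᵥ t) * σε2 := by
    rw [← h2 1 0]
    exact integral_nonneg fun ω => sq_nonneg _
  have hXL : ∀ n i, MemLp (X n i) 2 (P n) := fun n i =>
    (memLp_two_iff_integrable_sq (hXm n i).aestronglyMeasurable).2 (hpowint n i 2)
  refine ⟨isBigOInProb_of_integral_sq_le (C := (t ⬝ᵥ SigmaH *ᵥ t) * σε2) ?_,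
    tendsto_charFun_inv_sqrt_mul_sum hXm hXind h0 hv0 h2 (fun n i => hpowint n i 4) h4⟩
  filter_upwards [eventually_ge_atTop 1] with n hn
  have hnpos : (0 : ℝ) < n := by exact_mod_cast hn
  have hSL : MemLp (fun ω => ∑ i, X n i ω) 2 (P n) := memLp_finsetSum _ fun i _ => hXL n i
  change Integrable (fun ω => ((√(n : ℝ))⁻¹ * ∑ i, X n i ω) ^ 2) (P n) ∧
    ∫ ω, ((√(n : ℝ))⁻¹ * ∑ i, X n i ω) ^ 2 ∂(P n) ≤ _
  simp only [mul_pow]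
  refine ⟨hSL.integrable_sq.const_mul _, ?_⟩
  rw [integral_const_mul, integral_sum_sq_of_iIndepFun (hXL n) (hXind n) (h0 n)]
  simp only [h2]
  rw [Finset.sum_const, Finset.card_univ, Fintype.card_fin, nsmul_eq_mul, inv_pow,
    Real.sq_sqrt hnpos.le, ← mul_assoc, inv_mul_cancel₀ hnpos.ne', one_mul]

end Noise

/-! ### Algebraic decomposition of the estimation error -/

section Decomposition

theorem sum_mul_eq_inner {n : ℕ} (a b : Fin n → ℝ) :
    ∑ i, a i * b i = inner ℝ (WithLp.toLp 2 a : EuclideanSpace ℝ (Fin n)) (WithLp.toLp 2 b) := by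
  simp [PiLp.inner_apply, mul_comm]

theorem abs_inner_le_of_norm_sq_le {E : Type*} [NormedAddCommGroup E] [InnerProductSpace ℝ E]
    {x y : E} {B : ℝ} (hx : ‖x‖ ^ 2 ≤ B) (hy : ‖y‖ ^ 2 ≤ B) : |inner ℝ x y| ≤ B := by
  have := abs_real_inner_le_norm x y
  nlinarith [sq_nonneg (‖x‖ - ‖y‖)]

theorem abs_gram_sub_le {E : Type*} [NormedAddCommGroup E] [InnerProductSpace ℝ E] {B : ℝ}
    {h₁ h₂ e₁ e₂ : E} (b₁ : ‖e₁‖ ^ 2 ≤ B) (b₂ : ‖e₂‖ ^ 2 ≤ B) (b₃ : |inner ℝ h₁ e₂| ≤ B)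
    (b₄ : |inner ℝ h₂ e₁| ≤ B) :
    |inner ℝ (h₁ + e₁) (h₂ + e₂) - inner ℝ h₁ h₂| ≤ 3 * B := by
  have h : inner ℝ (h₁ + e₁) (h₂ + e₂) - inner ℝ h₁ h₂
      = inner ℝ h₁ e₂ + inner ℝ h₂ e₁ + inner ℝ e₁ e₂ := by
    rw [inner_add_left, inner_add_right, inner_add_right, real_inner_comm h₂ e₁]
    ring
  rw [h]
  have h1 := abs_add_le (inner ℝ h₁ e₂ + inner ℝ h₂ e₁) (inner ℝ e₁ e₂)
  have h2 := abs_add_le (inner ℝ h₁ e₂) (inner ℝ h₂ e₁)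
  have h3 := abs_inner_le_of_norm_sq_le b₁ b₂
  linarith

/-- Five remainder terms appear on expanding: three bounded by `B`, and two sums over `k` bounded by
`(∑ |β_k|) B`. Inner products of noise with error are assumed small directly, since `‖h‖ ‖e‖` would
be too large. -/
theorem abs_score_sub_le {E κ : Type*} [NormedAddCommGroup E] [InnerProductSpace ℝ E] [Fintype κ]
    {B : ℝ} {h e₀ ε e : E} {r : κ → E} (β : κ → ℝ) (b₀ : ‖e₀‖ ^ 2 ≤ B) (b : ‖e‖ ^ 2 ≤ B)
    (br : ∀ k, ‖r k‖ ^ 2 ≤ B) (hr : ∀ k, |inner ℝ h (r k)| ≤ B) (he : |inner ℝ h e| ≤ B)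
    (hε : |inner ℝ ε e₀| ≤ B) :
    |inner ℝ (h + e₀) (ε + e - ∑ k, β k • r k) - inner ℝ h ε| ≤ (3 + 2 * ∑ k, |β k|) * B := by
  have hs : ∀ x : E, (∀ k, |inner ℝ x (r k)| ≤ B) →
      |inner ℝ x (∑ k, β k • r k)| ≤ (∑ k, |β k|) * B := by
    intro x hx
    rw [inner_sum, Finset.sum_mul]
    refine (Finset.abs_sum_le_sum_abs _ _).trans (Finset.sum_le_sum fun k _ => ?_)
    rw [inner_smul_right, abs_mul]
    exact mul_le_mul_of_nonneg_left (hx k) (abs_nonneg _)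
  have h1 := hs h hr
  have h2 := hs e₀ fun k => abs_inner_le_of_norm_sq_le b₀ (br k)
  have h3 := abs_inner_le_of_norm_sq_le b₀ b
  have h4 : inner ℝ (h + e₀) (ε + e - ∑ k, β k • r k) - inner ℝ h ε
      = inner ℝ h e - inner ℝ h (∑ k, β k • r k) + inner ℝ ε e₀ + inner ℝ e₀ e
        - inner ℝ e₀ (∑ k, β k • r k) := by
    rw [inner_add_left, inner_sub_right, inner_sub_right, inner_add_right, inner_add_right,
      real_inner_comm ε e₀]
    ring
  rw [h4]
  rw [abs_le] at *
  constructor <;> linarith [h1.1, h1.2, h2.1, h2.2, h3.1, h3.2, he.1, he.2, hε.1, hε.2]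

variable {n p q : ℕ}

/-- Regrouping `Y` as `(Nβ + μ) + (Hβ + ε)` shows that its residual is `Rβ + r`: the terms `-β_k
e_k` in `r` compensate for the fit errors inside `Rβ`. Invertibility of `RᵀR` then isolates `β`. -/
theorem betaEW_sub_eq (Z : Matrix (Fin n) (Fin p) ℝ) (uδ : Fin q → ℕ) (αX : Fin q → ℝ) (uθ : ℕ)
    (αY : ℝ) (N H : Fin n → Fin q → ℝ) (μ ε : Fin n → ℝ) (β : Fin q → ℝ)
    {R : Fin n → Fin q → ℝ} {r : Fin n → ℝ}
    (hR : ∀ i j, R i j = H i j + fitError Z (uδ j) (αX j) (fun i => N i j) (fun i => H i j) i)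
    (hr : ∀ i, r i = ε i
      + fitError Z uθ αY (Matrix.of N *ᵥ β + μ) (fun i => ∑ j, β j * H i j + ε i) i
      - ∑ k, β k * fitError Z (uδ k) (αX k) (fun i => N i k) (fun i => H i k) i)
    (hdet : (Matrix.of fun j k => ∑ i, R i j * R i k).det ≠ 0) :
    betaEW Z uδ αX uθ αY (Matrix.of (N + H)) (Matrix.of (N + H) *ᵥ β + μ + ε) - β
      = (Matrix.of fun j k => ∑ i, R i j * R i k)⁻¹ *ᵥ fun j => ∑ i, R i j * r i := by
  have e1 : Matrix.of (N + H) - Z * ewDelta Z uδ αX (Matrix.of (N + H)) = Matrix.of R := by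
    ext i j
    simp only [Matrix.sub_apply, Matrix.of_apply, hR, fitError, Pi.sub_apply, Pi.add_apply]
    have : (Z * ewDelta Z uδ αX (Matrix.of (N + H))) i j
        = (Z *ᵥ ewCoef Z (uδ j) (αX j) ((fun i => N i j) + fun i => H i j)) i := rfl
    rw [this]
    ring
  have e2 : Matrix.of (N + H) *ᵥ β + μ + ε
      = (Matrix.of N *ᵥ β + μ) + fun i => ∑ j, β j * H i j + ε i := by
    funext i
    simp only [Pi.add_apply, Matrix.mulVec, dotProduct, Matrix.of_apply, add_mul,
      Finset.sum_add_distrib]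
    simp only [mul_comm (β _)]
    ring
  have e3 : (Matrix.of (N + H) *ᵥ β + μ + ε)
      - Z *ᵥ ewCoef Z uθ αY (Matrix.of (N + H) *ᵥ β + μ + ε) = Matrix.of R *ᵥ β + r := by
    rw [e2]
    funext i
    simp only [Pi.add_apply, Pi.sub_apply, hr, Matrix.mulVec, dotProduct, Matrix.of_apply, hR,
      add_mul, Finset.sum_add_distrib, fitError]
    simp only [mul_comm (β _)]
    ring
  have e4 : (Matrix.of R)ᵀ * Matrix.of R = Matrix.of fun j k => ∑ i, R i j * R i k := by
    ext j k
    simp [Matrix.mul_apply]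
  have e5 : (Matrix.of R)ᵀ *ᵥ r = fun j => ∑ i, R i j * r i := by
    funext j
    simp [Matrix.mulVec, dotProduct]
  have hunit : IsUnit (Matrix.of fun j k => ∑ i, R i j * R i k).det := isUnit_iff_ne_zero.2 hdet
  simp only [betaEW]
  rw [e1, e3, Matrix.mulVec_add, Matrix.mulVec_mulVec, e4, Matrix.mulVec_add,
    Matrix.mulVec_mulVec, Matrix.nonsing_inv_mul _ hunit, Matrix.one_mulVec, e5,
    add_sub_cancel_left]

end Decomposition

/-! ### Continuous mapping for random matrices -/

section MatrixLimit

variable {Ω : ℕ → Type*} [∀ n, MeasurableSpace (Ω n)] {P : ∀ n, Measure (Ω n)} {q : ℕ}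

theorem isLittleOInProb_comp_matrix {M : ∀ n, Ω n → Matrix (Fin q) (Fin q) ℝ}
    {A : Matrix (Fin q) (Fin q) ℝ} {g : Matrix (Fin q) (Fin q) ℝ → ℝ} (hg : ContinuousAt g A)
    (hM : ∀ j k, IsLittleOInProb P (fun n ω => M n ω j k - A j k) fun _ => 1) :
    IsLittleOInProb P (fun n ω => g (M n ω) - g A) fun _ => 1 := by
  let φ : (Fin q × Fin q → ℝ) → Matrix (Fin q) (Fin q) ℝ := fun x => Matrix.of fun j k => x (j, k)
  have hc : Continuous φ := continuous_matrix fun j k => continuous_apply (j, k)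
  let a : Fin q × Fin q → ℝ := fun x => A x.1 x.2
  have ha : φ a = A := rfl
  have hg₁ : ContinuousAt g (φ a) := by rw [ha]; exact hg
  have hg₂ : ContinuousAt (g ∘ φ) a := ContinuousAt.comp hg₁ hc.continuousAt
  let M' : ∀ n, Ω n → Fin q × Fin q → ℝ := fun n ω x => M n ω x.1 x.2
  have hM' : ∀ x : Fin q × Fin q, IsLittleOInProb P (fun n ω => M' n ω x - a x) fun _ => 1 :=
    fun x => hM x.1 x.2
  exact isLittleOInProb_comp_continuousAt (M := M') hg₂ hM'

end MatrixLimit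

/-! ### Linearization and convergence in distribution -/

section Limit

variable {Ω : ℕ → Type*} [∀ n, MeasurableSpace (Ω n)] {P : ∀ n, Measure (Ω n)}
  [∀ n, IsProbabilityMeasure (P n)] {q : ℕ}

theorem continuousAt_matrix_inv_apply {A : Matrix (Fin q) (Fin q) ℝ} (hA : A.det ≠ 0)
    (j k : Fin q) : ContinuousAt (fun M : Matrix (Fin q) (Fin q) ℝ => M⁻¹ j k) A := by
  have h : (fun M : Matrix (Fin q) (Fin q) ℝ => M⁻¹ j k)
      = fun M => M.det⁻¹ * M.adjugate j k := by
    funext M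
    rw [Matrix.inv_def, Ring.inverse_eq_inv', Matrix.smul_apply, smul_eq_mul]
  rw [h]
  exact ContinuousAt.mul (ContinuousAt.inv₀ continuous_id.matrix_det.continuousAt hA)
    (continuous_id.matrix_adjugate.matrix_elem j k).continuousAt

theorem tendsto_measure_det_eq_zero {M : ∀ n, Ω n → Matrix (Fin q) (Fin q) ℝ}
    {A : Matrix (Fin q) (Fin q) ℝ} (hA : A.det ≠ 0)
    (hM : ∀ j k, IsLittleOInProb P (fun n ω => M n ω j k - A j k) fun _ => 1) :
    Tendsto (fun n => P n {ω | (M n ω).det = 0}) atTop (𝓝 0) := by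
  have h : IsLittleOInProb P (fun n ω => (M n ω).det - A.det) fun _ => 1 :=
    isLittleOInProb_comp_matrix (g := Matrix.det) continuous_id.matrix_det.continuousAt hM
  refine tendsto_measure_of_eventually_subset (h (|A.det| / 2) (half_pos (abs_pos.2 hA)))
    (Eventually.of_forall fun n ω hω => ?_)
  have hω' : (M n ω).det = 0 := hω
  have : |A.det| / 2 * 1 < |(M n ω).det - A.det| := by
    rw [hω', zero_sub, abs_neg, mul_one]
    exact half_lt_self (abs_pos.2 hA)
  exact this

theorem sqrt_mul_inv_mulVec {S : Matrix (Fin q) (Fin q) ℝ} {n : ℕ} (hn : 1 ≤ n)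
    (hS : S.det ≠ 0) (c : Fin q → ℝ) (j : Fin q) :
    √(n : ℝ) * (S⁻¹ *ᵥ c) j = ∑ k, ((n : ℝ)⁻¹ • S)⁻¹ j k * (c k / √(n : ℝ)) := by
  have hn0 : (0 : ℝ) < n := by exact_mod_cast hn
  have hsq : √(n : ℝ) * √(n : ℝ) = n := Real.mul_self_sqrt hn0.le
  have hsq0 : √(n : ℝ) ≠ 0 := (Real.sqrt_pos.2 hn0).ne'
  have hSM : ((n : ℝ)⁻¹ • S)⁻¹ = (n : ℝ) • S⁻¹ := by
    refine Matrix.inv_eq_right_inv ?_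
    rw [Matrix.mul_smul, Matrix.smul_mul, smul_smul, mul_inv_cancel₀ hn0.ne', one_smul,
      Matrix.mul_nonsing_inv _ (isUnit_iff_ne_zero.2 hS)]
  rw [hSM, Matrix.mulVec, dotProduct, Finset.mul_sum]
  refine Finset.sum_congr rfl fun k _ => ?_
  rw [Matrix.smul_apply, smul_eq_mul]
  field_simp
  rw [pow_two, hsq]
  ring

/-- With `M = S/n` and `c' = c/√n`, write `M⁻¹c' - A⁻¹G = (M⁻¹ - A⁻¹)c' + A⁻¹(c' - G)`. The first
factor vanishes in probability by continuity of inversion at `A`, while `c'` stays bounded. Where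
`S` is singular nothing is assumed about `b`, but that event has vanishing probability. -/
theorem isLittleOInProb_linearized {S : ∀ n, Ω n → Matrix (Fin q) (Fin q) ℝ}
    {c G b : ∀ n, Ω n → Fin q → ℝ} {A : Matrix (Fin q) (Fin q) ℝ} (hA : IsUnit A)
    (hS : ∀ j k, IsLittleOInProb P (fun n ω => S n ω j k / n - A j k) fun _ => 1)
    (hc : ∀ k, IsLittleOInProb P (fun n ω => c n ω k / √(n : ℝ) - G n ω k) fun _ => 1)
    (hG : ∀ k, IsBigOInProb P (fun n ω => G n ω k) fun _ => 1)
    (hb : ∀ n ω, (S n ω).det ≠ 0 → b n ω = (S n ω)⁻¹ *ᵥ c n ω)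
    (t : Fin q → ℝ) :
    IsLittleOInProb P (fun n ω => ∑ j, t j * (√(n : ℝ) * b n ω j)
      - ∑ j, ∑ k, t j * A⁻¹ j k * G n ω k) fun _ => 1 := by
  have hdetA : A.det ≠ 0 := ((Matrix.isUnit_iff_isUnit_det A).1 hA).ne_zero
  have hM : ∀ j k, IsLittleOInProb P (fun n ω => ((n : ℝ)⁻¹ • S n ω) j k - A j k) fun _ => 1 := by
    intro j k
    have : (fun (n : ℕ) ω => ((n : ℝ)⁻¹ • S n ω) j k - A j k)
        = fun (n : ℕ) (ω : Ω n) => S n ω j k / n - A j k := by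
      funext n ω
      rw [Matrix.smul_apply, smul_eq_mul, div_eq_inv_mul]
    rw [this]
    exact hS j k
  have hinv : ∀ j k, IsLittleOInProb P
      (fun n ω => ((n : ℝ)⁻¹ • S n ω)⁻¹ j k - A⁻¹ j k) fun _ => 1 := fun j k =>
    isLittleOInProb_comp_matrix (g := fun M => M⁻¹ j k) (continuousAt_matrix_inv_apply hdetA j k) hM
  have hmain : IsLittleOInProb P (fun n ω => ∑ j, ∑ k, (t j * ((((n : ℝ)⁻¹ • S n ω)⁻¹ j k - A⁻¹ j k)
      * (c n ω k / √(n : ℝ))) + t j * A⁻¹ j k * (c n ω k / √(n : ℝ) - G n ω k))) fun _ => 1 := by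
    refine IsLittleOInProb.sum (fun _ => zero_le_one) fun j _ =>
      IsLittleOInProb.sum (fun _ => zero_le_one) fun k _ => ?_
    refine IsLittleOInProb.add (IsLittleOInProb.const_mul ?_ _) ((hc k).const_mul _)
    refine (hinv j k).mul_isBigOInProb ?_
    have := (hG k).add_isLittleOInProb (hc k)
    simpa using this
  refine hmain.congr_of_tendsto
    (tendsto_measure_of_eventually_subset (tendsto_measure_det_eq_zero hdetA hM) ?_)
  filter_upwards [eventually_ge_atTop 1] with n hn ω hω
  by_contra hne
  apply hω
  have hdetS : (S n ω).det ≠ 0 := by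
    intro h0
    apply hne
    show ((n : ℝ)⁻¹ • S n ω).det = 0
    rw [Matrix.det_smul, h0, mul_zero]
  rw [hb n ω hdetS, ← Finset.sum_sub_distrib]
  refine Finset.sum_congr rfl fun j _ => ?_
  rw [sqrt_mul_inv_mulVec hn hdetS, Finset.mul_sum, ← Finset.sum_sub_distrib]
  exact Finset.sum_congr rfl fun k _ => by ring

theorem isLittleO_mul_log_of_le {p v w : ℕ → ℕ} (hp : ∀ᶠ n in atTop, n < p n)
    (hw : (fun n => (w n : ℝ)) =o[atTop] fun n => √(n : ℝ) / Real.log (p n))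
    (hvw : ∀ n, v n ≤ w n) :
    (fun n => (v n : ℝ) * Real.log (p n)) =o[atTop] fun n => √(n : ℝ) := by
  refine IsLittleO.of_bound fun C hC => ?_
  filter_upwards [hw.bound hC, hp, eventually_ge_atTop 1] with n hn hpn h1
  have hlog : 0 < Real.log (p n) := Real.log_pos (by exact_mod_cast (by omega : 1 < p n))
  rw [Real.norm_of_nonneg (by positivity), Real.norm_of_nonneg (by positivity), ← mul_div_assoc,
    le_div_iff₀ hlog] at hn
  rw [Real.norm_of_nonneg (by positivity), Real.norm_of_nonneg (by positivity)]
  refine le_trans ?_ hn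
  have : (v n : ℝ) ≤ w n := by exact_mod_cast hvw n
  gcongr

/-- Cramér-Wold and Lévy continuity: the characteristic function of a vector at `t` is that of its
`t`-combination at 1. -/
theorem tendstoInDistribution_of_charFun {b : ∀ n, Ω n → EuclideanSpace ℝ (Fin q)}
    (hb : ∀ n, Measurable (b n)) {ν : Measure (EuclideanSpace ℝ (Fin q))} [IsProbabilityMeasure ν]
    (h : ∀ t : Fin q → ℝ, Tendsto (fun n => charFun ((P n).map fun ω => ∑ j, t j * b n ω j) 1) atTop
      (𝓝 (charFun ν (WithLp.toLp 2 t)))) :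
    TendstoInDistribution b atTop (id : EuclideanSpace ℝ (Fin q) → EuclideanSpace ℝ (Fin q)) P ν where
  forall_aemeasurable n := (hb n).aemeasurable
  tendsto := by
    refine ProbabilityMeasure.tendsto_iff_tendsto_charFun.2 fun t => ?_
    have h1 := h t.ofLp
    simp only [ProbabilityMeasure.coe_mk, Measure.map_id]
    refine h1.congr fun n => ?_
    have hm : Measurable fun ω => ∑ j, t.ofLp j * b n ω j :=
      Finset.measurable_fun_sum _ fun j _ =>
        ((EuclideanSpace.proj (𝕜 := ℝ) j).measurable.comp (hb n)).const_mul _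
    rw [charFun_apply_real, charFun_apply, integral_map hm.aemeasurable (by fun_prop),
      integral_map (hb n).aemeasurable (by fun_prop)]
    refine integral_congr_ae (Eventually.of_forall fun ω => ?_)
    simp [PiLp.inner_apply]

end Limit

/-! ### Fit errors against all noise vectors -/

section FitErrorNoise

variable {Ω : ℕ → Type*} [∀ n, MeasurableSpace (Ω n)] {P : ∀ n, Measure (Ω n)}
  [∀ n, IsProbabilityMeasure (P n)] {q : ℕ}
  {H : ∀ n, Ω n → Fin n → Fin q → ℝ} {ε : ∀ n, Ω n → Fin n → ℝ}
  {Kη : Fin q → ℝ≥0} {Kε : ℝ≥0}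

theorem exists_fitError_bound_noise {p u s : ℕ → ℕ} (hp : ∀ᶠ n in atTop, n < p n)
    (hu : (fun n => (u n : ℝ) * Real.log (p n)) =o[atTop] fun n => √(n : ℝ))
    {Z : ∀ n, Ω n → Fin n → Fin (p n) → ℝ} {f : ∀ n, Ω n → Fin n → ℝ}
    (hfs : WeaklySparse P Z f s fun n => √(n : ℝ)) (hsu : ∀ᶠ n in atTop, s n ≤ u n)
    {α : ℝ} (hα : 0 < α)
    (hZ : ∀ n, Measurable (Z n)) (hf : ∀ n, Measurable (f n)) (hH : ∀ n, Measurable (H n))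
    (hε : ∀ n, Measurable (ε n))
    (hHindep : ∀ n, iIndepFun (fun i ω => H n ω i) (P n))
    (hεindep : ∀ n, iIndepFun (fun i ω => ε n ω i) (P n))
    (hHε : ∀ n, IndepFun (H n) (ε n) (P n))
    (hind : ∀ n, IndepFun (fun ω => (H n ω, ε n ω)) (fun ω => (Z n ω, f n ω)) (P n))
    (hHsub : ∀ n i j, HasSubgaussianMGF (fun ω => H n ω i j) (Kη j) (P n))
    (hεsub : ∀ n i, HasSubgaussianMGF (fun ω => ε n ω i) Kε (P n)) (t : Fin q → ℝ) (t₀ : ℝ) :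
    ∃ B : ∀ n, Ω n → ℝ, IsLittleOInProb P B (fun n => √(n : ℝ)) ∧
      ∀ᶠ n in atTop, ∀ ω, ∀ ξ : Fin n → ℝ, (ξ = fun i => ∑ j, t j * H n ω i j + t₀ * ε n ω i) →
        ‖(WithLp.toLp 2 (fitError (Matrix.of (Z n ω)) (u n) α (f n ω) ξ) :
            EuclideanSpace ℝ (Fin n))‖ ^ 2 ≤ B n ω ∧
        (∀ k, |inner ℝ (WithLp.toLp 2 fun i => H n ω i k : EuclideanSpace ℝ (Fin n))
          (WithLp.toLp 2 (fitError (Matrix.of (Z n ω)) (u n) α (f n ω) ξ))| ≤ B n ω) ∧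
        |inner ℝ (WithLp.toLp 2 (ε n ω) : EuclideanSpace ℝ (Fin n))
          (WithLp.toLp 2 (fitError (Matrix.of (Z n ω)) (u n) α (f n ω) ξ))| ≤ B n ω := by
  have hsup := isLittleOInProb_supProj_noise hp hu hZ hf hH hε hHindep hεindep hHε hind hHsub hεsub
  -- One `T` for every noise vector needed: the sum of the suprema for `ξ`, for all columns of `H`
  -- and for `ε`. All summands are nonnegative, so `T` dominates each.
  have hT := ((hsup t t₀).add (IsLittleOInProb.sum (s := Finset.univ)
    (fun n => Real.sqrt_nonneg (n : ℝ)) fun k _ => hsup (Pi.single k 1) 0)).add (hsup 0 1)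
  obtain ⟨B, hB, hbound⟩ := exists_fitError_bound hp hu hfs hsu hα hT
  have hH_eq : ∀ n ω k, (fun i => ∑ j, (Pi.single k 1 : Fin q → ℝ) j * H n ω i j + 0 * ε n ω i)
      = fun i => H n ω i k := by
    intro n ω k
    funext i
    simp [Pi.single_apply]
  have hε_eq : ∀ n ω, (fun i => ∑ j, (0 : Fin q → ℝ) j * H n ω i j + 1 * ε n ω i) = ε n ω := by
    intro n ω
    funext i
    simp
  refine ⟨B, hB, hbound.mono fun n hn ω ξ hξ => ?_⟩
  simp only [hH_eq, hε_eq] at hn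
  have h₀ : ∀ h, 0 ≤ supProj (Matrix.of (Z n ω)) (u n) (WithLp.toLp 2 (f n ω)) h :=
    fun h => supProj_nonneg _ _ _ _
  have h₁ := Finset.sum_nonneg (s := Finset.univ) fun k _ =>
    h₀ (WithLp.toLp 2 fun i => H n ω i k)
  have h₂ := h₀ (WithLp.toLp 2 (ε n ω))
  have h₃ := h₀ (WithLp.toLp 2 ξ)
  have hres := hn ω ξ (by rw [hξ] at h₃ ⊢; linarith)
  rw [← hξ] at hres
  refine ⟨hres.1, fun k => hres.2 _ ?_, hres.2 _ ?_⟩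
  · have := Finset.single_le_sum (s := Finset.univ) (fun k _ =>
      h₀ (WithLp.toLp 2 fun i => H n ω i k)) (Finset.mem_univ k)
    linarith
  · linarith

end FitErrorNoise

/-! ### Replacing residuals by noise in the Gram matrix and score -/

section Residuals

variable {Ω : ℕ → Type*} [∀ n, MeasurableSpace (Ω n)] {P : ∀ n, Measure (Ω n)} {q : ℕ}
  {H e : ∀ n, Ω n → Fin n → Fin q → ℝ} {ε e₀ : ∀ n, Ω n → Fin n → ℝ} {B : ∀ n, Ω n → ℝ}

theorem IsLittleOInProb.of_abs_le {V W : ∀ n, Ω n → ℝ} {a : ℕ → ℝ}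
    (hW : IsLittleOInProb P W a) (h : ∀ᶠ n in atTop, ∀ ω, |V n ω| ≤ W n ω) :
    IsLittleOInProb P V a := fun r hr =>
  tendsto_measure_of_eventually_subset (hW r hr)
    (h.mono fun n hn ω (hω : r * a n < |V n ω|) => hω.trans_le ((hn ω).trans (le_abs_self _)))

theorem toLp_fun_add {n : ℕ} (a b : Fin n → ℝ) :
    (WithLp.toLp 2 fun i => a i + b i : EuclideanSpace ℝ (Fin n))
      = WithLp.toLp 2 a + WithLp.toLp 2 b := rfl

/-- There is slack: the difference is `o_P(√n)` while the scale is `n`. -/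
theorem isLittleOInProb_residual_gram_sub (hB : IsLittleOInProb P B fun n => √(n : ℝ))
    (he : ∀ᶠ n in atTop, ∀ ω j, ‖(WithLp.toLp 2 fun i => e n ω i j : EuclideanSpace ℝ (Fin n))‖ ^ 2
      ≤ B n ω)
    (hHe : ∀ᶠ n in atTop, ∀ ω j k, |inner ℝ (WithLp.toLp 2 fun i => H n ω i j :
      EuclideanSpace ℝ (Fin n)) (WithLp.toLp 2 fun i => e n ω i k)| ≤ B n ω) (j k : Fin q) :
    IsLittleOInProb P (fun n ω => (∑ i, (H n ω i j + e n ω i j) * (H n ω i k + e n ω i k)) / n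
      - (∑ i, H n ω i j * H n ω i k) / n) fun _ => 1 := by
  have h : IsLittleOInProb P (fun n ω => ∑ i, (H n ω i j + e n ω i j) * (H n ω i k + e n ω i k)
      - ∑ i, H n ω i j * H n ω i k) fun n => √(n : ℝ) := by
    refine (hB.const_mul 3).of_abs_le ?_
    filter_upwards [he, hHe] with n h₁ h₂ ω
    rw [sum_mul_eq_inner, sum_mul_eq_inner, toLp_fun_add, toLp_fun_add]
    exact abs_gram_sub_le (h₁ ω j) (h₁ ω k) (h₂ ω j k) (h₂ ω k j)
  have hn : ∀ᶠ n : ℕ in atTop, 0 < (n : ℝ) ∧ √(n : ℝ) ≤ n := by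
    filter_upwards [eventually_ge_atTop 1] with n hn
    have : (1 : ℝ) ≤ n := by exact_mod_cast hn
    exact ⟨by linarith, Real.sqrt_le_iff.2 ⟨by linarith, by nlinarith⟩⟩
  simpa only [sub_div] using h.div_scale hn

/-- Here the scale is `√n`, so the rate `o_P(√n)` of the error bounds is exactly what is used. -/
theorem isLittleOInProb_residual_score_sub (hB : IsLittleOInProb P B fun n => √(n : ℝ))
    (he : ∀ᶠ n in atTop, ∀ ω j, ‖(WithLp.toLp 2 fun i => e n ω i j : EuclideanSpace ℝ (Fin n))‖ ^ 2
      ≤ B n ω)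
    (hHe : ∀ᶠ n in atTop, ∀ ω j k, |inner ℝ (WithLp.toLp 2 fun i => H n ω i j :
      EuclideanSpace ℝ (Fin n)) (WithLp.toLp 2 fun i => e n ω i k)| ≤ B n ω)
    (hεe : ∀ᶠ n in atTop, ∀ ω k, |inner ℝ (WithLp.toLp 2 (ε n ω) : EuclideanSpace ℝ (Fin n))
      (WithLp.toLp 2 fun i => e n ω i k)| ≤ B n ω)
    (he₀ : ∀ᶠ n in atTop, ∀ ω, ‖(WithLp.toLp 2 (e₀ n ω) : EuclideanSpace ℝ (Fin n))‖ ^ 2 ≤ B n ω)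
    (hHe₀ : ∀ᶠ n in atTop, ∀ ω j, |inner ℝ (WithLp.toLp 2 fun i => H n ω i j :
      EuclideanSpace ℝ (Fin n)) (WithLp.toLp 2 (e₀ n ω))| ≤ B n ω) (β : Fin q → ℝ) (j : Fin q) :
    IsLittleOInProb P (fun n ω => (∑ i, (H n ω i j + e n ω i j)
        * (ε n ω i + e₀ n ω i - ∑ k, β k * e n ω i k)) / √(n : ℝ)
      - (√(n : ℝ))⁻¹ * ∑ i, H n ω i j * ε n ω i) fun _ => 1 := by
  have h : IsLittleOInProb P (fun n ω => ∑ i, (H n ω i j + e n ω i j)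
        * (ε n ω i + e₀ n ω i - ∑ k, β k * e n ω i k)
      - ∑ i, H n ω i j * ε n ω i) fun n => √(n : ℝ) := by
    refine (hB.const_mul (3 + 2 * ∑ k, |β k|)).of_abs_le ?_
    filter_upwards [he, hHe, hεe, he₀, hHe₀] with n h₁ h₂ h₃ h₄ h₅ ω
    have hsum : (WithLp.toLp 2 fun i => ε n ω i + e₀ n ω i - ∑ k, β k * e n ω i k :
        EuclideanSpace ℝ (Fin n)) = WithLp.toLp 2 (ε n ω) + WithLp.toLp 2 (e₀ n ω)
          - ∑ k, β k • WithLp.toLp 2 fun i => e n ω i k := by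
      ext i
      simp
    rw [sum_mul_eq_inner, sum_mul_eq_inner, hsum, toLp_fun_add]
    exact abs_score_sub_le β (h₁ ω j) (h₄ ω) (h₁ ω) (h₂ ω j) (h₅ ω j) (h₃ ω j)
  have hn : ∀ᶠ n : ℕ in atTop, 0 < √(n : ℝ) ∧ √(n : ℝ) ≤ √(n : ℝ) := by
    filter_upwards [eventually_ge_atTop 1] with n hn
    exact ⟨Real.sqrt_pos.2 (by exact_mod_cast hn), le_rfl⟩
  simpa only [div_eq_inv_mul, mul_sub] using h.div_scale hn

end Residuals

/-! ### The Gaussian limit, and measurability of the mean -/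

theorem measurable_mulVec_const {Ω' : Type*} [MeasurableSpace Ω'] {n q : ℕ}
    {V : Ω' → Fin n → Fin q → ℝ} (hV : Measurable V) (β : Fin q → ℝ) :
    Measurable fun ω => Matrix.of (V ω) *ᵥ β := by
  refine measurable_pi_lambda _ fun i => ?_
  simp only [Matrix.mulVec, dotProduct, Matrix.of_apply]
  exact Finset.measurable_fun_sum _ fun j _ =>
    ((measurable_pi_apply j).comp ((measurable_pi_apply i).comp hV)).mul_const _

theorem dotProduct_mulVec_vecMul_inv {q : ℕ} {A : Matrix (Fin q) (Fin q) ℝ} (hA : IsUnit A)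
    (t : Fin q → ℝ) : (t ᵥ* A⁻¹) ⬝ᵥ A *ᵥ (t ᵥ* A⁻¹) = (t ᵥ* A⁻¹) ⬝ᵥ t := by
  rw [Matrix.dotProduct_mulVec, Matrix.vecMul_vecMul,
    Matrix.nonsing_inv_mul _ ((Matrix.isUnit_iff_isUnit_det A).1 hA), Matrix.vecMul_one,
    dotProduct_comm]

theorem charFun_multivariateGaussian_zero_smul_inv {q : ℕ} {A : Matrix (Fin q) (Fin q) ℝ}
    (hA : IsUnit A) (hA' : A.PosSemidef) {c : ℝ} (hc : 0 ≤ c) (t : Fin q → ℝ) :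
    charFun (multivariateGaussian 0 (c • A⁻¹)) (WithLp.toLp 2 t)
      = Complex.exp (-((((t ᵥ* A⁻¹) ⬝ᵥ A *ᵥ (t ᵥ* A⁻¹)) * c : ℝ) / 2)) := by
  rw [charFun_multivariateGaussian (hA'.inv.smul hc), dotProduct_mulVec_vecMul_inv hA,
    ← Matrix.dotProduct_mulVec, Matrix.smul_mulVec, dotProduct_smul, inner_zero_right, smul_eq_mul,
    mul_comm c]
  simp

end ExpWeights

/-! ### Assembly of the asymptotic normality -/

open ExpWeights in
theorem mainTheorem2
    -- the triangular array: for each sample size `n` a probability space carrying the data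
    {Ω : ℕ → Type*} [∀ n, MeasurableSpace (Ω n)]
    (P : ∀ n, Measure (Ω n)) [∀ n, IsProbabilityMeasure (P n)]
    (q : ℕ) (hq : 1 < q)
    (p : ℕ → ℕ) (hp : ∀ᶠ n in atTop, n < p n)
    (β : Fin q → ℝ)
    (Z : ∀ n, Ω n → Fin n → Fin (p n) → ℝ)
    (X N H : ∀ n, Ω n → Fin n → Fin q → ℝ)
    (Y μ ε : ∀ n, Ω n → Fin n → ℝ)
    (hZ : ∀ n, Measurable (Z n)) (hN : ∀ n, Measurable (N n)) (hH : ∀ n, Measurable (H n))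
    (hμ : ∀ n, Measurable (μ n)) (hε : ∀ n, Measurable (ε n))
    -- the models `Y = X β + μ + ε` and `X = N + H`
    (hY : ∀ n ω, Y n ω = Matrix.of (X n ω) *ᵥ β + μ n ω + ε n ω)
    (hX : ∀ n ω, X n ω = N n ω + H n ω)
    -- the squared norms of the means are `O_P(n)`
    (hB1μ : ExpWeights.IsBigOInProb P (fun n ω => ‖(WithLp.toLp 2 (μ n ω) : EuclideanSpace ℝ (Fin n))‖ ^ 2)
      (fun n => (n : ℝ)))
    (hB1N : ∀ j, ExpWeights.IsBigOInProb P
      (fun n ω => ‖(WithLp.toLp 2 (fun i => N n ω i j) : EuclideanSpace ℝ (Fin n))‖ ^ 2)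
      (fun n => (n : ℝ)))
    -- the rows of `H` and the entries of `ε` are mutually independent, and jointly
    -- independent of the design and the means
    (hHindep : ∀ n, iIndepFun (fun i ω => H n ω i) (P n))
    (hεindep : ∀ n, iIndepFun (fun i ω => ε n ω i) (P n))
    (hHε : ∀ n, IndepFun (H n) (ε n) (P n))
    (hHεZ : ∀ n, IndepFun (fun ω => (H n ω, ε n ω)) (fun ω => (Z n ω, μ n ω, N n ω)) (P n))
    (hHid : ∀ n j i i', IdentDistrib (fun ω => H n ω i j) (fun ω => H n ω i' j) (P n) (P n))
    (hεid : ∀ n i i', IdentDistrib (fun ω => ε n ω i) (fun ω => ε n ω i') (P n) (P n))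
    (Kη : Fin q → ℝ≥0) (Kε : ℝ≥0)
    (hHsub : ∀ n i j, HasSubgaussianMGF (fun ω => H n ω i j) (Kη j ^ 2) (P n))
    (hεsub : ∀ n i, HasSubgaussianMGF (fun ω => ε n ω i) (Kε ^ 2) (P n))
    (SigmaH : Matrix (Fin q) (Fin q) ℝ) (σε2 : ℝ)
    (hSigmaH : ∀ n i j k, covariance (fun ω => H n ω i j) (fun ω => H n ω i k) (P n) = SigmaH j k)
    (hσε : ∀ n i, variance (fun ω => ε n ω i) (P n) = σε2)
    (hSigmaInv : IsUnit SigmaH)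
    -- weak sparsity at rate `√n`, and the chosen sparsities
    (sγ sθ uγ uθ : ℕ → ℕ) (sδ uδ : ℕ → Fin q → ℕ)
    (hsγ : ExpWeights.WeaklySparse P Z μ sγ (fun n => √(n : ℝ)))
    (hsδ : ∀ j, ExpWeights.WeaklySparse P Z (fun n ω i => N n ω i j) (fun n => sδ n j)
      (fun n => √(n : ℝ)))
    (hsθ : ExpWeights.WeaklySparse P Z (fun n ω => Matrix.of (N n ω) *ᵥ β + μ n ω) sθ
      (fun n => √(n : ℝ)))
    (huγ : ∀ᶠ n in atTop, sγ n ≤ uγ n)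
    (huδ : ∀ᶠ n in atTop, ∀ j, sδ n j ≤ uδ n j)
    (huθ : ∀ᶠ n in atTop, sθ n ≤ uθ n)
    (hu : (fun n => ((max (uγ n) (max (Finset.univ.sup (uδ n)) (uθ n)) : ℕ) : ℝ))
      =o[atTop] fun n => √(n : ℝ) / Real.log (p n))
    -- the temperatures of the exponential weights
    (αY : ℝ) (αX : Fin q → ℝ)
    (hαY : 4 * (Kε : ℝ) ^ 2 < αY) (hαX : ∀ j, 4 * (Kη j : ℝ) ^ 2 < αX j) :
    TendstoInDistribution
      (fun (n : ℕ) ω => WithLp.toLp 2 (√(n : ℝ) •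
        (ExpWeights.betaEW (Matrix.of (Z n ω)) (uδ n) αX (uθ n) αY (Matrix.of (X n ω)) (Y n ω)
          - β)))
      atTop (id : EuclideanSpace ℝ (Fin q) → EuclideanSpace ℝ (Fin q)) P
      (multivariateGaussian 0 (σε2 • SigmaH⁻¹)) := by
  have hXH : ∀ n, X n = fun ω => N n ω + H n ω := fun n => funext (hX n)
  have hXm : ∀ n, Measurable (X n) := fun n => by
    rw [hXH]
    exact (hN n).add (hH n)
  have hYm : ∀ n, Measurable (Y n) := fun n => by
    rw [show Y n = _ from funext (hY n)]
    exact ((measurable_mulVec_const (hXm n) β).add (hμ n)).add (hε n)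
  have hcol : ∀ j n, Measurable fun x : Fin n → Fin q → ℝ => fun i => x i j := fun j n =>
    measurable_pi_lambda _ fun i => (measurable_pi_apply j).comp (measurable_pi_apply i)
  have hαY' : 0 < αY := lt_of_le_of_lt (by positivity) hαY
  have hαX' : ∀ j, 0 < αX j := fun j => lt_of_le_of_lt (by positivity) (hαX j)
  have huδ' : ∀ j, (fun n => (uδ n j : ℝ) * Real.log (p n)) =o[atTop] fun n => √(n : ℝ) := fun j =>
    isLittleO_mul_log_of_le hp hu fun n =>
      (Finset.le_sup (f := uδ n) (Finset.mem_univ j)).trans ((le_max_left _ _).trans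
        (le_max_right _ _))
  have huθ' : (fun n => (uθ n : ℝ) * Real.log (p n)) =o[atTop] fun n => √(n : ℝ) :=
    isLittleO_mul_log_of_le hp hu fun n => (le_max_right _ _).trans (le_max_right _ _)
  have hindδ : ∀ j n, IndepFun (fun ω => (H n ω, ε n ω)) (fun ω => (Z n ω, fun i => N n ω i j))
      (P n) := fun j n => by
    have hm : Measurable fun x : (Fin n → Fin (p n) → ℝ) × (Fin n → ℝ) × (Fin n → Fin q → ℝ) =>
        (x.1, fun i => x.2.2 i j) :=
      measurable_fst.prodMk ((hcol j n).comp (measurable_snd.comp measurable_snd))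
    exact (hHεZ n).comp measurable_id hm
  have hindθ : ∀ n, IndepFun (fun ω => (H n ω, ε n ω))
      (fun ω => (Z n ω, Matrix.of (N n ω) *ᵥ β + μ n ω)) (P n) := fun n => by
    have hm : Measurable fun x : (Fin n → Fin (p n) → ℝ) × (Fin n → ℝ) × (Fin n → Fin q → ℝ) =>
        (x.1, Matrix.of x.2.2 *ᵥ β + x.2.1) :=
      measurable_fst.prodMk ((measurable_mulVec_const (measurable_snd.comp measurable_snd) β).add
        (measurable_fst.comp measurable_snd))
    exact (hHεZ n).comp measurable_id hm
  -- The noise in column `j` of `X` is `H_j`, the combination with coefficients `Pi.single j 1` and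
  -- 0; for the response below it is `Hβ + ε`.
  have hδ := fun j => exists_fitError_bound_noise hp (huδ' j) (hsδ j) (huδ.mono fun n h => h j)
    (hαX' j) hZ (fun n => (hcol j n).comp (hN n)) hH hε hHindep hεindep hHε (hindδ j) hHsub hεsub
    (Pi.single j 1) 0
  obtain ⟨Bθ, hBθ, hboundθ⟩ := exists_fitError_bound_noise hp huθ' hsθ huθ hαY' hZ
    (fun n => (measurable_mulVec_const (hN n) β).add (hμ n)) hH hε hHindep hεindep hHε hindθ
    hHsub hεsub β 1
  choose Bδ hBδ hboundδ using hδ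
  set e : ∀ n, Ω n → Fin n → Fin q → ℝ := fun n ω i j =>
    fitError (Matrix.of (Z n ω)) (uδ n j) (αX j) (fun i => N n ω i j) (fun i => H n ω i j) i with he
  set e₀ : ∀ n, Ω n → Fin n → ℝ := fun n ω =>
    fitError (Matrix.of (Z n ω)) (uθ n) αY (Matrix.of (N n ω) *ᵥ β + μ n ω)
      (fun i => ∑ j, β j * H n ω i j + ε n ω i) with he₀
  set B : ∀ n, Ω n → ℝ := fun n ω => ∑ j, Bδ j n ω + Bθ n ω with hB
  have hBo : IsLittleOInProb P B fun n => √(n : ℝ) :=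
    (IsLittleOInProb.sum (fun n => Real.sqrt_nonneg _) fun j _ => hBδ j).add hBθ
  have hδ' : ∀ᶠ n in atTop, ∀ j ω,
      ‖(WithLp.toLp 2 fun i => e n ω i j : EuclideanSpace ℝ (Fin n))‖ ^ 2 ≤ Bδ j n ω ∧
      (∀ k, |inner ℝ (WithLp.toLp 2 fun i => H n ω i k : EuclideanSpace ℝ (Fin n))
        (WithLp.toLp 2 fun i => e n ω i j)| ≤ Bδ j n ω) ∧
      |inner ℝ (WithLp.toLp 2 (ε n ω) : EuclideanSpace ℝ (Fin n))
        (WithLp.toLp 2 fun i => e n ω i j)| ≤ Bδ j n ω := by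
    filter_upwards [eventually_all.2 hboundδ] with n hn j ω
    exact hn j ω (fun i => H n ω i j) (by funext i; simp [Pi.single_apply])
  have hθ' : ∀ᶠ n in atTop, ∀ ω,
      ‖(WithLp.toLp 2 (e₀ n ω) : EuclideanSpace ℝ (Fin n))‖ ^ 2 ≤ Bθ n ω ∧
      ∀ k, |inner ℝ (WithLp.toLp 2 fun i => H n ω i k : EuclideanSpace ℝ (Fin n))
        (WithLp.toLp 2 (e₀ n ω))| ≤ Bθ n ω := by
    filter_upwards [hboundθ] with n hn ω
    have h := hn ω (fun i => ∑ j, β j * H n ω i j + ε n ω i) (by simp)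
    exact ⟨h.1, h.2.1⟩
  -- The individual bounds are eventually nonnegative, as they dominate squared norms; hence their
  -- sum dominates each.
  have hBle : ∀ᶠ n in atTop, ∀ ω, (∀ j, Bδ j n ω ≤ B n ω) ∧ Bθ n ω ≤ B n ω := by
    filter_upwards [hδ', hθ'] with n h₁ h₂ ω
    have hδ0 : ∀ j, 0 ≤ Bδ j n ω := fun j => (sq_nonneg _).trans (h₁ j ω).1
    have hθ0 : 0 ≤ Bθ n ω := (sq_nonneg _).trans (h₂ ω).1
    refine ⟨fun j => ?_, ?_⟩
    · exact (Finset.single_le_sum (fun j _ => hδ0 j) (Finset.mem_univ j)).trans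
        (le_add_of_nonneg_right hθ0)
    · exact le_add_of_nonneg_left (Finset.sum_nonneg fun j _ => hδ0 j)
  have b₁ : ∀ᶠ n in atTop, ∀ ω j,
      ‖(WithLp.toLp 2 fun i => e n ω i j : EuclideanSpace ℝ (Fin n))‖ ^ 2 ≤ B n ω := by
    filter_upwards [hδ', hBle] with n h₁ h₂ ω j
    exact (h₁ j ω).1.trans ((h₂ ω).1 j)
  have b₂ : ∀ᶠ n in atTop, ∀ ω j k, |inner ℝ (WithLp.toLp 2 fun i => H n ω i j :
      EuclideanSpace ℝ (Fin n)) (WithLp.toLp 2 fun i => e n ω i k)| ≤ B n ω := by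
    filter_upwards [hδ', hBle] with n h₁ h₂ ω j k
    exact ((h₁ k ω).2.1 j).trans ((h₂ ω).1 k)
  have b₃ : ∀ᶠ n in atTop, ∀ ω k, |inner ℝ (WithLp.toLp 2 (ε n ω) : EuclideanSpace ℝ (Fin n))
      (WithLp.toLp 2 fun i => e n ω i k)| ≤ B n ω := by
    filter_upwards [hδ', hBle] with n h₁ h₂ ω k
    exact (h₁ k ω).2.2.trans ((h₂ ω).1 k)
  have b₄ : ∀ᶠ n in atTop, ∀ ω,
      ‖(WithLp.toLp 2 (e₀ n ω) : EuclideanSpace ℝ (Fin n))‖ ^ 2 ≤ B n ω := by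
    filter_upwards [hθ', hBle] with n h₁ h₂ ω
    exact (h₁ ω).1.trans (h₂ ω).2
  have b₅ : ∀ᶠ n in atTop, ∀ ω j, |inner ℝ (WithLp.toLp 2 fun i => H n ω i j :
      EuclideanSpace ℝ (Fin n)) (WithLp.toLp 2 (e₀ n ω))| ≤ B n ω := by
    filter_upwards [hθ', hBle] with n h₁ h₂ ω j
    exact ((h₁ ω).2 j).trans (h₂ ω).2
  have hscore := score_moments_and_limit hH hε hHindep hεindep hHε hHsub hεsub hSigmaH hσε
  set S : ∀ n, Ω n → Matrix (Fin q) (Fin q) ℝ := fun n ω => Matrix.of fun j k =>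
    ∑ i, (H n ω i j + e n ω i j) * (H n ω i k + e n ω i k) with hS
  set c : ∀ n, Ω n → Fin q → ℝ := fun n ω j =>
    ∑ i, (H n ω i j + e n ω i j) * (ε n ω i + e₀ n ω i - ∑ k, β k * e n ω i k) with hc
  set G : ∀ n, Ω n → Fin q → ℝ := fun n ω j => (√(n : ℝ))⁻¹ * ∑ i, H n ω i j * ε n ω i with hG
  set b : ∀ n, Ω n → Fin q → ℝ := fun n ω => betaEW (Matrix.of (Z n ω)) (uδ n) αX (uθ n) αY
    (Matrix.of (X n ω)) (Y n ω) - β with hb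
  have hbm : ∀ n, Measurable (b n) := fun n =>
    (measurable_betaEW (hZ n) (hXm n) (hYm n) _ _ _ _).sub_const β
  have hSlim : ∀ j k, IsLittleOInProb P (fun n ω => S n ω j k / n - SigmaH j k) fun _ => 1 := by
    intro j k
    have h := (isLittleOInProb_residual_gram_sub hBo b₁ b₂ j k).add
      (isLittleOInProb_gram_sub hH hHindep hHsub hSigmaH j k)
    simp only [sub_add_sub_cancel] at h
    exact h
  have hclim : ∀ j, IsLittleOInProb P (fun n ω => c n ω j / √(n : ℝ) - G n ω j) fun _ => 1 :=
    isLittleOInProb_residual_score_sub hBo b₁ b₂ b₃ b₄ b₅ β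
  have hGO : ∀ j, IsBigOInProb P (fun n ω => G n ω j) fun _ => 1 := by
    intro j
    have h := (hscore (Pi.single j 1)).1
    simpa [Pi.single_apply] using h
  have hbS : ∀ n ω, (S n ω).det ≠ 0 → b n ω = (S n ω)⁻¹ *ᵥ c n ω := by
    intro n ω hdet
    have h := betaEW_sub_eq (Matrix.of (Z n ω)) (uδ n) αX (uθ n) αY (N n ω) (H n ω) (μ n ω) (ε n ω)
      β (R := fun i j => H n ω i j + e n ω i j)
      (r := fun i => ε n ω i + e₀ n ω i - ∑ k, β k * e n ω i k) (fun _ _ => rfl) (fun _ => rfl) hdet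
    rw [hb]
    simp only [hY, hX]
    exact h
  have hlin := isLittleOInProb_linearized hSigmaInv hSlim hclim hGO hbS
  have hσ0 : 0 ≤ σε2 := hσε 1 0 ▸ variance_nonneg _ _
  refine tendstoInDistribution_of_charFun (b := fun n ω => WithLp.toLp 2 (√(n : ℝ) • b n ω))
    (fun n => (WithLp.measurable_toLp 2 _).comp ((hbm n).const_smul √(n : ℝ))) fun t => ?_
  -- The linearized estimator in direction `t` is `tᵀ Σ_H⁻¹ Hᵀε / √n`, so the score limit is taken
  -- in direction `tᵀ Σ_H⁻¹`.
  have hlim := (hscore (t ᵥ* SigmaH⁻¹)).2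
  rw [charFun_multivariateGaussian_zero_smul_inv hSigmaInv
    (posSemidef_of_covariance hHsub hSigmaH) hσ0]
  have hGt : ∀ n ω, ∑ j, ∑ k, t j * SigmaH⁻¹ j k * G n ω k
      = (√(n : ℝ))⁻¹ * ∑ i, (∑ k, (t ᵥ* SigmaH⁻¹) k * H n ω i k) * ε n ω i := by
    intro n ω
    have h : ∑ i, (∑ k, (t ᵥ* SigmaH⁻¹) k * H n ω i k) * ε n ω i
        = ∑ k, (t ᵥ* SigmaH⁻¹) k * ∑ i, H n ω i k * ε n ω i := by
      simp only [Finset.sum_mul, Finset.mul_sum, mul_assoc]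
      exact Finset.sum_comm
    rw [h, Finset.sum_comm, Finset.mul_sum]
    refine Finset.sum_congr rfl fun k _ => ?_
    rw [← Finset.sum_mul, Matrix.vecMul, dotProduct]
    ring
  have hdiff := tendsto_charFun_sub_of_isLittleOInProb
    (fun n => Finset.measurable_fun_sum Finset.univ fun j _ =>
      (((measurable_pi_apply j).comp (hbm n)).const_mul (√(n : ℝ))).const_mul (t j)) ?_ (hlin t)
  · have h := hdiff.add hlim
    simp only [hGt, sub_add_cancel, zero_add] at h
    simpa using h
  · intro n
    fun_prop
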